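/- **Notation.** $(a)_n=a(a+1)\cdots(a+n-1)$; $[n]_\mu=n+(1-(-1)^n)\mu$; $[n]_\mu!=[1]_\mu[2]_\mu\cdots[n]_\mu$; ${}_pF_q$ is the usual hypergeometric series (all series below terminate; for $n=0$ the second term of $J_n$, which carries the factor $n$, is $0$), and $L_n^{(\alpha)}(x)=\frac{(\alpha+1)_n}{n!}\,{}_1F_1\left({-n\atop \alpha+1};x\right)$. *Specialized Chihara polynomials:* $$P_{2n}(\lambda;\mu,\gamma)=(-1)^n\sqrt{\tfrac{n!\,\Gamma(\mu+\frac12)}{\Gamma(n+\mu+\frac12)}}\;L_n^{(\mu-\frac12)}\!\left(\tfrac{\lambda^2-\gamma^2}{2}\right),$$ $$P_{2n+1}(\lambda;\mu,\gamma)=(-1)^n\sqrt{\tfrac{n!\,\Gamma(\mu+\frac32)}{\Gamma(n+\mu+\frac32)}}\;\tfrac{\lambda-\gamma}{\sqrt{2\mu+1}}\;L_n^{(\mu+\frac12)}\!\left(\tfrac{\lambda^2-\gamma^2}{2}\right).$$ *Big $-1$ Jacobi polynomials:* with $X=\frac{1-x^2}{1-c^2}$, $$J_n(x;a,b,c)={}_2F_1\!\left({-\frac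 n2,\frac{n+a+b+2}{2}\atop \frac{a+1}{2}};X\right)+\tfrac{n(1-x)}{(1+c)(a+1)}\,{}_2F_1\!\left({1-\frac n2,\frac{n+a+b+2}{2}\atop\frac{a+3}{2}};X\right)\quad(n\text{ even}),$$ $$J_n(x;a,b,c)={}_2F_1\!\left({-\frac{n-1}2,\frac{n+a+b+1}{2}\atop \frac{a+1}{2}};X\right)-\tfrac{(n+a+b+1)(1-x)}{(1+c)(a+1)}\,{}_2F_1\!\left({-\frac{n-1}2,\frac{n+a+b+3}{2}\atop\frac{a+3}{2}};X\right)\quad(n\text{ odd}),$$ with normalization $$h_n(a,b)=\frac{2\,\Gamma(\frac{n+b+1}{2})\Gamma(\frac{n+a+3}{2})(\frac n2)!}{(n+a+1)\Gamma(\frac{n+a+b+2}{2})(\frac{a+1}{2})_{n/2}^2}\ (n\text{ even}),\qquad h_n(a,b)=\frac{(n+a+b+1)\Gamma(\frac{n+b+2}{2})\Gamma(\frac{n+a+2}{2})(\frac{n-1}2)!}{2\,\Gamma(\frac{n+a+b+3}{2})(\frac{a+1}{2})_{(n+1)/2}^2}\ (n\text{ odd}).$$ *Dual $-1$ Hahn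 polynomials:* for $N$ even, with $\delta=-\frac{\eta+\xi+N}{2}$, $$R_n(x;\eta,\xi,N)=16^{\frac n2}(-\tfrac N2)_{\frac n2}(\tfrac{1-2\eta-N}{2})_{\frac n2}\,{}_3F_2\!\left({-\frac n2,\delta+\frac{x+1}4,\delta-\frac{x+1}4\atop -\frac N2,\frac{1-2\eta-N}{2}};1\right)\quad(n\text{ even}),$$ $$R_n(x;\eta,\xi,N)=16^{\frac{n-1}2}(1-\tfrac N2)_{\frac{n-1}2}(\tfrac{1-2\eta-N}{2})_{\frac{n-1}2}(x+2\eta+2\xi+1)\,{}_3F_2\!\left({-\frac{n-1}2,\delta+\frac{x+1}4,\delta-\frac{x+1}4\atop 1-\frac N2,\frac{1-2\eta-N}{2}};1\right)\quad(n\text{ odd});$$ for $N$ odd, with $\delta=\frac{\eta+\xi+1}{2}$, $$R_n(x;\eta,\xi,N)=16^{\frac n2}(\tfrac{1-N}2)_{\frac n2}(\tfrac{2\xi+1}{2})_{\frac n2}\,{}_3F_2\!\left({-\frac n2,\delta+\frac{x+1}4,\delta-\frac{x+1}4\atop \frac{1-N}2,\frac{2\xi+1}{2}};1\right)\quad(n\text{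 even}),$$ $$R_n(x;\eta,\xi,N)=16^{\frac{n-1}2}(\tfrac{1-N}2)_{\frac{n-1}2}(\tfrac{2\xi+3}{2})_{\frac{n-1}2}(x+2\xi-2\eta+1)\,{}_3F_2\!\left({-\frac{n-1}2,\delta+\frac{x+1}4,\delta-\frac{x+1}4\atop \frac{1-N}2,\frac{2\xi+3}{2}};1\right)\quad(n\text{ odd}).$$ For $N$ even, let $$\varpi_s(\eta,\xi,N)=(-1)^{\frac s2}\frac{(-\frac N2)_{\frac s2}(-\frac N2-\eta+\frac12)_{\frac s2}(-N-\eta-\xi)_{\frac s2}}{\frac s2!\,(-\frac N2-\xi+\frac12)_{\frac s2}(-\frac N2-\eta-\xi)_{\frac s2}}\quad(s\text{ even}),$$ $$\varpi_s(\eta,\xi,N)=(-1)^{\frac{s-1}2}\frac{(-\frac N2)_{\frac{s+1}2}(-\frac N2-\eta+\frac12)_{\frac{s-1}2}(-N-\eta-\xi)_{\frac{s-1}2}}{\frac{s-1}2!\,(-\frac N2-\xi+\frac12)_{\frac{s-1}2}(-\frac N2-\eta-\xi)_{\frac{s+1}2}}\quad(s\text{ odd}),$$ $\nu_0(\eta,\xi,N)=\dfrac{(-N-\eta-\xi)_{N/2}}{(\frac{-N-2\xi+1}{2})_{N/2}}$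 and $\rho_s(\eta,\xi,N)=\varpi_{N-s}(\eta,\xi,N)$. For $N$ odd, let $$\varpi_s(\eta,\xi,N)=(-1)^{\frac s2}\frac{(\frac{1-N}2)_{\frac s2}(\xi+\frac12)_{\frac s2}(\eta+\xi+1)_{\frac s2}}{\frac s2!\,(\eta+\frac12)_{\frac s2}(\frac{N+3}2+\eta+\xi)_{\frac s2}}\quad(s\text{ even}),$$ $$\varpi_s(\eta,\xi,N)=(-1)^{\frac{s-1}2}\frac{(\frac{1-N}2)_{\frac{s-1}2}(\xi+\frac12)_{\frac{s+1}2}(\eta+\xi+1)_{\frac{s-1}2}}{\frac{s-1}2!\,(\eta+\frac12)_{\frac{s+1}2}(\frac{N+3}2+\eta+\xi)_{\frac{s-1}2}}\quad(s\text{ odd}),$$ $\nu_0(\eta,\xi,N)=\dfrac{(\eta+\xi+1)_{(N+1)/2}}{(\eta+\frac12)_{(N+1)/2}}$ and $\rho_s(\eta,\xi,N)=\varpi_s(\eta,\xi,N)$. For all $N$, $z_s=z_s(\eta,\xi,N)=(-1)^{s+N+1}(2s+2\eta+2\xi+1)$. **Proposition (first convolution identity).** Let $\mu_1,\mu_2>0$,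 $\epsilon_1,\epsilon_2\in\{1,-1\}$, $N,j\in\{0,1,2,\dots\}$, and let $c,\lambda_1,\lambda_2$ be real with $|\lambda_2|>|c|$. Put $\mu_{12}=\mu_1+\mu_2+j+\frac12$, $\epsilon_{12}=\epsilon_1\epsilon_2(-1)^j$, $$\phi(n_1,n_2,j)=\tfrac{n_1(n_1-1)}{2}+\tfrac{j(j+1)}{2}+n_1(n_1+n_2+1),$$ $$K_j(\lambda_2;\mu_2,\mu_1;c)=\sqrt{\left(\tfrac{\lambda_2^2-c^2}{2}\right)^j\left(\tfrac{\lambda_2-c\epsilon_1\epsilon_2}{\lambda_2-(-1)^jc\epsilon_1\epsilon_2}\right)\frac{\Gamma(\mu_1+\frac12)\Gamma(\mu_2+\frac12)}{\Gamma(\mu_{12}+\frac12)\,h_j(2\mu_2,2\mu_1)}}\,.$$ Then $$\operatorname{sign}(\lambda_2)^j\,K_j(\lambda_2;\mu_2,\mu_1;c)\,P_N(\lambda_2;\mu_{12},c\epsilon_{12})\,J_j\!\left(\tfrac{\epsilon_2\lambda_1}{\lambda_2};2\mu_2,2\mu_1,-\tfrac{c\epsilon_1\epsilon_2}{\lambda_2}\right)$$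 $$=\sum_{n_1+n_2=N+j}(-1)^{\phi(n_1,n_2,j)}\left(\tfrac{\epsilon_2}{2}\right)^{n_1}\sqrt{\frac{[n_2]_{\mu_2}!\,\rho_j(\mu_2,\mu_1,n_1+n_2)}{[n_1]_{\mu_1}!\,[n_1+n_2]_{\mu_2}!\,\nu_0(\mu_2,\mu_1,n_1+n_2)}}\;R_{n_1}(z_j;\mu_2,\mu_1,n_1+n_2)\,P_{n_1}(\lambda_1;\mu_1,c\epsilon_1)\,P_{n_2}(\lambda_2;\mu_2,\lambda_1\epsilon_2),$$ where the sum is over integers $n_1,n_2\ge0$, $z_j=z_j(\mu_2,\mu_1,n_1+n_2)$, and all square roots are the nonnegative ones. -/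

import Mathlib

open scoped Nat

namespace DunklOP

noncomputable section

/-- The Pochhammer symbol `(a)_n = a (a+1) ⋯ (a+n-1)`. -/
def poch (a : ℝ) (n : ℕ) : ℝ := (ascPochhammer ℝ n).eval a

/-- The `μ`-number `[n]_μ = n + (1 - (-1)^n) μ`. -/
def muNumber (n : ℕ) (μ : ℝ) : ℝ := (n : ℝ) + (1 - (-1) ^ n) * μ

/-- The `μ`-factorial `[n]_μ! = [1]_μ [2]_μ ⋯ [n]_μ`. -/
def muFactorial (n : ℕ) (μ : ℝ) : ℝ := ∏ k ∈ Finset.Icc 1 n, muNumber k μ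

/-- The hypergeometric series `₁F₁(a; b; x)`. -/
def hyp1F1 (a b x : ℝ) : ℝ := ∑' k : ℕ, poch a k / (poch b k * k !) * x ^ k

/-- The hypergeometric series `₃F₂(a₁, a₂, a₃; b₁, b₂; x)`. When `a₁ = -m` with `m : ℕ` it is a
finite sum: the terms with `k > m` vanish because of the factor `(-m)_k`. -/
def hyp3F2 (a₁ a₂ a₃ b₁ b₂ x : ℝ) : ℝ :=
  ∑' k : ℕ, poch a₁ k * poch a₂ k * poch a₃ k / (poch b₁ k * poch b₂ k * k !) * x ^ k

/-- The Laguerre polynomial `L_n^{(α)}(x)`. -/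
def laguerre (n : ℕ) (α x : ℝ) : ℝ := poch (α + 1) n / n ! * hyp1F1 (-n) (α + 1) x

/-- The Specialized Chihara polynomial `P_n(x; μ, γ)`; below `n / 2` is the integer part. -/
def chihara (n : ℕ) (x μ γ : ℝ) : ℝ :=
  if Even n then
    (-1) ^ (n / 2) *
      √((n / 2)! * Real.Gamma (μ + 1 / 2) / Real.Gamma ((n / 2 : ℕ) + μ + 1 / 2)) *
      laguerre (n / 2) (μ - 1 / 2) ((x ^ 2 - γ ^ 2) / 2)
  else
    (-1) ^ (n / 2) *
      √((n / 2)! * Real.Gamma (μ + 3 / 2) / Real.Gamma ((n / 2 : ℕ) + μ + 3 / 2)) *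
      ((x - γ) / √(2 * μ + 1)) *
      laguerre (n / 2) (μ + 1 / 2) ((x ^ 2 - γ ^ 2) / 2)

/-- The Big `-1` Jacobi polynomial `J_n(x; a, b, c)`. -/
def bigJacobi (n : ℕ) (x a b c : ℝ) : ℝ :=
  if Even n then
    ₂F₁ (-((n : ℝ) / 2)) ((n + a + b + 2) / 2) ((a + 1) / 2) ((1 - x ^ 2) / (1 - c ^ 2)) +
      n * (1 - x) / ((1 + c) * (a + 1)) *
        ₂F₁ (1 - (n : ℝ) / 2) ((n + a + b + 2) / 2) ((a + 3) / 2) ((1 - x ^ 2) / (1 - c ^ 2))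
  else
    ₂F₁ (-(((n : ℝ) - 1) / 2)) ((n + a + b + 1) / 2) ((a + 1) / 2) ((1 - x ^ 2) / (1 - c ^ 2)) -
      (n + a + b + 1) * (1 - x) / ((1 + c) * (a + 1)) *
        ₂F₁ (-(((n : ℝ) - 1) / 2)) ((n + a + b + 3) / 2) ((a + 3) / 2)
          ((1 - x ^ 2) / (1 - c ^ 2))

/-- The normalization factor `h_n(a, b)` of the Big `-1` Jacobi polynomials. -/
def bigJacobiNorm (n : ℕ) (a b : ℝ) : ℝ :=
  if Even n then
    2 * Real.Gamma ((n + b + 1) / 2) * Real.Gamma ((n + a + 3) / 2) * (n / 2)! /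
      ((n + a + 1) * Real.Gamma ((n + a + b + 2) / 2) * poch ((a + 1) / 2) (n / 2) ^ 2)
  else
    (n + a + b + 1) * Real.Gamma ((n + b + 2) / 2) * Real.Gamma ((n + a + 2) / 2) *
        ((n - 1) / 2)! /
      (2 * Real.Gamma ((n + a + b + 3) / 2) * poch ((a + 1) / 2) ((n + 1) / 2) ^ 2)

/-- The dual `-1` Hahn polynomial `R_n(x; η, ξ, N)`. -/
def dualHahn (n : ℕ) (x η ξ : ℝ) (N : ℕ) : ℝ :=
  if Even N then
    let δ : ℝ := -((η + ξ + N) / 2)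
    if Even n then
      16 ^ (n / 2) * poch (-((N : ℝ) / 2)) (n / 2) * poch ((1 - 2 * η - N) / 2) (n / 2) *
        hyp3F2 (-((n : ℝ) / 2)) (δ + (x + 1) / 4) (δ - (x + 1) / 4)
          (-((N : ℝ) / 2)) ((1 - 2 * η - N) / 2) 1
    else
      16 ^ ((n - 1) / 2) * poch (1 - (N : ℝ) / 2) ((n - 1) / 2) *
        poch ((1 - 2 * η - N) / 2) ((n - 1) / 2) * (x + 2 * η + 2 * ξ + 1) *
        hyp3F2 (-(((n : ℝ) - 1) / 2)) (δ + (x + 1) / 4) (δ - (x + 1) / 4)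
          (1 - (N : ℝ) / 2) ((1 - 2 * η - N) / 2) 1
  else
    let δ : ℝ := (η + ξ + 1) / 2
    if Even n then
      16 ^ (n / 2) * poch ((1 - (N : ℝ)) / 2) (n / 2) * poch ((2 * ξ + 1) / 2) (n / 2) *
        hyp3F2 (-((n : ℝ) / 2)) (δ + (x + 1) / 4) (δ - (x + 1) / 4)
          ((1 - (N : ℝ)) / 2) ((2 * ξ + 1) / 2) 1
    else
      16 ^ ((n - 1) / 2) * poch ((1 - (N : ℝ)) / 2) ((n - 1) / 2) *
        poch ((2 * ξ + 3) / 2) ((n - 1) / 2) * (x + 2 * ξ - 2 * η + 1) *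
        hyp3F2 (-(((n : ℝ) - 1) / 2)) (δ + (x + 1) / 4) (δ - (x + 1) / 4)
          ((1 - (N : ℝ)) / 2) ((2 * ξ + 3) / 2) 1

/-- The weights `ϖ_s(η, ξ, N)` of the dual `-1` Hahn polynomials. -/
def dualHahnWeight (s : ℕ) (η ξ : ℝ) (N : ℕ) : ℝ :=
  if Even N then
    if Even s then
      (-1) ^ (s / 2) *
        (poch (-((N : ℝ) / 2)) (s / 2) * poch (-((N : ℝ) / 2) - η + 1 / 2) (s / 2) *
          poch (-(N : ℝ) - η - ξ) (s / 2)) /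
        ((s / 2)! * poch (-((N : ℝ) / 2) - ξ + 1 / 2) (s / 2) *
          poch (-((N : ℝ) / 2) - η - ξ) (s / 2))
    else
      (-1) ^ ((s - 1) / 2) *
        (poch (-((N : ℝ) / 2)) ((s + 1) / 2) * poch (-((N : ℝ) / 2) - η + 1 / 2) ((s - 1) / 2) *
          poch (-(N : ℝ) - η - ξ) ((s - 1) / 2)) /
        (((s - 1) / 2)! * poch (-((N : ℝ) / 2) - ξ + 1 / 2) ((s - 1) / 2) *
          poch (-((N : ℝ) / 2) - η - ξ) ((s + 1) / 2))
  else
    if Even s then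
      (-1) ^ (s / 2) *
        (poch ((1 - (N : ℝ)) / 2) (s / 2) * poch (ξ + 1 / 2) (s / 2) *
          poch (η + ξ + 1) (s / 2)) /
        ((s / 2)! * poch (η + 1 / 2) (s / 2) * poch (((N : ℝ) + 3) / 2 + η + ξ) (s / 2))
    else
      (-1) ^ ((s - 1) / 2) *
        (poch ((1 - (N : ℝ)) / 2) ((s - 1) / 2) * poch (ξ + 1 / 2) ((s + 1) / 2) *
          poch (η + ξ + 1) ((s - 1) / 2)) /
        (((s - 1) / 2)! * poch (η + 1 / 2) ((s + 1) / 2) *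
          poch (((N : ℝ) + 3) / 2 + η + ξ) ((s - 1) / 2))

/-- The normalization factors `ν_n(η, ξ, N)` of the dual `-1` Hahn polynomials. -/
def dualHahnNorm (n : ℕ) (η ξ : ℝ) (N : ℕ) : ℝ :=
  if Even N then
    if Even n then
      16 ^ n * (n / 2)! * poch (-((N : ℝ) / 2)) (n / 2) * poch (ξ + 1 / 2) (n / 2) *
        poch ((-(N : ℝ) - 2 * η + 1) / 2) (n / 2) *
        (poch (-(N : ℝ) - η - ξ) (N / 2) / poch ((-(N : ℝ) - 2 * ξ + 1) / 2) (N / 2))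
    else
      -(16 ^ n * ((n - 1) / 2)! * poch (-((N : ℝ) / 2)) ((n + 1) / 2) *
        poch (ξ + 1 / 2) ((n + 1) / 2) * poch ((-(N : ℝ) - 2 * η + 1) / 2) ((n - 1) / 2) *
        (poch (-(N : ℝ) - η - ξ) (N / 2) / poch ((-(N : ℝ) - 2 * ξ + 1) / 2) (N / 2)))
  else
    if Even n then
      16 ^ n * (n / 2)! * poch ((1 - (N : ℝ)) / 2) (n / 2) * poch (ξ + 1 / 2) (n / 2) *
        poch (-((N : ℝ) / 2) - η) (n / 2) *
        (poch (η + ξ + 1) ((N + 1) / 2) / poch (η + 1 / 2) ((N + 1) / 2))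
    else
      -(16 ^ n * ((n - 1) / 2)! * poch ((1 - (N : ℝ)) / 2) ((n - 1) / 2) *
        poch (ξ + 1 / 2) ((n + 1) / 2) * poch (-((N : ℝ) / 2) - η) ((n + 1) / 2) *
        (poch (η + ξ + 1) ((N + 1) / 2) / poch (η + 1 / 2) ((N + 1) / 2)))

/-- The grid points `z_s = (-1)^(s+N+1) (2s + 2η + 2ξ + 1)`. -/
def dualHahnGrid (s : ℕ) (η ξ : ℝ) (N : ℕ) : ℝ :=
  (-1) ^ (s + N + 1) * (2 * s + 2 * η + 2 * ξ + 1)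

/-- The reindexed weights `ρ_s(η, ξ, N)` (used for `s ≤ N`). -/
def dualHahnRho (s : ℕ) (η ξ : ℝ) (N : ℕ) : ℝ :=
  if Even N then dualHahnWeight (N - s) η ξ N else dualHahnWeight s η ξ N

/-- The phase exponent `φ(n₁, n₂, j)`; both halves are exact divisions. -/
def phase (n₁ n₂ j : ℕ) : ℕ :=
  n₁ * (n₁ - 1) / 2 + j * (j + 1) / 2 + n₁ * (n₁ + n₂ + 1)

/-- The parameter `μ₁₂ = μ₁ + μ₂ + j + 1/2`. -/
def muCoupled (μ₁ μ₂ : ℝ) (j : ℕ) : ℝ := μ₁ + μ₂ + j + 1 / 2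

/-- The parameter `ε₁₂ = ε₁ ε₂ (-1)^j`. -/
def epsCoupled (ε₁ ε₂ : ℝ) (j : ℕ) : ℝ := ε₁ * ε₂ * (-1) ^ j

/-- The factor `K_j(y; μ₂, μ₁; c)`, which also depends on the signs `ε₁, ε₂`. -/
def convK (j : ℕ) (y μ₂ μ₁ c ε₁ ε₂ : ℝ) : ℝ :=
  √(((y ^ 2 - c ^ 2) / 2) ^ j *
    ((y - c * ε₁ * ε₂) / (y - (-1) ^ j * c * ε₁ * ε₂)) *
    (Real.Gamma (μ₁ + 1 / 2) * Real.Gamma (μ₂ + 1 / 2) /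
      (Real.Gamma (muCoupled μ₁ μ₂ j + 1 / 2) * bigJacobiNorm j (2 * μ₂) (2 * μ₁))))

end

end DunklOP

open DunklOP

namespace DunklOP

open Finset hiding antidiagonal mem_antidiagonal
open Finset.HasAntidiagonal

/-! ### Pochhammer symbols -/

/-! The identity is two classical Laguerre convolutions glued together. Up to normalization, a
Chihara polynomial of degree `2n` or `2n + 1` is a Laguerre polynomial in `(λ² - γ²) / 2`, times `λ
- γ` in odd degree. With `x = (x₁² - c²) / 2` and `y = (x₂² - x₁²) / 2`, the two factors of a
summand are Laguerre polynomials in `x` and in `y`, and the left side contains one in `x + y = (x₂²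
- c²) / 2`.

The core is `lag_conv_hahn`: with Hahn polynomials of degree `J` as weights, `∑ L_a(x) L_b(y)` over
`a + b = n + J` is a Jacobi polynomial homogenized to degree `J` in `x, y`, times `L_n(x + y)` with
parameter raised by `2J`. The generating function `G_A(x; t) = (1 - t)^(-A) exp(-x t / (1 - t))`
satisfies `G_A(x) G_B(y) = G_{A+B}(x + y)`, which is `lag_conv`. A weight `(-a)_k (-b)_l`
differentiates the two factors `k` and `l` times (`lag_add`). In the Hahn combination of these
weights, an alternating binomial sum kills every term of total degree below `J` in `x, y`
(`hahnSymm_conv`). The remaining work on this part is to recognize the series: Chu–Vandermonde turns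
the symmetric Hahn and Jacobi sums into `₃F₂` and `₂F₁`, and `hyp3F2_transform` gives the second
`₃F₂` form needed when `N + j` is even.

For fixed `N + j` the pairs `(n₁, n₂)` fall into two parity classes: even-even and odd-odd, or
even-odd and odd-even. In each class the dual `-1` Hahn polynomial is a Hahn `₃F₂`, so the class
sums by `lag_conv_hahn` or its dual form. Both sums carry the same Laguerre factor in `x + y`. Their
two Jacobi `₂F₁` combine into the Big `-1` Jacobi polynomial by a contiguous relation, a different
one for each of the four parities of `(N, j)`.

Square roots are kept apart. `√([n]_μ!)` times a Chihara polynomial contains no root, and the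
remaining root in the summand depends only on `n₁ + n₂ = N + j`. It therefore leaves the sum, and
`norm_ratio_ee` and its companions show that the squared constants of the two sides differ by the
square of an explicit nonnegative number. -/

@[simp] lemma poch_zero (a : ℝ) : poch a 0 = 1 := by simp [poch]

@[simp] lemma poch_one (a : ℝ) : poch a 1 = a := by simp [poch]

lemma poch_succ (a : ℝ) (n : ℕ) : poch a (n + 1) = poch a n * (a + n) := by
  simp [poch, ascPochhammer_succ_eval]

lemma poch_succ_left (a : ℝ) (n : ℕ) : poch a (n + 1) = a * poch (a + 1) n := by
  induction n with
  | zero => simp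
  | succ n ih => rw [poch_succ, ih, poch_succ]; push_cast; ring

lemma poch_add (a : ℝ) (m n : ℕ) : poch a (m + n) = poch a m * poch (a + m) n := by
  induction n with
  | zero => simp
  | succ n ih => rw [← add_assoc, poch_succ, ih, poch_succ]; push_cast; ring

lemma poch_pos {a : ℝ} (ha : 0 < a) (n : ℕ) : 0 < poch a n := ascPochhammer_pos n a ha

lemma poch_ne {a : ℝ} (ha : 0 < a) (n : ℕ) : poch a n ≠ 0 := (poch_pos ha n).ne'

/-- The factors are the same in reverse order with opposite signs. This trades the negative
parameters of the Hahn weights for positive ones, where nonvanishing is clear. -/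
lemma poch_reflect (a : ℝ) (n : ℕ) : poch (1 - a - n) n = (-1) ^ n * poch a n := by
  induction n with
  | zero => simp
  | succ n ih =>
    rw [poch_succ_left, poch_succ, show 1 - a - ((n + 1 : ℕ) : ℝ) + 1 = 1 - a - n by push_cast; ring,
      ih]
    push_cast; ring

/-- Writing `n = k + l` instead of `l = n - k` suits antidiagonal sums and avoids truncated
subtraction. -/
lemma poch_neg_nat {n k l : ℕ} (h : k + l = n) :
    poch (-(n : ℝ)) k = (-1) ^ k * (n ! / l !) := by
  induction k generalizing l with
  | zero =>
    obtain rfl : l = n := by omega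
    simp [Nat.factorial_ne_zero]
  | succ k ih =>
    have hl : ((l + 1 : ℕ) ! : ℝ) = (l + 1) * l ! := by rw [Nat.factorial_succ]; push_cast; ring
    have h1 : (l ! : ℝ) ≠ 0 := by positivity
    have h2 : (l + 1 : ℝ) ≠ 0 := by positivity
    rw [poch_succ, ih (l := l + 1) (by omega), hl, ← h]
    push_cast
    field_simp
    ring

lemma poch_neg_nat_ne {n k : ℕ} (h : k ≤ n) : poch (-(n : ℝ)) k ≠ 0 := by
  obtain ⟨l, rfl⟩ := Nat.exists_eq_add_of_le h
  rw [poch_neg_nat rfl]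
  positivity

lemma poch_neg_nat_eq_zero {n k : ℕ} (h : n < k) : poch (-(n : ℝ)) k = 0 :=
  ascPochhammer_eval_neg_coe_nat_of_lt h

/-- Reassociation of a triple sum. -/
lemma sum_antidiagonal_assoc (f : ℕ → ℕ → ℕ → ℝ) (n : ℕ) :
    ∑ p ∈ antidiagonal n, ∑ q ∈ antidiagonal p.1, f q.1 q.2 p.2 =
      ∑ p ∈ antidiagonal n, ∑ q ∈ antidiagonal p.2, f p.1 q.1 q.2 := by
  rw [sum_sigma', sum_sigma']
  refine sum_nbij' (fun x => ⟨(x.2.1, x.2.2 + x.1.2), (x.2.2, x.1.2)⟩)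
    (fun x => ⟨(x.1.1 + x.2.1, x.2.2), (x.1.1, x.2.1)⟩) ?_ ?_ ?_ ?_ ?_
  · rintro ⟨⟨a, b⟩, ⟨c, d⟩⟩ h
    simp only [mem_sigma, mem_antidiagonal] at h ⊢
    obtain ⟨h1, rfl⟩ := h
    exact ⟨by rw [← h1]; ring, trivial⟩
  · rintro ⟨⟨a, b⟩, ⟨c, d⟩⟩ h
    simp only [mem_sigma, mem_antidiagonal] at h ⊢
    obtain ⟨h1, rfl⟩ := h
    exact ⟨by rw [← h1]; ring, trivial⟩
  · rintro ⟨⟨a, b⟩, ⟨c, d⟩⟩ h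
    simp only [mem_sigma, mem_antidiagonal] at h ⊢
    obtain ⟨h1, rfl⟩ := h
    rfl
  · rintro ⟨⟨a, b⟩, ⟨c, d⟩⟩ h
    simp only [mem_sigma, mem_antidiagonal] at h ⊢
    obtain ⟨h1, rfl⟩ := h
    rfl
  · rintro ⟨⟨a, b⟩, ⟨c, d⟩⟩ h
    rfl

/-! ### Chu–Vandermonde and Pfaff–Saalschütz summations, free of parameters in denominators. -/

lemma choose_cast_of_add {n k l : ℕ} (h : k + l = n) :
    (n.choose k : ℝ) = n ! / (k ! * l !) := by
  subst h
  rw [Nat.cast_add_choose]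

/-- The Chu–Vandermonde identity, with binomial coefficients. -/
lemma vandermonde_choose (b c : ℝ) (l : ℕ) :
    ∑ p ∈ antidiagonal l, (l.choose p.1 : ℝ) * ((-1) ^ p.1 * poch b p.1 * poch (c + p.1) p.2) =
      poch (c - b) l := by
  induction l generalizing b c with
  | zero => simp
  | succ l ih =>
    -- Pascal's rule splits the sum in two. The induction hypothesis at `(b, c)` and at `(b + 1, c +
    -- 1)` gives the same value `(c - b)_l` with factors `c + l` and `-b`, whose sum is the new
    -- factor `c - b + l`.
    rw [sum_antidiagonal_choose_succ_mul (fun i j => (-1) ^ i * poch b i * poch (c + i) j)]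
    have h1 : ∑ p ∈ antidiagonal l, (l.choose p.1 : ℝ) *
        ((-1) ^ p.1 * poch b p.1 * poch (c + p.1) (p.2 + 1)) = (c + l) * poch (c - b) l := by
      rw [← ih b c, mul_sum]
      refine sum_congr rfl fun p hp => ?_
      rw [mem_antidiagonal] at hp
      rw [poch_succ, ← hp]; push_cast; ring
    have h2 : ∑ p ∈ antidiagonal l, (l.choose p.2 : ℝ) *
        ((-1) ^ (p.1 + 1) * poch b (p.1 + 1) * poch (c + (p.1 + 1 : ℕ)) p.2) =
          -b * poch (c - b) l := by
      rw [show c - b = (c + 1) - (b + 1) by ring, ← ih (b + 1) (c + 1), mul_sum]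
      refine sum_congr rfl fun p hp => ?_
      rw [mem_antidiagonal] at hp
      rw [poch_succ_left, show c + ((p.1 + 1 : ℕ) : ℝ) = c + 1 + p.1 by push_cast; ring,
        Nat.choose_symm_of_eq_add hp.symm]
      ring
    rw [h1, h2, poch_succ]; ring

/-- The Chu–Vandermonde identity. -/
lemma vandermonde (b c : ℝ) (l : ℕ) :
    ∑ p ∈ antidiagonal l, (-1) ^ p.1 * poch b p.1 * poch (c + p.1) p.2 / (p.1 ! * p.2 !) =
      poch (c - b) l / l ! := by
  rw [← vandermonde_choose, sum_div]
  refine sum_congr rfl fun p hp => ?_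
  rw [choose_cast_of_add (mem_antidiagonal.1 hp)]
  field_simp

/-- The coefficient of `t^d` in `e^(-t) e^t = 1`. It is Vandermonde at `b = c = 1`, where `(1)_k (1
+ k)_{d-k} = (1)_d` does not depend on `k`. -/
lemma sum_alternating (d : ℕ) :
    ∑ p ∈ antidiagonal d, (-1 : ℝ) ^ p.1 / (p.1 ! * p.2 !) = if d = 0 then 1 else 0 := by
  have h := vandermonde 1 1 d
  have h1 : poch 1 d ≠ 0 := poch_ne one_pos d
  have h2 : ∑ p ∈ antidiagonal d, (-1) ^ p.1 * poch 1 p.1 * poch (1 + p.1) p.2 / (p.1 ! * p.2 !)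
      = poch 1 d * ∑ p ∈ antidiagonal d, (-1 : ℝ) ^ p.1 / (p.1 ! * p.2 !) := by
    rw [mul_sum]
    refine sum_congr rfl fun p hp => ?_
    rw [← mem_antidiagonal.1 hp, poch_add]; ring
  rw [h2] at h
  split_ifs with hd
  · subst hd; simp
  · obtain ⟨e, rfl⟩ := Nat.exists_eq_succ_of_ne_zero hd
    have h3 : poch ((1 : ℝ) - 1) (e + 1) = 0 := by rw [poch_succ_left]; simp
    simp only [Nat.succ_eq_add_one] at h h1 ⊢
    rw [h3, zero_div] at h
    exact (mul_eq_zero.1 h).resolve_left h1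

/-- The Pfaff–Saalschütz identity. -/
lemma pfaff_saalschutz (u v e : ℝ) (s : ℕ) :
    ∑ p ∈ antidiagonal s, poch u p.1 * poch v p.1 * poch (e - u - v) p.2 * poch (e + p.1) p.2 /
      (p.1 ! * p.2 !) = poch (e - u) s * poch (e - v) s / s ! := by
  -- The factor `(e - u - v)_{s-k}` is itself expanded by Vandermonde. After reassociating the
  -- triple sum, the inner sum and then the outer one are again Vandermonde sums.
  have h1 : ∀ p ∈ antidiagonal s, poch u p.1 * poch v p.1 * poch (e - u - v) p.2 *
      poch (e + p.1) p.2 / (p.1 ! * p.2 !) = ∑ q ∈ antidiagonal p.2,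
        (-1) ^ q.1 * poch u (p.1 + q.1) * poch v p.1 * poch (e - v + (p.1 + q.1 : ℕ)) q.2 *
          poch (e + p.1) (q.1 + q.2) / (p.1 ! * q.1 ! * q.2 !) := by
    intro p hp
    have := vandermonde (u + p.1) (e - v + p.1) p.2
    rw [show e - v + p.1 - (u + p.1) = e - u - v by ring] at this
    rw [show poch u p.1 * poch v p.1 * poch (e - u - v) p.2 * poch (e + p.1) p.2 / (p.1 ! * p.2 !) =
      poch u p.1 * poch v p.1 * poch (e + p.1) p.2 / p.1 ! * (poch (e - u - v) p.2 / p.2 !) by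
        field_simp, ← this, mul_sum]
    refine sum_congr rfl fun q hq => ?_
    rw [mem_antidiagonal.1 hq, poch_add]
    push_cast
    rw [← add_assoc]
    field_simp
  rw [sum_congr rfl h1, ← sum_antidiagonal_assoc (fun a b c => (-1) ^ b * poch u (a + b) *
    poch v a * poch (e - v + (a + b : ℕ)) c * poch (e + a) (b + c) / (a ! * b ! * c !))]
  have h2 : ∀ p ∈ antidiagonal s, ∑ q ∈ antidiagonal p.1,
      (-1) ^ q.2 * poch u (q.1 + q.2) * poch v q.1 * poch (e - v + (q.1 + q.2 : ℕ)) p.2 *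
        poch (e + q.1) (q.2 + p.2) / (q.1 ! * q.2 ! * p.2 !) =
      poch (e - v) s * ((-1) ^ p.1 * poch u p.1 * poch (e + p.1) p.2 / (p.1 ! * p.2 !)) := by
    intro p hp
    have h3 := vandermonde v e p.1
    rw [show poch (e - v) s * ((-1) ^ p.1 * poch u p.1 * poch (e + p.1) p.2 / (p.1 ! * p.2 !)) =
      (-1) ^ p.1 * poch u p.1 * poch (e + p.1) p.2 * poch (e - v + p.1) p.2 / p.2 ! *
        (poch (e - v) p.1 / p.1 !) by
        rw [← mem_antidiagonal.1 hp, poch_add]; field_simp, ← h3, mul_sum]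
    refine sum_congr rfl fun q hq => ?_
    rw [poch_add (e + q.1), add_assoc e, ← Nat.cast_add, mem_antidiagonal.1 hq]
    rw [show (-1 : ℝ) ^ p.1 = (-1) ^ q.1 * (-1) ^ q.2 by
      rw [← mem_antidiagonal.1 hq, pow_add]]
    have : ((-1 : ℝ) ^ q.1) * (-1) ^ q.1 = 1 := by rw [← mul_pow]; simp
    field_simp
    linear_combination (-poch u p.1 * poch v q.1 * poch (e - v + p.1) p.2 * poch (e + p.1) p.2 *
      poch (e + q.1) q.2) * this
  rw [sum_congr rfl h2, ← mul_sum, vandermonde]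
  ring

/-! ### Laguerre polynomials and their convolutions -/

/-- The Laguerre polynomial `L_n^{(A-1)}(x)`, defined through the recurrence coming from its
generating function. -/
noncomputable def lag : ℕ → ℝ → ℝ → ℝ
  | 0, _, _ => 1
  | n + 1, A, x => (A * lag n (A + 1) x - x * lag n (A + 2) x) / (n + 1)

@[simp] lemma lag_zero (A x : ℝ) : lag 0 A x = 1 := rfl

/-- This is `∂_t G_A = A G_{A+1} - x G_{A+2}` for the generating function `G_A = (1 - t)^(-A) exp(-x
t / (1 - t))`. -/
lemma lag_succ (n : ℕ) (A x : ℝ) :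
    (n + 1) * lag (n + 1) A x = A * lag n (A + 1) x - x * lag n (A + 2) x := by
  rw [lag]; field_simp

/-- Coefficientwise `G_A(x) G_B(y) = G_{A+B}(x + y)`. The induction is the product rule: the factor
`m + 1 = p.1 + p.2` distributes the derivative over the two factors. -/
lemma lag_conv (m : ℕ) (A B x y : ℝ) :
    ∑ p ∈ antidiagonal m, lag p.1 A x * lag p.2 B y = lag m (A + B) (x + y) := by
  induction m generalizing A B with
  | zero => simp
  | succ m ih =>
    have hm : (m + 1 : ℝ) ≠ 0 := by positivity
    refine mul_left_cancel₀ hm ?_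
    have h1 : (m + 1 : ℝ) * ∑ p ∈ antidiagonal (m + 1), lag p.1 A x * lag p.2 B y =
        ∑ p ∈ antidiagonal (m + 1), (p.1 : ℝ) * lag p.1 A x * lag p.2 B y +
          ∑ p ∈ antidiagonal (m + 1), (p.2 : ℝ) * lag p.2 B y * lag p.1 A x := by
      rw [mul_sum, ← sum_add_distrib]
      refine sum_congr rfl fun p hp => ?_
      have : (p.1 + p.2 : ℝ) = m + 1 := by exact_mod_cast mem_antidiagonal.1 hp
      rw [← this]; ring
    have h2 : ∑ p ∈ antidiagonal (m + 1), (p.1 : ℝ) * lag p.1 A x * lag p.2 B y =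
        A * lag m (A + 1 + B) (x + y) - x * lag m (A + 2 + B) (x + y) := by
      rw [Nat.sum_antidiagonal_succ, ← ih, ← ih, mul_sum, mul_sum, ← sum_sub_distrib]
      simp only [Nat.cast_zero, zero_mul, zero_add]
      refine sum_congr rfl fun p hp => ?_
      push_cast
      rw [lag_succ]; ring
    have h3 : ∑ p ∈ antidiagonal (m + 1), (p.2 : ℝ) * lag p.2 B y * lag p.1 A x =
        B * lag m (A + (B + 1)) (x + y) - y * lag m (A + (B + 2)) (x + y) := by
      rw [Nat.sum_antidiagonal_succ', ← ih, ← ih, mul_sum, mul_sum, ← sum_sub_distrib]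
      simp only [Nat.cast_zero, zero_mul, zero_add]
      refine sum_congr rfl fun p hp => ?_
      push_cast
      rw [lag_succ]; ring
    rw [h1, h2, h3, lag_succ, show A + 1 + B = A + B + 1 by ring,
      show A + 2 + B = A + B + 2 by ring, ← add_assoc, ← add_assoc]
    ring

/-- The `k`-th derivative of the Laguerre generating function, coefficientwise. -/
lemma lag_add (k p : ℕ) {A : ℝ} (hA : 0 < A) (x : ℝ) :
    ((p + k)! / p ! : ℝ) * lag (p + k) A x = poch A k *
      ∑ i ∈ range (k + 1), (-1) ^ i * (k.choose i : ℝ) / poch A i * x ^ i * lag p (A + k + i) x := by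
  induction k generalizing A with
  | zero => simp [Nat.factorial_ne_zero]
  | succ k ih =>
    have h1 : ((p + (k + 1))! : ℝ) = (p + k)! * ((p + k : ℕ) + 1) := by
      rw [← add_assoc, Nat.factorial_succ]; push_cast; ring
    rw [h1, ← add_assoc, mul_div_right_comm, mul_assoc, lag_succ, mul_sub,
      mul_left_comm _ A, ih (by linarith), mul_left_comm _ x, ih (by linarith)]
    -- Both pieces of the derivative are rewritten over the same range and with the same Laguerre
    -- parameter `A + (k + 1) + i`, so that only the binomial weights remain to be compared, in
    -- `key`.
    have e1 : A * (poch (A + 1) k * ∑ i ∈ range (k + 1), (-1) ^ i * (k.choose i : ℝ) /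
        poch (A + 1) i * x ^ i * lag p (A + 1 + k + i) x) =
        ∑ i ∈ range (k + 2), (-1) ^ i * poch A (k + 1) / poch A i * (A * (k.choose i : ℝ) / (A + i)) *
          x ^ i * lag p (A + (k + 1 : ℕ) + i) x := by
      rw [sum_range_succ _ (k + 1), Nat.choose_succ_self, mul_sum, mul_sum]
      simp only [Nat.cast_zero, mul_zero, zero_div, zero_mul, add_zero]
      refine sum_congr rfl fun i _ => ?_
      have h2 : A * poch (A + 1) i = poch A i * (A + i) := by
        rw [← poch_succ_left, poch_succ]
      have h3 : poch (A + 1) i = poch A i * (A + i) / A := by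
        rw [eq_div_iff hA.ne', ← h2]; ring
      have h4 := poch_ne hA i
      rw [h3, poch_succ_left, show A + ((k + 1 : ℕ) : ℝ) + i = A + 1 + k + i by push_cast; ring]
      have : A + i ≠ 0 := by positivity
      field_simp
    have e2 : x * (poch (A + 2) k * ∑ i ∈ range (k + 1), (-1) ^ i * (k.choose i : ℝ) /
        poch (A + 2) i * x ^ i * lag p (A + 2 + k + i) x) =
        - ∑ i ∈ range (k + 2), (-1) ^ i * poch A (k + 1) / poch A i *
          ((if i = 0 then 0 else (A + k + 1) * (k.choose (i - 1) : ℝ)) / (A + i)) *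
          x ^ i * lag p (A + (k + 1 : ℕ) + i) x := by
      rw [sum_range_succ' _ (k + 1), mul_sum, mul_sum]
      simp only [if_true, zero_div, zero_mul, mul_zero, add_zero]
      rw [← sum_neg_distrib]
      refine sum_congr rfl fun i _ => ?_
      have hq : ∀ r, poch (A + 2) r = poch A (r + 1) * (A + r + 1) / (A * (A + 1)) := by
        intro r
        have hr : poch A (r + 2) = A * (A + 1) * poch (A + 2) r := by
          rw [poch_succ_left, poch_succ_left]; ring_nf
        rw [poch_succ] at hr
        push_cast at hr
        have : A * (A + 1) ≠ 0 := by positivity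
        rw [eq_div_iff this]
        linear_combination -hr
      have h4 := poch_ne hA (i + 1)
      rw [hq, hq, if_neg (Nat.succ_ne_zero i), Nat.add_sub_cancel,
        show A + ((k + 1 : ℕ) : ℝ) + (i + 1 : ℕ) = A + 2 + k + i by push_cast; ring]
      have h5 : A + i + 1 ≠ 0 := by positivity
      have h6 : A + (i + 1 : ℕ) = A + i + 1 := by push_cast; ring
      rw [h6]
      field_simp
      ring
    rw [e1, e2, sub_neg_eq_add, ← sum_add_distrib, mul_sum]
    refine sum_congr rfl fun i _ => ?_
    have h5 : A + i ≠ 0 := by positivity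
    have key : A * (k.choose i : ℝ) / (A + i) +
        (if i = 0 then 0 else (A + k + 1) * (k.choose (i - 1) : ℝ)) / (A + i) =
          ((k + 1).choose i : ℝ) := by
      rw [← add_div, div_eq_iff h5]
      cases i with
      | zero => simp
      | succ i =>
        have h7 := Nat.add_one_mul_choose_eq k i
        have h8 := Nat.choose_succ_succ k i
        rw [if_neg (Nat.succ_ne_zero i), Nat.add_sub_cancel]
        simp only [Nat.succ_eq_add_one] at h7 h8
        have h7' : ((k : ℝ) + 1) * k.choose i = (k + 1).choose (i + 1) * (i + 1) := by
          exact_mod_cast h7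
        have h8' : ((k + 1).choose (i + 1) : ℝ) = k.choose i + k.choose (i + 1) := by
          exact_mod_cast h8
        push_cast
        linear_combination h7' - A * h8'
    rw [← key]
    have := poch_ne hA i
    field_simp

/-- The explicit form of the Laguerre polynomial. -/
lemma lag_eq_sum (k : ℕ) {A : ℝ} (hA : 0 < A) (x : ℝ) :
    lag k A x = poch A k / k ! *
      ∑ i ∈ range (k + 1), (-1) ^ i * (k.choose i : ℝ) / poch A i * x ^ i := by
  have h := lag_add k 0 hA x
  simp only [zero_add, lag_zero, mul_one, Nat.factorial_zero, Nat.cast_one, div_one] at h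
  rw [div_mul_eq_mul_div, ← h]
  field_simp

/-- A sum over an antidiagonal of a function vanishing for small arguments. -/
lemma sum_antidiagonal_shift (f : ℕ → ℕ → ℝ) (k l n : ℕ) (h1 : ∀ a b, a < k → f a b = 0)
    (h2 : ∀ a b, b < l → f a b = 0) :
    ∑ p ∈ antidiagonal (n + k + l), f p.1 p.2 = ∑ p ∈ antidiagonal n, f (p.1 + k) (p.2 + l) := by
  induction l generalizing f with
  | zero =>
    induction k generalizing f with
    | zero => simp
    | succ k ih =>
      rw [add_zero, ← add_assoc, Nat.sum_antidiagonal_succ, h1 _ _ (Nat.succ_pos k), zero_add]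
      have := ih (fun a b => f (a + 1) b) (fun a b h => h1 _ _ (by omega)) (by simp)
      simp only [add_zero] at this ⊢
      rw [this]
      rfl
  | succ l ih =>
    rw [← add_assoc, Nat.sum_antidiagonal_succ', h2 _ _ (Nat.succ_pos l), zero_add]
    exact ih (fun a b => f a (b + 1)) (fun a b h => h1 _ _ h) (fun a b h => h2 _ _ (by omega))

/-- Up to sign, `(-a)_k` acts on the coefficient of `t^a` as `t^k (d/dt)^k`. Both factors are
differentiated by `lag_add` and multiplied by `lag_conv`; the factor `t^(k+l)` accounts for the
shift from `n + k + l` to `n`. -/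
lemma poch_mul_lag_conv (k l n : ℕ) {A B : ℝ} (hA : 0 < A) (hB : 0 < B) (x y : ℝ) :
    ∑ p ∈ antidiagonal (n + k + l), poch (-(p.1 : ℝ)) k * poch (-(p.2 : ℝ)) l *
        (lag p.1 A x * lag p.2 B y) =
      (-1) ^ (k + l) * (poch A k * poch B l) * ∑ i ∈ range (k + 1), ∑ j ∈ range (l + 1),
        (-1) ^ i * (k.choose i : ℝ) / poch A i * x ^ i *
          ((-1) ^ j * (l.choose j : ℝ) / poch B j * y ^ j) *
            lag n (A + B + (k + l : ℕ) + (i + j : ℕ)) (x + y) := by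
  rw [sum_antidiagonal_shift (fun a b => poch (-(a : ℝ)) k * poch (-(b : ℝ)) l *
    (lag a A x * lag b B y))]
  · simp_rw [poch_neg_nat (Nat.add_comm k _)]
    simp_rw [poch_neg_nat (Nat.add_comm l _)]
    have h : ∀ p ∈ antidiagonal n, (-1) ^ k * (((p.1 + k)! : ℝ) / p.1 !) *
        ((-1) ^ l * (((p.2 + l)! : ℝ) / p.2 !)) * (lag (p.1 + k) A x * lag (p.2 + l) B y) =
        (-1) ^ (k + l) * (poch A k * poch B l) * ∑ i ∈ range (k + 1), ∑ j ∈ range (l + 1),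
        (-1) ^ i * (k.choose i : ℝ) / poch A i * x ^ i *
          ((-1) ^ j * (l.choose j : ℝ) / poch B j * y ^ j) *
            (lag p.1 (A + k + i) x * lag p.2 (B + l + j) y) := by
      intro p _
      have ha := lag_add k p.1 hA x
      have hb := lag_add l p.2 hB y
      calc _ = (-1) ^ (k + l) * ((((p.1 + k)! : ℝ) / p.1 !) * lag (p.1 + k) A x) *
            ((((p.2 + l)! : ℝ) / p.2 !) * lag (p.2 + l) B y) := by ring
        _ = (-1) ^ (k + l) * (poch A k * poch B l) * ((∑ i ∈ range (k + 1),
            (-1) ^ i * (k.choose i : ℝ) / poch A i * x ^ i * lag p.1 (A + k + i) x) *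
            (∑ i ∈ range (l + 1),
            (-1) ^ i * (l.choose i : ℝ) / poch B i * y ^ i * lag p.2 (B + l + i) y)) := by
              rw [ha, hb]; ring
        _ = _ := by
          rw [sum_mul_sum]
          congr 1
          refine sum_congr rfl fun i _ => sum_congr rfl fun j _ => ?_
          ring
    rw [sum_congr rfl h, ← mul_sum, sum_comm]
    congr 1
    refine sum_congr rfl fun i _ => ?_
    rw [sum_comm]
    refine sum_congr rfl fun j _ => ?_
    rw [← mul_sum, lag_conv]
    congr 2
    push_cast; ring
  · intro a b h
    rw [poch_neg_nat_eq_zero h]; ring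
  · intro a b h
    rw [poch_neg_nat_eq_zero h]; ring

/-- The coefficient of `t^J` in the product of `∑ (-1)^a C(a,i) t^a / a! = (-t)^i e^(-t) / i!` and
`∑ C(b,j) t^b / b! = t^j e^t / j!`: the exponentials cancel and only `i + j = J` survives. -/
lemma sum_alternating_choose (i j J : ℕ) :
    ∑ p ∈ antidiagonal J, (-1 : ℝ) ^ p.1 * (p.1.choose i * p.2.choose j) / (p.1 ! * p.2 !) =
      if i + j = J then (-1 : ℝ) ^ i / (i ! * j !) else 0 := by
  by_cases h : i + j ≤ J
  · obtain ⟨d, rfl⟩ := Nat.exists_eq_add_of_le h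
    rw [show i + j + d = d + i + j by ring,
      sum_antidiagonal_shift (fun a b => (-1 : ℝ) ^ a * (a.choose i * b.choose j) / (a ! * b !))]
    · have h1 : ∀ p ∈ antidiagonal d, (-1 : ℝ) ^ (p.1 + i) * ((p.1 + i).choose i *
          (p.2 + j).choose j) / ((p.1 + i)! * (p.2 + j)!) =
          (-1) ^ i / (i ! * j !) * ((-1 : ℝ) ^ p.1 / (p.1 ! * p.2 !)) := by
        intro p _
        rw [choose_cast_of_add (Nat.add_comm i p.1), choose_cast_of_add (Nat.add_comm j p.2), pow_add]
        field_simp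
      rw [sum_congr rfl h1, ← mul_sum, sum_alternating]
      by_cases hd : d = 0
      · subst hd; simp
      · rw [if_neg hd, if_neg (by omega), mul_zero]
    · intro a b hab
      simp [Nat.choose_eq_zero_of_lt hab]
    · intro a b hab
      simp [Nat.choose_eq_zero_of_lt hab]
  · rw [if_neg (by omega)]
    refine sum_eq_zero fun p hp => ?_
    have hp' := mem_antidiagonal.1 hp
    by_cases h1 : p.1 < i
    · simp [Nat.choose_eq_zero_of_lt h1]
    · simp [Nat.choose_eq_zero_of_lt (show p.2 < j by omega)]

/-- The Hahn polynomial, in a form symmetric in the two degrees `a` and `b`. -/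
noncomputable def hahnSymm (J : ℕ) (A B : ℝ) (a b : ℕ) : ℝ :=
  ∑ p ∈ antidiagonal J, (-1) ^ p.1 * poch (-(a : ℝ)) p.1 * poch (-(b : ℝ)) p.2 /
    (poch A p.1 * poch B p.2 * p.1 ! * p.2 !)

/-- The homogeneous form of the Jacobi polynomial. -/
noncomputable def jacobiHom (J : ℕ) (A B x y : ℝ) : ℝ :=
  ∑ p ∈ antidiagonal J, (-1) ^ p.2 * x ^ p.1 * y ^ p.2 /
    (poch A p.1 * poch B p.2 * p.1 ! * p.2 !)

lemma hahnSymm_conv (J n : ℕ) {A B : ℝ} (hA : 0 < A) (hB : 0 < B) (x y : ℝ) :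
    ∑ p ∈ antidiagonal (n + J), hahnSymm J A B p.1 p.2 * (lag p.1 A x * lag p.2 B y) =
      (-1) ^ J * jacobiHom J A B x y * lag n (A + B + 2 * J) (x + y) := by
  unfold hahnSymm
  simp_rw [sum_mul]
  rw [sum_comm]
  have h1 : ∀ q ∈ antidiagonal J, ∑ p ∈ antidiagonal (n + J),
      (-1) ^ q.1 * poch (-(p.1 : ℝ)) q.1 * poch (-(p.2 : ℝ)) q.2 /
        (poch A q.1 * poch B q.2 * q.1 ! * q.2 !) * (lag p.1 A x * lag p.2 B y) =
      ∑ i ∈ range (J + 1), ∑ j ∈ range (J + 1),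
        (-1 : ℝ) ^ J * ((-1) ^ (i + j) / (poch A i * poch B j) * x ^ i * y ^ j *
            lag n (A + B + J + (i + j : ℕ)) (x + y)) *
        ((-1 : ℝ) ^ q.1 * (q.1.choose i * q.2.choose j) / (q.1 ! * q.2 !)) := by
    intro q hq
    have hq' := mem_antidiagonal.1 hq
    have h := poch_mul_lag_conv q.1 q.2 n hA hB x y
    rw [add_assoc, hq'] at h
    have hA1 := poch_ne hA q.1
    have hB1 := poch_ne hB q.2
    calc _ = (-1) ^ q.1 / (poch A q.1 * poch B q.2 * q.1 ! * q.2 !) *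
          ∑ p ∈ antidiagonal (n + J), poch (-(p.1 : ℝ)) q.1 * poch (-(p.2 : ℝ)) q.2 *
            (lag p.1 A x * lag p.2 B y) := by
          rw [mul_sum]
          refine sum_congr rfl fun p _ => ?_
          ring
      _ = ∑ i ∈ range (q.1 + 1), ∑ j ∈ range (q.2 + 1),
        (-1 : ℝ) ^ J * ((-1) ^ (i + j) / (poch A i * poch B j) * x ^ i * y ^ j *
            lag n (A + B + J + (i + j : ℕ)) (x + y)) *
        ((-1 : ℝ) ^ q.1 * (q.1.choose i * q.2.choose j) / (q.1 ! * q.2 !)) := by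
          rw [h, ← mul_assoc, mul_sum]
          refine sum_congr rfl fun i _ => ?_
          rw [mul_sum]
          refine sum_congr rfl fun j _ => ?_
          rw [pow_add (-1 : ℝ) i j]
          field_simp
      _ = _ := by
          -- Both ranges are enlarged to `J + 1`, the new terms having zero binomials, so that the
          -- sum over `q` can be moved inside.
          have s1 : range (q.1 + 1) ⊆ range (J + 1) := range_subset_range.2 (by omega)
          have s2 : range (q.2 + 1) ⊆ range (J + 1) := range_subset_range.2 (by omega)
          rw [sum_subset s1]
          · refine sum_congr rfl fun i _ => ?_
            refine sum_subset s2 fun j _ hj => ?_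
            have : q.2 < j := by simpa using hj
            simp [Nat.choose_eq_zero_of_lt this]
          · intro i _ hi
            have : q.1 < i := by simpa using hi
            simp [Nat.choose_eq_zero_of_lt this]
  rw [sum_congr rfl h1, sum_comm]
  -- The weights `(A)_k (B)_l` have cancelled, so the sum over `k + l = J` is the alternating one.
  -- It leaves `i + j = J` only, hence a form homogeneous in `x, y` and the single parameter `A + B
  -- + 2J`.
  simp_rw [sum_comm (s := antidiagonal J), ← mul_sum, sum_alternating_choose]
  rw [jacobiHom, Nat.sum_antidiagonal_eq_sum_range_succ_mk, mul_sum, sum_mul]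
  refine sum_congr rfl fun i hi => ?_
  have hi' : i ≤ J := Nat.lt_succ_iff.1 (mem_range.1 hi)
  rw [sum_eq_single (J - i)]
  · have h2 : i + (J - i) = J := by omega
    rw [h2, if_pos rfl, show A + B + (J : ℝ) + J = A + B + 2 * J by ring]
    have h3 : (-1 : ℝ) ^ J * (-1) ^ i = (-1) ^ (J - i) := by
      conv_lhs => rw [← h2]
      rw [pow_add, mul_right_comm, ← mul_pow]; simp
    rw [← h3]
    have := poch_ne hA i
    have := poch_ne hB (J - i)
    field_simp
  · intro j _ hj
    rw [if_neg (by omega), mul_zero]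
  · intro h
    exact absurd (mem_range.2 (by omega)) h

/-! ### Terminating hypergeometric series -/

lemma poch_neg_div_factorial {n : ℕ} {p : ℕ × ℕ} (hp : p ∈ antidiagonal n) :
    poch (-(n : ℝ)) p.1 = (-1) ^ p.1 * (n ! / p.2 !) :=
  poch_neg_nat (mem_antidiagonal.1 hp)

/-- Each term of a series which terminates at `n` can be indexed by the antidiagonal of `n`. -/
lemma tsum_eq_sum_antidiagonal (n : ℕ) (f : ℕ → ℝ) (hf : ∀ k, n < k → f k = 0) :
    ∑' k, f k = ∑ p ∈ antidiagonal n, f p.1 := by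
  rw [Nat.sum_antidiagonal_eq_sum_range_succ_mk]
  refine tsum_eq_sum fun k hk => hf k ?_
  simpa using hk

lemma hyp1F1_neg_nat (n : ℕ) (b x : ℝ) :
    hyp1F1 (-n) b x = ∑ p ∈ antidiagonal n,
      (-1) ^ p.1 * (n ! / (p.1 ! * p.2 !)) / poch b p.1 * x ^ p.1 := by
  rw [hyp1F1, tsum_eq_sum_antidiagonal n]
  · refine sum_congr rfl fun p hp => ?_
    rw [poch_neg_div_factorial hp]
    field_simp
  · intro k hk
    rw [poch_neg_nat_eq_zero hk]; simp

lemma hyp2F1_neg_nat (n : ℕ) (b c x : ℝ) :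
    ₂F₁ (-(n : ℝ)) b c x = ∑ p ∈ antidiagonal n,
      (-1) ^ p.1 * (n ! / (p.1 ! * p.2 !)) * poch b p.1 / poch c p.1 * x ^ p.1 := by
  rw [ordinaryHypergeometric_eq_tsum]
  beta_reduce
  rw [tsum_eq_sum_antidiagonal n]
  · refine sum_congr rfl fun p hp => ?_
    have := poch_neg_div_factorial hp
    simp only [poch, smul_eq_mul] at this ⊢
    rw [this]
    field_simp
  · intro k hk
    have := poch_neg_nat_eq_zero hk
    simp only [poch] at this
    rw [this]; simp

lemma hyp3F2_neg_nat (n : ℕ) (a b d e : ℝ) :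
    hyp3F2 (-n) a b d e 1 = ∑ p ∈ antidiagonal n,
      (-1) ^ p.1 * (n ! / (p.1 ! * p.2 !)) * (poch a p.1 * poch b p.1) /
        (poch d p.1 * poch e p.1) := by
  rw [hyp3F2, tsum_eq_sum_antidiagonal n]
  · refine sum_congr rfl fun p hp => ?_
    rw [poch_neg_div_factorial hp, one_pow]
    field_simp
  · intro k hk
    -- Past `n` a denominator may vanish too; since `0 / 0 = 0`, the zero numerator decides.
    rw [poch_neg_nat_eq_zero hk]; simp

lemma hyp3F2_comm₁₂ (a b c d e x : ℝ) : hyp3F2 a b c d e x = hyp3F2 b a c d e x := by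
  unfold hyp3F2
  congr 1; ext k; ring

lemma hyp3F2_comm₂₃ (a b c d e x : ℝ) : hyp3F2 a b c d e x = hyp3F2 a c b d e x := by
  unfold hyp3F2
  congr 1; ext k; ring

lemma poch_ne_of_le {a : ℝ} {k n : ℕ} (h : k ≤ n) (ha : poch a n ≠ 0) : poch a k ≠ 0 := by
  obtain ⟨l, rfl⟩ := Nat.exists_eq_add_of_le h
  rw [poch_add] at ha
  exact left_ne_zero_of_mul ha

lemma poch_shift_ne {a : ℝ} {k l : ℕ} (ha : poch a (k + l) ≠ 0) : poch (a + k) l ≠ 0 := by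
  rw [poch_add] at ha
  exact right_ne_zero_of_mul ha

/-- A transformation of terminating `₃F₂` series at `1`. -/
lemma hyp3F2_transform (n : ℕ) (a b d e : ℝ) (hd : poch d n ≠ 0) (he : poch e n ≠ 0)
    (hs : poch (d + e - a - b) n ≠ 0) :
    hyp3F2 (-n) a b e d 1 = poch (d + e - a - b) n / poch d n *
      hyp3F2 (-n) (e - a) (e - b) e (d + e - a - b) 1 := by
  rw [hyp3F2_neg_nat, hyp3F2_neg_nat]
  -- Pfaff–Saalschütz is Euler's transformation `₂F₁(a,b;e) = (1-z)^(e-a-b) ₂F₁(e-a,e-b;e)` read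
  -- coefficientwise. It replaces `a, b` by `e - a, e - b` at the cost of an inner sum, which
  -- Vandermonde evaluates.
  have h1 : ∀ p ∈ antidiagonal n, (-1) ^ p.1 * ((n ! : ℝ) / (p.1 ! * p.2 !)) *
      (poch a p.1 * poch b p.1) / (poch e p.1 * poch d p.1) =
      ∑ q ∈ antidiagonal p.1, n ! * (-1) ^ (q.1 + q.2) * poch (e - a) q.1 * poch (e - b) q.1 *
        poch (a + b - e) q.2 / (poch e q.1 * poch d (q.1 + q.2) * q.1 ! * q.2 ! * p.2 !) := by
    intro p hp
    have hp' := mem_antidiagonal.1 hp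
    have h := pfaff_saalschutz (e - a) (e - b) e p.1
    rw [show e - (e - a) - (e - b) = a + b - e by ring, sub_sub_cancel, sub_sub_cancel] at h
    calc _ = (-1) ^ p.1 * ((n ! : ℝ) / p.2 !) / (poch e p.1 * poch d p.1) *
          (poch a p.1 * poch b p.1 / p.1 !) := by field_simp
      _ = _ := by
        rw [← h, mul_sum]
        refine sum_congr rfl fun q hq => ?_
        have hq' := mem_antidiagonal.1 hq
        have he1 : poch e (q.1 + q.2) ≠ 0 := poch_ne_of_le (by omega) he
        have hd1 : poch d (q.1 + q.2) ≠ 0 := poch_ne_of_le (by omega) hd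
        have he2 := poch_shift_ne he1
        have he3 : poch e q.1 ≠ 0 := poch_ne_of_le (by omega) he
        rw [← hq', poch_add e]
        field_simp
  rw [sum_congr rfl h1, sum_antidiagonal_assoc (fun k i r => n ! * (-1) ^ (k + i) *
    poch (e - a) k * poch (e - b) k * poch (a + b - e) i /
      (poch e k * poch d (k + i) * k ! * i ! * r !)), mul_sum]
  refine sum_congr rfl fun p hp => ?_
  have hp' := mem_antidiagonal.1 hp
  have he3 : poch e p.1 ≠ 0 := poch_ne_of_le (by omega) he
  have hs1 : poch (d + e - a - b) p.1 ≠ 0 := poch_ne_of_le (by omega) hs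
  have h2 : ∀ q ∈ antidiagonal p.2, n ! * (-1) ^ (p.1 + q.1) * poch (e - a) p.1 *
      poch (e - b) p.1 * poch (a + b - e) q.1 /
        (poch e p.1 * poch d (p.1 + q.1) * p.1 ! * q.1 ! * q.2 !) =
      n ! * (-1) ^ p.1 * poch (e - a) p.1 * poch (e - b) p.1 / (poch e p.1 * p.1 ! * poch d n) *
        ((-1) ^ q.1 * poch (a + b - e) q.1 * poch (d + p.1 + q.1) q.2 / (q.1 ! * q.2 !)) := by
    intro q hq
    have hq' := mem_antidiagonal.1 hq
    have hd1 : poch d (p.1 + q.1) ≠ 0 := poch_ne_of_le (by omega) hd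
    have hd2 : poch d (p.1 + q.1 + q.2) ≠ 0 := poch_ne_of_le (by omega) hd
    have hd3 := poch_shift_ne hd2
    have h3 : poch d n = poch d (p.1 + q.1) * poch (d + p.1 + q.1) q.2 := by
      rw [← hp', ← hq', ← add_assoc, poch_add]; push_cast; rw [add_assoc d]
    push_cast at hd3
    rw [← add_assoc] at hd3
    rw [h3, pow_add]
    field_simp
  rw [sum_congr rfl h2, ← mul_sum, vandermonde]
  have h4 : poch (d + e - a - b) n = poch (d + e - a - b) p.1 *
      poch (d + p.1 - (a + b - e)) p.2 := by
    rw [← hp', poch_add]; congr 2; ring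
  rw [h4]
  field_simp

/-- The Hahn polynomial as a `₃F₂` series. -/
lemma hahnSymm_eq (a b J : ℕ) {A B : ℝ} (hA : 0 < A) (hB : 0 < B) (hJ : J ≤ a + b) :
    hahnSymm J A B a b = poch (-((a + b : ℕ) : ℝ)) J / (J ! * poch B J) *
      hyp3F2 (-a) (-J) (A + B + J - 1) (-((a + b : ℕ) : ℝ)) A 1 := by
  rw [hyp3F2_comm₁₂, hyp3F2_neg_nat, hahnSymm]
  set m : ℝ := ((a + b : ℕ) : ℝ) with hm
  -- Since `a + b = m`, Vandermonde expands `(-b)_{J-k}` in products involving `a` and `m` only;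
  -- this breaks the symmetry between the two degrees.
  have h1 : ∀ p ∈ antidiagonal J, (-1) ^ p.1 * poch (-(a : ℝ)) p.1 * poch (-(b : ℝ)) p.2 /
      (poch A p.1 * poch B p.2 * p.1 ! * p.2 !) =
      ∑ q ∈ antidiagonal p.2, (-1) ^ (p.1 + q.1) * poch (-(a : ℝ)) (p.1 + q.1) *
        poch ((p.1 + q.1 : ℕ) - m) q.2 /
          (poch A p.1 * poch B (q.1 + q.2) * p.1 ! * q.1 ! * q.2 !) := by
    intro p hp
    have h := vandermonde (p.1 - a) (p.1 - m) p.2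
    rw [show (p.1 : ℝ) - m - (p.1 - a) = -b by rw [hm]; push_cast; ring] at h
    calc _ = (-1) ^ p.1 * poch (-(a : ℝ)) p.1 / (poch A p.1 * poch B p.2 * p.1 !) *
          (poch (-(b : ℝ)) p.2 / p.2 !) := by field_simp
      _ = _ := by
        rw [← h, mul_sum]
        refine sum_congr rfl fun q hq => ?_
        rw [mem_antidiagonal.1 hq, poch_add, pow_add, show -(a : ℝ) + p.1 = p.1 - a by ring,
          show ((p.1 + q.1 : ℕ) : ℝ) - m = p.1 - m + q.1 by push_cast; ring]
        field_simp
  rw [sum_congr rfl h1, ← sum_antidiagonal_assoc (fun k i r => (-1) ^ (k + i) *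
    poch (-(a : ℝ)) (k + i) * poch ((k + i : ℕ) - m) r /
      (poch A k * poch B (i + r) * k ! * i ! * r !)), mul_sum]
  refine sum_congr rfl fun p hp => ?_
  have hp' := mem_antidiagonal.1 hp
  have hBJ := poch_ne hB J
  have hAp := poch_ne hA p.1
  have h2 : ∀ q ∈ antidiagonal p.1, (-1) ^ (q.1 + q.2) *
      poch (-(a : ℝ)) (q.1 + q.2) * poch ((q.1 + q.2 : ℕ) - m) p.2 /
      (poch A q.1 * poch B (q.2 + p.2) * q.1 ! * q.2 ! * p.2 !) =
      (-1) ^ p.1 * poch (-(a : ℝ)) p.1 * poch (p.1 - m) p.2 / (p.2 ! * poch A p.1 * poch B J) *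
        ((-1) ^ q.1 * poch (1 - B - J) q.1 * poch (A + q.1) q.2 / (q.1 ! * q.2 !)) := by
    intro q hq
    have hq' := mem_antidiagonal.1 hq
    have hB1 := poch_ne hB (q.2 + p.2)
    have hA1 := poch_ne hA q.1
    have hA2 : poch A p.1 = poch A q.1 * poch (A + q.1) q.2 := by rw [← hq', poch_add]
    have hA3 : poch (A + q.1) q.2 ≠ 0 := poch_ne (by positivity) _
    have hB2 : poch B J = poch B (q.2 + p.2) * poch (B + (q.2 + p.2 : ℕ)) q.1 := by
      rw [← poch_add]; congr 1; omega
    have hB4 : poch (B + (q.2 + p.2 : ℕ)) q.1 ≠ 0 := poch_ne (by positivity) _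
    have hB3 : poch (1 - B - J) q.1 = (-1) ^ q.1 * poch (B + (q.2 + p.2 : ℕ)) q.1 := by
      rw [← poch_reflect]
      congr 1
      rw [← hp', ← hq']; push_cast; ring
    have hs : (-1 : ℝ) ^ q.1 * (-1) ^ q.1 = 1 := by rw [← mul_pow]; simp
    rw [hB3, hB2, hA2, ← mul_assoc ((-1 : ℝ) ^ q.1), hs, hq']
    field_simp
  rw [sum_congr rfl h2, ← mul_sum, vandermonde]
  have h3 : poch (-m) J = poch (-m) p.1 * poch (p.1 - m) p.2 := by
    rw [← hp', poch_add]; congr 2; ring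
  have h4 : poch (-m) p.1 ≠ 0 := poch_neg_nat_ne (by omega)
  rw [h3, show A - (1 - B - J) = A + B + J - 1 by ring]
  field_simp

lemma jacobiHom_eq (J : ℕ) {A B : ℝ} (hA : 0 < A) (hB : 0 < B) (x y : ℝ) (h : x + y ≠ 0) :
    jacobiHom J A B x y = (x + y) ^ J / (J ! * poch A J) *
      ₂F₁ (-(J : ℝ)) (A + B + J - 1) B (y / (x + y)) := by
  rw [hyp2F1_neg_nat, mul_sum]
  -- The binomial theorem expands the powers of `x + y`; the coefficient of each monomial in `x, y`
  -- is then a Vandermonde sum.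
  have h1 : ∀ p ∈ antidiagonal J, (x + y) ^ J / (J ! * poch A J) *
      ((-1) ^ p.1 * (J ! / (p.1 ! * p.2 !)) * poch (A + B + J - 1) p.1 / poch B p.1 *
        (y / (x + y)) ^ p.1) = ∑ q ∈ antidiagonal p.2, (-1) ^ p.1 * poch (A + B + J - 1) p.1 /
          (poch A J * poch B p.1 * p.1 ! * q.1 ! * q.2 !) * y ^ (p.1 + q.1) * x ^ q.2 := by
    intro p hp
    have hp' := mem_antidiagonal.1 hp
    have h2 : (x + y) ^ J * (y / (x + y)) ^ p.1 = y ^ p.1 * (y + x) ^ p.2 := by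
      rw [div_pow, ← hp', pow_add, add_comm y x]; field_simp
    have hA1 := poch_ne hA J
    have hB1 := poch_ne hB p.1
    calc _ = (-1) ^ p.1 * poch (A + B + J - 1) p.1 / (poch A J * poch B p.1 * p.1 ! * p.2 !) *
          ((x + y) ^ J * (y / (x + y)) ^ p.1) := by field_simp
      _ = _ := by
        rw [h2, (Commute.all y x).add_pow', mul_sum, mul_sum]
        refine sum_congr rfl fun q hq => ?_
        rw [nsmul_eq_mul, choose_cast_of_add (mem_antidiagonal.1 hq), pow_add]
        field_simp
  rw [sum_congr rfl h1, ← sum_antidiagonal_assoc (fun s t i => (-1) ^ s *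
    poch (A + B + J - 1) s / (poch A J * poch B s * s ! * t ! * i !) * y ^ (s + t) * x ^ i),
    jacobiHom, ← Nat.sum_antidiagonal_swap]
  refine sum_congr rfl fun p hp => ?_
  have hp' := mem_antidiagonal.1 hp
  have hBp := poch_ne hB p.1
  have hA1 := poch_ne hA p.2
  have hA2 : poch (A + p.2) p.1 ≠ 0 := poch_ne (by positivity) _
  have hA3 : poch A J = poch A p.2 * poch (A + p.2) p.1 := by
    rw [← poch_add]; congr 1; omega
  have h2 : ∀ q ∈ antidiagonal p.1, (-1) ^ q.1 * poch (A + B + J - 1) q.1 /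
      (poch A J * poch B q.1 * q.1 ! * q.2 ! * p.2 !) * y ^ (q.1 + q.2) * x ^ p.2 =
      y ^ p.1 * x ^ p.2 / (poch A J * poch B p.1 * p.2 !) *
        ((-1) ^ q.1 * poch (A + B + J - 1) q.1 * poch (B + q.1) q.2 / (q.1 ! * q.2 !)) := by
    intro q hq
    have hq' := mem_antidiagonal.1 hq
    have hB1 := poch_ne hB q.1
    have hB2 : poch (B + q.1) q.2 ≠ 0 := poch_ne (by positivity) _
    have hB3 : poch B p.1 = poch B q.1 * poch (B + q.1) q.2 := by rw [← hq', poch_add]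
    have := poch_ne hA J
    rw [hB3, hq']
    field_simp
  rw [sum_congr rfl h2, ← mul_sum, vandermonde]
  have h3 : poch (B - (A + B + J - 1)) p.1 = (-1) ^ p.1 * poch (A + p.2) p.1 := by
    rw [← poch_reflect]; congr 1; rw [← hp']; push_cast; ring
  rw [h3, hA3]
  simp only [Prod.fst_swap, Prod.snd_swap]
  field_simp

/-- The convolution identity for Laguerre polynomials with Hahn polynomials as coefficients. -/
lemma lag_conv_hahn (J n : ℕ) {A B : ℝ} (hA : 0 < A) (hB : 0 < B) (x y : ℝ) (h : x + y ≠ 0) :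
    ∑ p ∈ antidiagonal (n + J),
        hyp3F2 (-p.1) (-J) (A + B + J - 1) (-((n + J : ℕ) : ℝ)) A 1 *
          (lag p.1 A x * lag p.2 B y) =
      poch B J * n ! / (poch A J * (n + J)!) * ((x + y) ^ J *
        ₂F₁ (-(J : ℝ)) (A + B + J - 1) B (y / (x + y))) * lag n (A + B + 2 * J) (x + y) := by
  have hc := hahnSymm_conv J n hA hB x y
  have hA1 := poch_ne hA J
  have hB1 := poch_ne hB J
  rw [jacobiHom_eq J hA hB x y h] at hc
  have h1 : ∀ p ∈ antidiagonal (n + J), hahnSymm J A B p.1 p.2 * (lag p.1 A x * lag p.2 B y) =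
      poch (-((n + J : ℕ) : ℝ)) J / (J ! * poch B J) *
        (hyp3F2 (-p.1) (-J) (A + B + J - 1) (-((n + J : ℕ) : ℝ)) A 1 *
          (lag p.1 A x * lag p.2 B y)) := by
    intro p hp
    have hp' := mem_antidiagonal.1 hp
    rw [hahnSymm_eq p.1 p.2 J hA hB (by omega), hp']; ring
  rw [sum_congr rfl h1, ← mul_sum, poch_neg_nat (Nat.add_comm J n)] at hc
  have h2 : (-1 : ℝ) ^ J * (-1) ^ J = 1 := by rw [← mul_pow]; simp
  have h3 : ((-1 : ℝ) ^ J) ≠ 0 := by positivity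
  rw [mul_assoc ((-1 : ℝ) ^ J) _ (lag _ _ _), mul_div_assoc, mul_assoc ((-1 : ℝ) ^ J)] at hc
  have hc' := mul_left_cancel₀ h3 hc
  set S : ℝ := ∑ p ∈ antidiagonal (n + J),
    hyp3F2 (-p.1) (-J) (A + B + J - 1) (-((n + J : ℕ) : ℝ)) A 1 * (lag p.1 A x * lag p.2 B y)
  have hn : (n ! : ℝ) ≠ 0 := by positivity
  have hn' : ((n + J)! : ℝ) ≠ 0 := by positivity
  have hJ : (J ! : ℝ) ≠ 0 := by positivity
  field_simp at hc' ⊢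
  linear_combination hc'

/-- The same identity with the coefficients in their dual form. -/
lemma lag_conv_hahn_dual (J n : ℕ) {A B : ℝ} (hA : 0 < A) (hB : 0 < B) (x y : ℝ)
    (h : x + y ≠ 0) :
    ∑ p ∈ antidiagonal (n + J), poch (1 - B - (n + J : ℕ)) p.1 / poch A p.1 *
        hyp3F2 (-p.1) (1 - A - B - (n + J : ℕ) - J) (-n) (-((n + J : ℕ) : ℝ))
          (1 - B - (n + J : ℕ)) 1 *
          (lag p.1 A x * lag p.2 B y) =
      poch B J * n ! / (poch A J * (n + J)!) * ((x + y) ^ J *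
        ₂F₁ (-(J : ℝ)) (A + B + J - 1) B (y / (x + y))) * lag n (A + B + 2 * J) (x + y) := by
  rw [← lag_conv_hahn J n hA hB x y h]
  refine sum_congr rfl fun p hp => ?_
  have hp' := mem_antidiagonal.1 hp
  have h1 : poch (1 - B - (n + J : ℕ)) p.1 = (-1) ^ p.1 * poch (B + p.2) p.1 := by
    rw [← poch_reflect]; congr 1; rw [← hp']; push_cast; ring
  have h2 : A + -((n + J : ℕ) : ℝ) - -(J : ℝ) - (A + B + J - 1) = 1 - B - (n + J : ℕ) := by
    push_cast; ring
  have h3 : poch (B + p.2) p.1 ≠ 0 := poch_ne (by positivity) _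
  -- With these arguments the new numerator parameters are `-n` and `1 - A - B - (n + J) - J`, the
  -- form of the dual `-1` Hahn polynomial when `n₁ + n₂` is even.
  rw [hyp3F2_transform p.1 (-J) (A + B + J - 1) A (-((n + J : ℕ) : ℝ)) (poch_ne hA _)
    (poch_neg_nat_ne (by omega)) (by rw [h2, h1]; positivity), h2, hyp3F2_comm₂₃]
  congr 3
  · push_cast; ring
  · push_cast; ring

lemma laguerre_eq_lag (n : ℕ) {A : ℝ} (hA : 0 < A) (x : ℝ) : laguerre n (A - 1) x = lag n A x := by
  rw [laguerre, sub_add_cancel, hyp1F1_neg_nat, lag_eq_sum n hA,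
    ← Nat.sum_antidiagonal_eq_sum_range_succ_mk
      (fun p : ℕ × ℕ => (-1) ^ p.1 * (n.choose p.1 : ℝ) / poch A p.1 * x ^ p.1)]
  congr 1
  refine sum_congr rfl fun p hp => ?_
  rw [choose_cast_of_add (mem_antidiagonal.1 hp)]

/-! ### Explicit forms of the polynomials -/

lemma Gamma_add_nat {a : ℝ} (ha : 0 < a) (n : ℕ) :
    Real.Gamma (a + n) = poch a n * Real.Gamma a := by
  induction n with
  | zero => simp
  | succ n ih =>
    rw [poch_succ, Nat.cast_succ, ← add_assoc, Real.Gamma_add_one (by positivity), ih]; ring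

lemma muFactorial_succ (n : ℕ) (μ : ℝ) :
    muFactorial (n + 1) μ = muFactorial n μ * muNumber (n + 1) μ := by
  rw [muFactorial, muFactorial, prod_Icc_succ_top (by omega)]

lemma muFactorial_even (n : ℕ) (μ : ℝ) :
    muFactorial (2 * n) μ = 4 ^ n * n ! * poch (μ + 1 / 2) n := by
  induction n with
  | zero => simp [muFactorial]
  | succ n ih =>
    have h1 : (-1 : ℝ) ^ (2 * n + 1) = -1 := Odd.neg_one_pow ⟨n, rfl⟩
    have h2 : (-1 : ℝ) ^ (2 * n + 1 + 1) = 1 := Even.neg_one_pow ⟨n + 1, by ring⟩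
    rw [show 2 * (n + 1) = 2 * n + 1 + 1 by ring, muFactorial_succ, muFactorial_succ, ih, poch_succ,
      Nat.factorial_succ, muNumber, muNumber, h1, h2]
    push_cast
    ring

lemma muFactorial_odd (n : ℕ) (μ : ℝ) :
    muFactorial (2 * n + 1) μ = 2 * 4 ^ n * n ! * poch (μ + 1 / 2) (n + 1) := by
  have h1 : (-1 : ℝ) ^ (2 * n + 1) = -1 := Odd.neg_one_pow ⟨n, rfl⟩
  rw [muFactorial_succ, muFactorial_even, poch_succ, muNumber, h1]
  push_cast
  ring

lemma muFactorial_pos (n : ℕ) {μ : ℝ} (hμ : 0 < μ) : 0 < muFactorial n μ := by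
  refine prod_pos fun k hk => ?_
  have h1 : 0 < k := (mem_Icc.1 hk).1
  have h2 : (0 : ℝ) < k := by exact_mod_cast h1
  have h3 : (0 : ℝ) ≤ 1 - (-1) ^ k := by
    rcases neg_one_pow_eq_or ℝ k with h | h <;> rw [h] <;> norm_num
  unfold muNumber
  positivity

/-- The monic multiple of the Specialized Chihara polynomial. -/
noncomputable def chiharaMonic (n : ℕ) (x μ γ : ℝ) : ℝ := √(muFactorial n μ) * chihara n x μ γ

lemma chiharaMonic_even (n : ℕ) (x γ : ℝ) {μ : ℝ} (hμ : 0 < μ) :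
    chiharaMonic (2 * n) x μ γ =
      (-1) ^ n * 2 ^ n * n ! * lag n (μ + 1 / 2) ((x ^ 2 - γ ^ 2) / 2) := by
  have hA : 0 < μ + 1 / 2 := by positivity
  have hp := poch_pos hA n
  have hG := Real.Gamma_pos_of_pos hA
  rw [chiharaMonic, chihara, if_pos (even_two_mul n), Nat.mul_div_cancel_left n two_pos,
    show μ - 1 / 2 = μ + 1 / 2 - 1 by ring, laguerre_eq_lag n hA, muFactorial_even]
  rw [show (n : ℝ) + μ + 1 / 2 = μ + 1 / 2 + n by ring, Gamma_add_nat hA]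
  have h : √(4 ^ n * n ! * poch (μ + 1 / 2) n) * √(n ! * Real.Gamma (μ + 1 / 2) /
      (poch (μ + 1 / 2) n * Real.Gamma (μ + 1 / 2))) = 2 ^ n * n ! := by
    have h4 : (4 : ℝ) ^ n = 2 ^ n * 2 ^ n := by rw [← mul_pow]; norm_num
    have h5 : 4 ^ n * n ! * poch (μ + 1 / 2) n * (n ! * Real.Gamma (μ + 1 / 2) /
      (poch (μ + 1 / 2) n * Real.Gamma (μ + 1 / 2))) = (2 ^ n * n !) ^ 2 := by
      rw [h4]
      generalize poch (μ + 1 / 2) n = P at hp ⊢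
      generalize Real.Gamma (μ + 1 / 2) = G at hG ⊢
      field_simp
    rw [← Real.sqrt_mul (by positivity), h5, Real.sqrt_sq (by positivity)]
  linear_combination ((-1) ^ n * lag n (μ + 1 / 2) ((x ^ 2 - γ ^ 2) / 2)) * h

lemma chiharaMonic_odd (n : ℕ) (x γ : ℝ) {μ : ℝ} (hμ : 0 < μ) :
    chiharaMonic (2 * n + 1) x μ γ =
      (-1) ^ n * 2 ^ n * n ! * (x - γ) * lag n (μ + 1 / 2 + 1) ((x ^ 2 - γ ^ 2) / 2) := by
  have hA : 0 < μ + 1 / 2 := by positivity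
  have hA1 : 0 < μ + 1 / 2 + 1 := by positivity
  have hp := poch_pos hA1 n
  have hG := Real.Gamma_pos_of_pos hA1
  rw [chiharaMonic, chihara, if_neg (by simp), show (2 * n + 1) / 2 = n by omega,
    show μ + 1 / 2 = μ + 1 / 2 + 1 - 1 by ring, laguerre_eq_lag n hA1, muFactorial_odd]
  rw [show (n : ℝ) + μ + 3 / 2 = μ + 1 / 2 + 1 + n by ring, Gamma_add_nat hA1,
    show μ + 3 / 2 = μ + 1 / 2 + 1 by ring, poch_succ_left, add_sub_cancel_right]
  have h : √(2 * 4 ^ n * n ! * ((μ + 1 / 2) * poch (μ + 1 / 2 + 1) n)) *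
      √(n ! * Real.Gamma (μ + 1 / 2 + 1) /
        (poch (μ + 1 / 2 + 1) n * Real.Gamma (μ + 1 / 2 + 1))) / √(2 * μ + 1) = 2 ^ n * n ! := by
    have h4 : (4 : ℝ) ^ n = 2 ^ n * 2 ^ n := by rw [← mul_pow]; norm_num
    have h5 : 2 * 4 ^ n * n ! * ((μ + 1 / 2) * poch (μ + 1 / 2 + 1) n) *
      (n ! * Real.Gamma (μ + 1 / 2 + 1) /
        (poch (μ + 1 / 2 + 1) n * Real.Gamma (μ + 1 / 2 + 1))) / (2 * μ + 1) =
          (2 ^ n * n !) ^ 2 := by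
      rw [h4]
      generalize poch (μ + 1 / 2 + 1) n = P at hp ⊢
      generalize Real.Gamma (μ + 1 / 2 + 1) = G at hG ⊢
      field_simp
    rw [← Real.sqrt_mul (by positivity), ← Real.sqrt_div (by positivity), h5,
      Real.sqrt_sq (by positivity)]
  linear_combination ((-1) ^ n * (x - γ) * lag n (μ + 1 / 2 + 1) ((x ^ 2 - γ ^ 2) / 2)) * h

/-! ### Signs of the phase factor, by parity. -/

lemma neg_one_pow_mul_half (a : ℕ) : (-1 : ℝ) ^ (2 * a * (2 * a - 1) / 2) = (-1) ^ a := by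
  cases a with
  | zero => simp
  | succ a =>
    have : 2 * (a + 1) * (2 * (a + 1) - 1) / 2 = (2 * a + 1) * (a + 1) := by
      rw [mul_assoc, Nat.mul_div_cancel_left _ two_pos, show 2 * (a + 1) - 1 = 2 * a + 1 by omega,
        mul_comm]
    rw [this, pow_mul, pow_succ (-1 : ℝ) (2 * a), pow_mul]
    simp

lemma neg_one_pow_mul_half' (a : ℕ) : (-1 : ℝ) ^ ((2 * a + 1) * (2 * a) / 2) = (-1) ^ a := by
  have : (2 * a + 1) * (2 * a) / 2 = (2 * a + 1) * a := by
    rw [mul_left_comm, Nat.mul_div_cancel_left _ two_pos]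
  rw [this, pow_mul, pow_succ (-1 : ℝ) (2 * a), pow_mul]
  simp

lemma neg_one_pow_triangle_even (J : ℕ) : (-1 : ℝ) ^ (2 * J * (2 * J + 1) / 2) = (-1) ^ J := by
  rw [mul_comm, neg_one_pow_mul_half']

lemma neg_one_pow_triangle_odd (J : ℕ) :
    (-1 : ℝ) ^ ((2 * J + 1) * (2 * J + 1 + 1) / 2) = (-1) ^ (J + 1) := by
  rw [mul_comm, show 2 * J + 1 + 1 = 2 * (J + 1) by ring, show 2 * J + 1 = 2 * (J + 1) - 1 by omega,
    neg_one_pow_mul_half]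

lemma neg_one_pow_phase_ee (a b j : ℕ) :
    (-1 : ℝ) ^ phase (2 * a) (2 * b) j = (-1) ^ a * (-1) ^ (j * (j + 1) / 2) := by
  rw [phase, pow_add, pow_add, neg_one_pow_mul_half, mul_assoc 2 a, pow_mul (-1 : ℝ) 2]
  simp

lemma neg_one_pow_phase_oo (a b j : ℕ) :
    (-1 : ℝ) ^ phase (2 * a + 1) (2 * b + 1) j = -((-1) ^ a * (-1) ^ (j * (j + 1) / 2)) := by
  rw [phase, pow_add, pow_add, Nat.add_sub_cancel, neg_one_pow_mul_half',
    show (2 * a + 1) * (2 * a + 1 + (2 * b + 1) + 1) =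
      2 * ((2 * a + 1) * (a + b + 1) + a) + 1 by ring, pow_succ _ (2 * _), pow_mul (-1 : ℝ) 2]
  simp

lemma neg_one_pow_phase_eo (a b j : ℕ) :
    (-1 : ℝ) ^ phase (2 * a) (2 * b + 1) j = (-1) ^ a * (-1) ^ (j * (j + 1) / 2) := by
  rw [phase, pow_add, pow_add, neg_one_pow_mul_half, mul_assoc 2 a, pow_mul (-1 : ℝ) 2]
  simp

lemma neg_one_pow_phase_oe (a b j : ℕ) :
    (-1 : ℝ) ^ phase (2 * a + 1) (2 * b) j = (-1) ^ a * (-1) ^ (j * (j + 1) / 2) := by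
  rw [phase, pow_add, pow_add, Nat.add_sub_cancel, neg_one_pow_mul_half',
    show (2 * a + 1) * (2 * a + 1 + 2 * b + 1) = 2 * ((2 * a + 1) * (a + b + 1)) by ring,
    pow_mul (-1 : ℝ) 2]
  simp

/-! ### Dual `-1` Hahn polynomials as Hahn-type `₃F₂` series, by parity of `n` and `N`. -/

lemma dualHahn_ee (n m : ℕ) (x η ξ : ℝ) :
    dualHahn (2 * n) x η ξ (2 * m) = 16 ^ n * poch (-(m : ℝ)) n * poch (1 - (η + 1 / 2) - m) n *
      hyp3F2 (-n) (-((η + ξ + 2 * m) / 2) + (x + 1) / 4) (-((η + ξ + 2 * m) / 2) - (x + 1) / 4)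
        (-m) (1 - (η + 1 / 2) - m) 1 := by
  rw [dualHahn, if_pos (even_two_mul m), if_pos (even_two_mul n),
    Nat.mul_div_cancel_left n two_pos]
  push_cast
  rw [show (1 - 2 * η - 2 * (m : ℝ)) / 2 = 1 - (η + 1 / 2) - m by ring,
    show 2 * (m : ℝ) / 2 = m by ring, show 2 * (n : ℝ) / 2 = n by ring]

lemma dualHahn_oe (n m : ℕ) (x η ξ : ℝ) :
    dualHahn (2 * n + 1) x η ξ (2 * (m + 1)) =
      16 ^ n * poch (-(m : ℝ)) n * poch (1 - (η + 1 / 2 + 1) - m) n * (x + 2 * η + 2 * ξ + 1) *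
      hyp3F2 (-n) (-((η + ξ + 2 * (m + 1)) / 2) + (x + 1) / 4)
        (-((η + ξ + 2 * (m + 1)) / 2) - (x + 1) / 4) (-m) (1 - (η + 1 / 2 + 1) - m) 1 := by
  rw [dualHahn, if_pos (even_two_mul _), if_neg (by simp),
    Nat.add_sub_cancel, Nat.mul_div_cancel_left n two_pos]
  push_cast
  rw [show (1 - 2 * η - 2 * ((m : ℝ) + 1)) / 2 = 1 - (η + 1 / 2 + 1) - m by ring,
    show 1 - 2 * ((m : ℝ) + 1) / 2 = -m by ring, show (2 * (n : ℝ) + 1 - 1) / 2 = n by ring]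

lemma dualHahn_eo (n m : ℕ) (x η ξ : ℝ) :
    dualHahn (2 * n) x η ξ (2 * m + 1) = 16 ^ n * poch (-(m : ℝ)) n * poch (ξ + 1 / 2) n *
      hyp3F2 (-n) ((η + ξ + 1) / 2 + (x + 1) / 4) ((η + ξ + 1) / 2 - (x + 1) / 4)
        (-m) (ξ + 1 / 2) 1 := by
  rw [dualHahn, if_neg (by simp), if_pos (even_two_mul n),
    Nat.mul_div_cancel_left n two_pos]
  push_cast
  rw [show (1 - (2 * (m : ℝ) + 1)) / 2 = -m by ring, show (2 * ξ + 1) / 2 = ξ + 1 / 2 by ring,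
    show 2 * (n : ℝ) / 2 = n by ring]

lemma dualHahn_oo (n m : ℕ) (x η ξ : ℝ) :
    dualHahn (2 * n + 1) x η ξ (2 * m + 1) =
      16 ^ n * poch (-(m : ℝ)) n * poch (ξ + 1 / 2 + 1) n * (x + 2 * ξ - 2 * η + 1) *
      hyp3F2 (-n) ((η + ξ + 1) / 2 + (x + 1) / 4) ((η + ξ + 1) / 2 - (x + 1) / 4)
        (-m) (ξ + 1 / 2 + 1) 1 := by
  rw [dualHahn, if_neg (by simp), if_neg (by simp),
    Nat.add_sub_cancel, Nat.mul_div_cancel_left n two_pos]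
  push_cast
  rw [show (1 - (2 * (m : ℝ) + 1)) / 2 = -m by ring,
    show (2 * ξ + 3) / 2 = ξ + 1 / 2 + 1 by ring,
    show (2 * (n : ℝ) + 1 - 1) / 2 = n by ring]

/-! ### Contiguous relations and the Big `-1` Jacobi polynomials -/

/-- Termwise comparison of coefficients. It serves the case `N`, `j` even. -/
lemma hyp2F1_contiguous (n : ℕ) (b x : ℝ) {c : ℝ} (hc : 0 < c) :
    ₂F₁ (-((n + 1 : ℕ) : ℝ)) b c x = ₂F₁ (-((n + 1 : ℕ) : ℝ)) (b + 1) c x +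
      ((n + 1) / c) * x * ₂F₁ (-(n : ℝ)) (b + 1) (c + 1) x := by
  rw [hyp2F1_neg_nat, hyp2F1_neg_nat, hyp2F1_neg_nat, Nat.sum_antidiagonal_succ,
    Nat.sum_antidiagonal_succ, add_assoc, mul_sum, ← sum_add_distrib]
  simp only [poch_zero]
  congr 1
  refine sum_congr rfl fun p hp => ?_
  have h1 := mem_antidiagonal.1 hp
  have hp1 := poch_ne (show 0 < c + 1 by positivity) p.1
  have h2 : ((n : ℝ) + 1) = p.1 + p.2 + 1 := by rw [← h1]; push_cast; ring
  rw [poch_succ_left c, poch_succ_left b, poch_succ (b + 1), Nat.factorial_succ,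
    Nat.factorial_succ]
  push_cast
  field_simp
  ring

/-- Pascal's rule for the binomials in the coefficients. It serves the case `N`, `j` odd. -/
lemma hyp2F1_contiguous_succ (n : ℕ) (b x : ℝ) {c : ℝ} (hc : 0 < c) :
    ₂F₁ (-((n + 1 : ℕ) : ℝ)) b c x = ₂F₁ (-(n : ℝ)) b c x -
      (b / c) * x * ₂F₁ (-(n : ℝ)) (b + 1) (c + 1) x := by
  rw [hyp2F1_neg_nat, hyp2F1_neg_nat, hyp2F1_neg_nat, mul_sum]
  have h0 : ∀ m : ℕ, ∀ p ∈ antidiagonal m, (-1) ^ p.1 * ((m ! : ℝ) / (p.1 ! * p.2 !)) *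
      poch b p.1 / poch c p.1 * x ^ p.1 =
      (m.choose p.1 : ℝ) * ((-1) ^ p.1 * poch b p.1 / poch c p.1 * x ^ p.1) := by
    intro m p hp
    rw [choose_cast_of_add (mem_antidiagonal.1 hp)]; ring
  rw [sum_congr rfl (h0 _), sum_congr rfl (h0 _), sum_antidiagonal_choose_succ_mul
    (fun i _ => (-1) ^ i * poch b i / poch c i * x ^ i), sub_eq_add_neg, ← sum_neg_distrib]
  congr 1
  refine sum_congr rfl fun p hp => ?_
  have hp1 := poch_ne (show 0 < c + 1 by positivity) p.1
  rw [choose_cast_of_add ((add_comm _ _).trans (mem_antidiagonal.1 hp)), poch_succ_left, poch_succ_left]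
  field_simp
  ring

/-- Termwise, the factor `(c + k) - (b + k) = c - b` is constant. It serves the case `N` even, `j`
odd. -/
lemma hyp2F1_contiguous_lower (n : ℕ) (b x : ℝ) {c : ℝ} (hc : 0 < c) :
    ₂F₁ (-(n : ℝ)) b c x - (b / c) * ₂F₁ (-(n : ℝ)) (b + 1) (c + 1) x =
      ((c - b) / c) * ₂F₁ (-(n : ℝ)) b (c + 1) x := by
  rw [hyp2F1_neg_nat, hyp2F1_neg_nat, hyp2F1_neg_nat, mul_sum, mul_sum, ← sum_sub_distrib]
  refine sum_congr rfl fun p hp => ?_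
  have hp1 := poch_ne hc p.1
  have h2 : c + p.1 ≠ 0 := by positivity
  have h3 : c * poch (c + 1) p.1 = poch c p.1 * (c + p.1) := by rw [← poch_succ_left, poch_succ]
  have h4 : b * poch (b + 1) p.1 = poch b p.1 * (b + p.1) := by rw [← poch_succ_left, poch_succ]
  have h5 : poch (c + 1) p.1 = poch c p.1 * (c + p.1) / c := by rw [← h3]; field_simp
  have h6 : b / c * ((-1) ^ p.1 * ((n ! : ℝ) / (p.1 ! * p.2 !)) * poch (b + 1) p.1 /
      poch (c + 1) p.1 * x ^ p.1) = ((-1) ^ p.1 * ((n ! : ℝ) / (p.1 ! * p.2 !)) *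
        (b * poch (b + 1) p.1) / (c * poch (c + 1) p.1) * x ^ p.1) := by ring
  rw [h6, h3, h4, h5]
  field_simp
  ring

/-- Termwise, `c + n + 1 = (c + k) + (n + 1 - k)`. It serves the case `N` odd, `j` even. -/
lemma hyp2F1_contiguous_upper (n : ℕ) (b x : ℝ) {c : ℝ} (hc : 0 < c) :
    ₂F₁ (-((n + 1 : ℕ) : ℝ)) b c x + ((n + 1) / c) * ₂F₁ (-(n : ℝ)) b (c + 1) x =
      ((c + n + 1) / c) * ₂F₁ (-((n + 1 : ℕ) : ℝ)) b (c + 1) x := by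
  rw [hyp2F1_neg_nat, hyp2F1_neg_nat, hyp2F1_neg_nat]
  have h0 : ∀ p ∈ antidiagonal (n + 1), ((c + n + 1) / c) *
      ((-1) ^ p.1 * (((n + 1)! : ℝ) / (p.1 ! * p.2 !)) * poch b p.1 / poch (c + 1) p.1 * x ^ p.1) =
      (-1) ^ p.1 * (((n + 1)! : ℝ) / (p.1 ! * p.2 !)) * poch b p.1 / poch c p.1 * x ^ p.1 +
      p.2 / c * ((-1) ^ p.1 * (((n + 1)! : ℝ) / (p.1 ! * p.2 !)) * poch b p.1 /
        poch (c + 1) p.1 * x ^ p.1) := by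
    intro p hp
    have h1 := mem_antidiagonal.1 hp
    have h2 : (p.1 + p.2 : ℝ) = n + 1 := by exact_mod_cast h1
    have hp1 := poch_ne hc p.1
    have h2' : c + p.1 ≠ 0 := by positivity
    have h5 : poch (c + 1) p.1 = poch c p.1 * (c + p.1) / c := by
      rw [eq_div_iff hc.ne', mul_comm, ← poch_succ_left, poch_succ]
    rw [h5, add_assoc c, ← h2]
    field_simp
    ring
  rw [mul_sum _ _ ((c + n + 1) / c), sum_congr rfl h0, sum_add_distrib]
  congr 1
  rw [Nat.sum_antidiagonal_succ', mul_sum]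
  simp only [Nat.cast_zero, zero_div, zero_mul, zero_add]
  refine sum_congr rfl fun p hp => ?_
  rw [Nat.factorial_succ, Nat.factorial_succ]
  push_cast
  field_simp

lemma bigJacobi_zero (t a b c : ℝ) : bigJacobi 0 t a b c = 1 := by
  -- For `j = 0` the second series does not have the form `-J` with `J` natural, but it is
  -- multiplied by `0`.
  rw [bigJacobi, if_pos (by simp)]
  have := hyp2F1_neg_nat 0 ((0 + a + b + 2) / 2) ((a + 1) / 2) ((1 - t ^ 2) / (1 - c ^ 2))
  simp only [Nat.cast_zero, neg_zero, zero_div, zero_mul] at this ⊢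
  rw [this]; simp

lemma bigJacobi_even (J : ℕ) (t c μ₁ μ₂ : ℝ) :
    bigJacobi (2 * (J + 1)) t (2 * μ₂) (2 * μ₁) c =
      ₂F₁ (-((J + 1 : ℕ) : ℝ)) (μ₁ + 1 / 2 + (μ₂ + 1 / 2) + (J + 1 : ℕ)) (μ₂ + 1 / 2)
        ((1 - t ^ 2) / (1 - c ^ 2)) +
      (J + 1) / (μ₂ + 1 / 2) * ((1 - t) / (1 + c)) *
        ₂F₁ (-(J : ℝ)) (μ₁ + 1 / 2 + (μ₂ + 1 / 2) + (J + 1 : ℕ)) (μ₂ + 1 / 2 + 1)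
          ((1 - t ^ 2) / (1 - c ^ 2)) := by
  rw [bigJacobi, if_pos (even_two_mul _)]
  push_cast
  rw [show (2 * μ₂ + 1) / 2 = μ₂ + 1 / 2 by ring, show (2 * μ₂ + 3) / 2 = μ₂ + 1 / 2 + 1 by ring,
    show -(2 * ((J : ℝ) + 1) / 2) = -((J : ℝ) + 1) by ring,
    show 1 - 2 * ((J : ℝ) + 1) / 2 = -J by ring,
    show (2 * ((J : ℝ) + 1) + 2 * μ₂ + 2 * μ₁ + 2) / 2 =
      μ₁ + 1 / 2 + (μ₂ + 1 / 2) + (J + 1) by ring,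
    show 2 * ((J : ℝ) + 1) * (1 - t) / ((1 + c) * (2 * μ₂ + 1)) =
      ((J : ℝ) + 1) / (μ₂ + 1 / 2) * ((1 - t) / (1 + c)) by
        rw [div_mul_div_comm, show 2 * μ₂ + 1 = 2 * (μ₂ + 1 / 2) by ring,
          show (1 + c) * (2 * (μ₂ + 1 / 2)) = 2 * ((μ₂ + 1 / 2) * (1 + c)) by ring, mul_assoc 2,
          mul_div_mul_left _ _ two_ne_zero]]

lemma bigJacobi_odd (J : ℕ) (t c μ₁ μ₂ : ℝ) :
    bigJacobi (2 * J + 1) t (2 * μ₂) (2 * μ₁) c =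
      ₂F₁ (-(J : ℝ)) (μ₁ + 1 / 2 + (μ₂ + 1 / 2) + J) (μ₂ + 1 / 2)
        ((1 - t ^ 2) / (1 - c ^ 2)) -
      (μ₁ + 1 / 2 + (μ₂ + 1 / 2) + J) / (μ₂ + 1 / 2) * ((1 - t) / (1 + c)) *
        ₂F₁ (-(J : ℝ)) (μ₁ + 1 / 2 + (μ₂ + 1 / 2) + J + 1) (μ₂ + 1 / 2 + 1)
          ((1 - t ^ 2) / (1 - c ^ 2)) := by
  rw [bigJacobi, if_neg (by simp)]
  push_cast
  rw [show (2 * μ₂ + 1) / 2 = μ₂ + 1 / 2 by ring, show (2 * μ₂ + 3) / 2 = μ₂ + 1 / 2 + 1 by ring,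
    show -((2 * (J : ℝ) + 1 - 1) / 2) = -(J : ℝ) by ring,
    show (2 * (J : ℝ) + 1 + 2 * μ₂ + 2 * μ₁ + 1) / 2 =
      μ₁ + 1 / 2 + (μ₂ + 1 / 2) + J by ring,
    show (2 * (J : ℝ) + 1 + 2 * μ₂ + 2 * μ₁ + 3) / 2 =
      μ₁ + 1 / 2 + (μ₂ + 1 / 2) + J + 1 by ring,
    show (2 * (J : ℝ) + 1 + 2 * μ₂ + 2 * μ₁ + 1) * (1 - t) / ((1 + c) * (2 * μ₂ + 1)) =
      (μ₁ + 1 / 2 + (μ₂ + 1 / 2) + J) / (μ₂ + 1 / 2) * ((1 - t) / (1 + c)) by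
        rw [div_mul_div_comm, show 2 * μ₂ + 1 = 2 * (μ₂ + 1 / 2) by ring,
          show (1 + c) * (2 * (μ₂ + 1 / 2)) = 2 * ((μ₂ + 1 / 2) * (1 + c)) by ring,
          show (2 * (J : ℝ) + 1 + 2 * μ₂ + 2 * μ₁ + 1) =
            2 * (μ₁ + 1 / 2 + (μ₂ + 1 / 2) + J) by ring, mul_assoc 2,
          mul_div_mul_left _ _ two_ne_zero]]

/-! ### Splitting sums over an antidiagonal by parity -/

lemma sum_antidiagonal_odd (f : ℕ → ℕ → ℝ) (m : ℕ) :
    ∑ p ∈ antidiagonal (2 * m + 1), f p.1 p.2 = ∑ p ∈ antidiagonal m, f (2 * p.1) (2 * p.2 + 1) +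
      ∑ p ∈ antidiagonal m, f (2 * p.1 + 1) (2 * p.2) := by
  induction m generalizing f with
  | zero =>
    rw [Nat.sum_antidiagonal_succ]
    simp
  | succ m ih =>
    rw [show 2 * (m + 1) + 1 = 2 * m + 1 + 1 + 1 by ring,
      Nat.sum_antidiagonal_succ (n := 2 * m + 1 + 1), Nat.sum_antidiagonal_succ (n := 2 * m + 1),
      Nat.sum_antidiagonal_succ (n := m), Nat.sum_antidiagonal_succ (n := m),
      ih (fun a b => f (a + 1 + 1) b)]
    simp only [mul_add, mul_one, mul_zero, zero_add]
    ring_nf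

lemma sum_antidiagonal_even (f : ℕ → ℕ → ℝ) (m : ℕ) :
    ∑ p ∈ antidiagonal (2 * (m + 1)), f p.1 p.2 =
      ∑ p ∈ antidiagonal (m + 1), f (2 * p.1) (2 * p.2) +
        ∑ p ∈ antidiagonal m, f (2 * p.1 + 1) (2 * p.2 + 1) := by
  rw [show 2 * (m + 1) = 2 * m + 1 + 1 by ring, Nat.sum_antidiagonal_succ' (n := 2 * m + 1),
    Nat.sum_antidiagonal_succ' (n := m), sum_antidiagonal_odd (fun a b => f a (b + 1))]
  simp only [mul_add, mul_one, mul_zero]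
  ring_nf

/-! ### The convolution sums, split by parity -/

/-- The square-root free part of the summand of the convolution identity. -/
noncomputable def convTerm (μ₁ μ₂ ε₁ ε₂ c x₁ x₂ : ℝ) (j n₁ n₂ : ℕ) : ℝ :=
  (-1) ^ phase n₁ n₂ j * (ε₂ / 2) ^ n₁ *
    dualHahn n₁ (dualHahnGrid j μ₂ μ₁ (n₁ + n₂)) μ₂ μ₁ (n₁ + n₂) *
      (chiharaMonic n₁ x₁ μ₁ (c * ε₁) / muFactorial n₁ μ₁) * chiharaMonic n₂ x₂ μ₂ (x₁ * ε₂)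

/-- The factors on the left come, in order, from the phase, from `(ε₂ / 2)^(2a)`, from the dual Hahn
normalization and from the two Chihara polynomials. Their product does not depend on `a`, so only
Hahn weights remain in the sum. -/
lemma conv_coeff {a b m : ℕ} (h : a + b = m) :
    (-1) ^ a * (1 / 4) ^ a * (16 ^ a * poch (-(m : ℝ)) a) * ((-1) ^ a / 2 ^ a) *
      ((-1) ^ b * 2 ^ b * b !) = (-1) ^ m * 2 ^ m * m ! := by
  rw [poch_neg_nat h, ← h, pow_add, pow_add, div_pow,
    show (16 : ℝ) = 4 * (2 * 2) by norm_num, mul_pow, mul_pow]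
  have h1 : ((-1 : ℝ) ^ a) ^ 2 = 1 := by rw [← pow_mul, mul_comm, pow_mul]; simp
  field_simp
  linear_combination h1

section

variable {μ₁ μ₂ ε₁ ε₂ : ℝ} (c x₁ x₂ : ℝ)

lemma half_pow_even (hε₂ : ε₂ ^ 2 = 1) (a : ℕ) : (ε₂ / 2) ^ (2 * a) = (1 / 4) ^ a := by
  rw [pow_mul, div_pow, hε₂]; norm_num

lemma chiharaMonic_div_even (hμ₁ : 0 < μ₁) (hε₁ : ε₁ ^ 2 = 1) (a : ℕ) :
    chiharaMonic (2 * a) x₁ μ₁ (c * ε₁) / muFactorial (2 * a) μ₁ =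
      (-1) ^ a / 2 ^ a / poch (μ₁ + 1 / 2) a * lag a (μ₁ + 1 / 2) ((x₁ ^ 2 - c ^ 2) / 2) := by
  have hp := poch_pos (show 0 < μ₁ + 1 / 2 by positivity) a
  rw [chiharaMonic_even a x₁ _ hμ₁, muFactorial_even, mul_pow c, hε₁, mul_one,
    show (4 : ℝ) = 2 * 2 by norm_num, mul_pow 2]
  generalize poch (μ₁ + 1 / 2) a = P at hp ⊢
  field_simp

lemma chiharaMonic_div_odd (hμ₁ : 0 < μ₁) (hε₁ : ε₁ ^ 2 = 1) (a : ℕ) :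
    chiharaMonic (2 * a + 1) x₁ μ₁ (c * ε₁) / muFactorial (2 * a + 1) μ₁ =
      (-1) ^ a / 2 ^ a / poch (μ₁ + 1 / 2 + 1) a * ((x₁ - c * ε₁) / (2 * (μ₁ + 1 / 2))) *
        lag a (μ₁ + 1 / 2 + 1) ((x₁ ^ 2 - c ^ 2) / 2) := by
  have hp := poch_pos (show 0 < μ₁ + 1 / 2 + 1 by positivity) a
  rw [chiharaMonic_odd a x₁ _ hμ₁, muFactorial_odd, mul_pow c, hε₁, mul_one, poch_succ_left,
    show (4 : ℝ) = 2 * 2 by norm_num, mul_pow 2]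
  generalize poch (μ₁ + 1 / 2 + 1) a = P at hp ⊢
  have hA : 0 < μ₁ + 1 / 2 := by positivity
  generalize μ₁ + 1 / 2 = A at hA ⊢
  field_simp

variable (hμ₁ : 0 < μ₁) (hμ₂ : 0 < μ₂) (hε₁ : ε₁ ^ 2 = 1) (hε₂ : ε₂ ^ 2 = 1)
  (hw : (x₁ ^ 2 - c ^ 2) / 2 + (x₂ ^ 2 - x₁ ^ 2) / 2 ≠ 0)
include hμ₁ hμ₂ hε₁ hε₂ hw

/-- The Hahn degree `P` is left free because the grid point gives `P = J` for `j = 2J` and `P = J +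
1` for `j = 2J + 1`. -/
lemma sum_convTerm_ee (ν P j : ℕ)
    (hz : (dualHahnGrid j μ₂ μ₁ (2 * (ν + P)) + 1) / 4 = (μ₁ + μ₂) / 2 + P ∨
      (dualHahnGrid j μ₂ μ₁ (2 * (ν + P)) + 1) / 4 = -((μ₁ + μ₂) / 2 + P)) :
    ∑ p ∈ antidiagonal (ν + P), convTerm μ₁ μ₂ ε₁ ε₂ c x₁ x₂ j (2 * p.1) (2 * p.2) =
      (-1) ^ (j * (j + 1) / 2) * ((-1) ^ (ν + P) * 2 ^ (ν + P) * (ν + P)!) *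
      (poch (μ₂ + 1 / 2) P * ν ! / (poch (μ₁ + 1 / 2) P * (ν + P)!) *
        (((x₁ ^ 2 - c ^ 2) / 2 + (x₂ ^ 2 - x₁ ^ 2) / 2) ^ P *
          ₂F₁ (-(P : ℝ)) (μ₁ + 1 / 2 + (μ₂ + 1 / 2) + P - 1) (μ₂ + 1 / 2)
            ((x₂ ^ 2 - x₁ ^ 2) / 2 / ((x₁ ^ 2 - c ^ 2) / 2 + (x₂ ^ 2 - x₁ ^ 2) / 2))) *
        lag ν (μ₁ + 1 / 2 + (μ₂ + 1 / 2) + 2 * P)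
          ((x₁ ^ 2 - c ^ 2) / 2 + (x₂ ^ 2 - x₁ ^ 2) / 2)) := by
  rw [← lag_conv_hahn_dual P ν (by positivity) (by positivity) _ _ hw, mul_sum]
  refine sum_congr rfl fun p hp => ?_
  have hp' := mem_antidiagonal.1 hp
  rw [convTerm, neg_one_pow_phase_ee, half_pow_even hε₂, ← mul_add, hp', dualHahn_ee,
    chiharaMonic_div_even c x₁ hμ₁ hε₁, chiharaMonic_even _ _ _ hμ₂, mul_pow x₁, hε₂, mul_one,
    ← conv_coeff hp']
  have h3 : hyp3F2 (-p.1)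
      (-((μ₂ + μ₁ + 2 * (ν + P : ℕ)) / 2) + (dualHahnGrid j μ₂ μ₁ (2 * (ν + P)) + 1) / 4)
      (-((μ₂ + μ₁ + 2 * (ν + P : ℕ)) / 2) - (dualHahnGrid j μ₂ μ₁ (2 * (ν + P)) + 1) / 4)
      (-(ν + P : ℕ)) (1 - (μ₂ + 1 / 2) - (ν + P : ℕ)) 1 =
      hyp3F2 (-p.1) (1 - (μ₁ + 1 / 2) - (μ₂ + 1 / 2) - (ν + P : ℕ) - P) (-ν)
        (-((ν + P : ℕ) : ℝ)) (1 - (μ₂ + 1 / 2) - (ν + P : ℕ)) 1 := by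
    -- The sign of the grid point only exchanges two numerator parameters.
    rcases hz with hz | hz
    · rw [hz, hyp3F2_comm₂₃]
      congr 1 <;> push_cast <;> ring
    · rw [hz]
      congr 1 <;> push_cast <;> ring
  rw [h3]
  ring

lemma sum_convTerm_oo (ν P j : ℕ)
    (hz : (dualHahnGrid j μ₂ μ₁ (2 * (ν + P + 1)) + 1) / 4 = (μ₁ + μ₂) / 2 + P + 1 ∨
      (dualHahnGrid j μ₂ μ₁ (2 * (ν + P + 1)) + 1) / 4 = -((μ₁ + μ₂) / 2 + P + 1)) :
    ∑ p ∈ antidiagonal (ν + P), convTerm μ₁ μ₂ ε₁ ε₂ c x₁ x₂ j (2 * p.1 + 1) (2 * p.2 + 1) =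
      -(-1) ^ (j * (j + 1) / 2) * ((-1) ^ (ν + P) * 2 ^ (ν + P) * (ν + P)!) *
      ((dualHahnGrid j μ₂ μ₁ (2 * (ν + P + 1)) + 2 * μ₂ + 2 * μ₁ + 1) * (ε₂ / 2) *
        ((x₁ - c * ε₁) / (2 * (μ₁ + 1 / 2))) * (x₂ - x₁ * ε₂)) *
      (poch (μ₂ + 1 / 2 + 1) P * ν ! / (poch (μ₁ + 1 / 2 + 1) P * (ν + P)!) *
        (((x₁ ^ 2 - c ^ 2) / 2 + (x₂ ^ 2 - x₁ ^ 2) / 2) ^ P *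
          ₂F₁ (-(P : ℝ)) (μ₁ + 1 / 2 + 1 + (μ₂ + 1 / 2 + 1) + P - 1) (μ₂ + 1 / 2 + 1)
            ((x₂ ^ 2 - x₁ ^ 2) / 2 / ((x₁ ^ 2 - c ^ 2) / 2 + (x₂ ^ 2 - x₁ ^ 2) / 2))) *
        lag ν (μ₁ + 1 / 2 + 1 + (μ₂ + 1 / 2 + 1) + 2 * P)
          ((x₁ ^ 2 - c ^ 2) / 2 + (x₂ ^ 2 - x₁ ^ 2) / 2)) := by
  rw [← lag_conv_hahn_dual P ν (by positivity) (by positivity) _ _ hw, mul_sum]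
  refine sum_congr rfl fun p hp => ?_
  have hp' := mem_antidiagonal.1 hp
  rw [convTerm, neg_one_pow_phase_oo, pow_succ (ε₂ / 2), half_pow_even hε₂,
    show 2 * p.1 + 1 + (2 * p.2 + 1) = 2 * (ν + P + 1) by omega, dualHahn_oe,
    chiharaMonic_div_odd c x₁ hμ₁ hε₁, chiharaMonic_odd _ _ _ hμ₂, mul_pow x₁, hε₂, mul_one,
    ← conv_coeff hp']
  have h3 : hyp3F2 (-p.1)
      (-((μ₂ + μ₁ + 2 * ((ν + P : ℕ) + 1)) / 2) +
        (dualHahnGrid j μ₂ μ₁ (2 * (ν + P + 1)) + 1) / 4)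
      (-((μ₂ + μ₁ + 2 * ((ν + P : ℕ) + 1)) / 2) -
        (dualHahnGrid j μ₂ μ₁ (2 * (ν + P + 1)) + 1) / 4)
      (-(ν + P : ℕ)) (1 - (μ₂ + 1 / 2 + 1) - (ν + P : ℕ)) 1 =
      hyp3F2 (-p.1) (1 - (μ₁ + 1 / 2 + 1) - (μ₂ + 1 / 2 + 1) - (ν + P : ℕ) - P) (-ν)
        (-((ν + P : ℕ) : ℝ)) (1 - (μ₂ + 1 / 2 + 1) - (ν + P : ℕ)) 1 := by
    rcases hz with hz | hz
    · rw [hz, hyp3F2_comm₂₃]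
      congr 1 <;> push_cast <;> ring
    · rw [hz]
      congr 1 <;> push_cast <;> ring
  rw [h3]
  ring

lemma sum_convTerm_eo (ν P j : ℕ)
    (hz : (dualHahnGrid j μ₂ μ₁ (2 * (ν + P) + 1) + 1) / 4 = (μ₁ + μ₂ + 1) / 2 + P ∨
      (dualHahnGrid j μ₂ μ₁ (2 * (ν + P) + 1) + 1) / 4 = -((μ₁ + μ₂ + 1) / 2 + P)) :
    ∑ p ∈ antidiagonal (ν + P), convTerm μ₁ μ₂ ε₁ ε₂ c x₁ x₂ j (2 * p.1) (2 * p.2 + 1) =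
      (-1) ^ (j * (j + 1) / 2) * ((-1) ^ (ν + P) * 2 ^ (ν + P) * (ν + P)!) * (x₂ - x₁ * ε₂) *
      (poch (μ₂ + 1 / 2 + 1) P * ν ! / (poch (μ₁ + 1 / 2) P * (ν + P)!) *
        (((x₁ ^ 2 - c ^ 2) / 2 + (x₂ ^ 2 - x₁ ^ 2) / 2) ^ P *
          ₂F₁ (-(P : ℝ)) (μ₁ + 1 / 2 + (μ₂ + 1 / 2 + 1) + P - 1) (μ₂ + 1 / 2 + 1)
            ((x₂ ^ 2 - x₁ ^ 2) / 2 / ((x₁ ^ 2 - c ^ 2) / 2 + (x₂ ^ 2 - x₁ ^ 2) / 2))) *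
        lag ν (μ₁ + 1 / 2 + (μ₂ + 1 / 2 + 1) + 2 * P)
          ((x₁ ^ 2 - c ^ 2) / 2 + (x₂ ^ 2 - x₁ ^ 2) / 2)) := by
  rw [← lag_conv_hahn P ν (by positivity) (by positivity) _ _ hw, mul_sum]
  refine sum_congr rfl fun p hp => ?_
  have hp' := mem_antidiagonal.1 hp
  rw [convTerm, neg_one_pow_phase_eo, half_pow_even hε₂,
    show 2 * p.1 + (2 * p.2 + 1) = 2 * (ν + P) + 1 by omega, dualHahn_eo,
    chiharaMonic_div_even c x₁ hμ₁ hε₁, chiharaMonic_odd _ _ _ hμ₂, mul_pow x₁, hε₂, mul_one,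
    ← conv_coeff hp']
  have h3 : hyp3F2 (-p.1)
      ((μ₂ + μ₁ + 1) / 2 + (dualHahnGrid j μ₂ μ₁ (2 * (ν + P) + 1) + 1) / 4)
      ((μ₂ + μ₁ + 1) / 2 - (dualHahnGrid j μ₂ μ₁ (2 * (ν + P) + 1) + 1) / 4)
      (-(ν + P : ℕ)) (μ₁ + 1 / 2) 1 =
      hyp3F2 (-p.1) (-P) (μ₁ + 1 / 2 + (μ₂ + 1 / 2 + 1) + P - 1)
        (-((ν + P : ℕ) : ℝ)) (μ₁ + 1 / 2) 1 := by
    rcases hz with hz | hz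
    · rw [hz, hyp3F2_comm₂₃]
      congr 1 <;> ring
    · rw [hz]
      congr 1 <;> ring
  rw [h3]
  -- The factor `(μ₁ + 1/2)_a` of the dual Hahn polynomial cancels the one in the denominator of the
  -- first Chihara factor. Once `Q * Q' = 1` is inserted on the right, the rest is a ring identity.
  have hA := poch_ne (show 0 < μ₁ + 1 / 2 by positivity) p.1
  generalize poch (μ₁ + 1 / 2) p.1 = Q at hA ⊢
  have hQ : Q * Q⁻¹ = 1 := mul_inv_cancel₀ hA
  rw [div_eq_mul_inv _ Q]
  generalize Q⁻¹ = Q' at hQ ⊢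
  have hk : ∀ r s : ℝ, r = s → Q * Q' * r = s := fun r s h => by rw [hQ, one_mul, h]
  refine Eq.trans ?_ (hk _ _ rfl)
  ring

lemma sum_convTerm_oe (ν P j : ℕ)
    (hz : (dualHahnGrid j μ₂ μ₁ (2 * (ν + P) + 1) + 1) / 4 = (μ₁ + μ₂ + 1) / 2 + P ∨
      (dualHahnGrid j μ₂ μ₁ (2 * (ν + P) + 1) + 1) / 4 = -((μ₁ + μ₂ + 1) / 2 + P)) :
    ∑ p ∈ antidiagonal (ν + P), convTerm μ₁ μ₂ ε₁ ε₂ c x₁ x₂ j (2 * p.1 + 1) (2 * p.2) =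
      (-1) ^ (j * (j + 1) / 2) * ((-1) ^ (ν + P) * 2 ^ (ν + P) * (ν + P)!) *
      ((dualHahnGrid j μ₂ μ₁ (2 * (ν + P) + 1) + 2 * μ₁ - 2 * μ₂ + 1) * (ε₂ / 2) *
        ((x₁ - c * ε₁) / (2 * (μ₁ + 1 / 2)))) *
      (poch (μ₂ + 1 / 2) P * ν ! / (poch (μ₁ + 1 / 2 + 1) P * (ν + P)!) *
        (((x₁ ^ 2 - c ^ 2) / 2 + (x₂ ^ 2 - x₁ ^ 2) / 2) ^ P *
          ₂F₁ (-(P : ℝ)) (μ₁ + 1 / 2 + 1 + (μ₂ + 1 / 2) + P - 1) (μ₂ + 1 / 2)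
            ((x₂ ^ 2 - x₁ ^ 2) / 2 / ((x₁ ^ 2 - c ^ 2) / 2 + (x₂ ^ 2 - x₁ ^ 2) / 2))) *
        lag ν (μ₁ + 1 / 2 + 1 + (μ₂ + 1 / 2) + 2 * P)
          ((x₁ ^ 2 - c ^ 2) / 2 + (x₂ ^ 2 - x₁ ^ 2) / 2)) := by
  rw [← lag_conv_hahn P ν (by positivity) (by positivity) _ _ hw, mul_sum]
  refine sum_congr rfl fun p hp => ?_
  have hp' := mem_antidiagonal.1 hp
  rw [convTerm, neg_one_pow_phase_oe, pow_succ (ε₂ / 2), half_pow_even hε₂,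
    show 2 * p.1 + 1 + 2 * p.2 = 2 * (ν + P) + 1 by omega, dualHahn_oo,
    chiharaMonic_div_odd c x₁ hμ₁ hε₁, chiharaMonic_even _ _ _ hμ₂, mul_pow x₁, hε₂, mul_one,
    ← conv_coeff hp']
  have h3 : hyp3F2 (-p.1)
      ((μ₂ + μ₁ + 1) / 2 + (dualHahnGrid j μ₂ μ₁ (2 * (ν + P) + 1) + 1) / 4)
      ((μ₂ + μ₁ + 1) / 2 - (dualHahnGrid j μ₂ μ₁ (2 * (ν + P) + 1) + 1) / 4)
      (-(ν + P : ℕ)) (μ₁ + 1 / 2 + 1) 1 =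
      hyp3F2 (-p.1) (-P) (μ₁ + 1 / 2 + 1 + (μ₂ + 1 / 2) + P - 1)
        (-((ν + P : ℕ) : ℝ)) (μ₁ + 1 / 2 + 1) 1 := by
    rcases hz with hz | hz
    · rw [hz, hyp3F2_comm₂₃]
      congr 1 <;> ring
    · rw [hz]
      congr 1 <;> ring
  rw [h3]
  have hA := poch_ne (show 0 < μ₁ + 1 / 2 + 1 by positivity) p.1
  generalize poch (μ₁ + 1 / 2 + 1) p.1 = Q at hA ⊢
  have hQ : Q * Q⁻¹ = 1 := mul_inv_cancel₀ hA
  rw [div_eq_mul_inv _ Q]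
  generalize Q⁻¹ = Q' at hQ ⊢
  have hk : ∀ r s : ℝ, r = s → Q * Q' * r = s := fun r s h => by rw [hQ, one_mul, h]
  refine Eq.trans ?_ (hk _ _ rfl)
  ring

end

/-! ### Normalization constants -/

lemma dualHahnNorm_zero_even (μ₁ μ₂ : ℝ) (m : ℕ) :
    dualHahnNorm 0 μ₂ μ₁ (2 * m) =
      poch (μ₁ + 1 / 2 + (μ₂ + 1 / 2) + m) m / poch (μ₁ + 1 / 2) m := by
  rw [dualHahnNorm, if_pos (even_two_mul m), if_pos (by simp), Nat.mul_div_cancel_left m two_pos]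
  push_cast
  rw [show -(2 * (m : ℝ)) - μ₂ - μ₁ = 1 - (μ₁ + 1 / 2 + (μ₂ + 1 / 2) + m) - m by ring,
    show (-(2 * (m : ℝ)) - 2 * μ₁ + 1) / 2 = 1 - (μ₁ + 1 / 2) - m by ring, poch_reflect,
    poch_reflect, mul_div_mul_left _ _ (by positivity)]
  simp

lemma dualHahnNorm_zero_odd (μ₁ μ₂ : ℝ) (m : ℕ) :
    dualHahnNorm 0 μ₂ μ₁ (2 * m + 1) =
      poch (μ₁ + 1 / 2 + (μ₂ + 1 / 2)) (m + 1) / poch (μ₂ + 1 / 2) (m + 1) := by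
  rw [dualHahnNorm, if_neg (by simp), if_pos (by simp), show (2 * m + 1 + 1) / 2 = m + 1 by omega,
    show μ₂ + μ₁ + 1 = μ₁ + 1 / 2 + (μ₂ + 1 / 2) by ring]
  simp

section

variable {μ₁ μ₂ : ℝ} (hμ₁ : 0 < μ₁) (hμ₂ : 0 < μ₂)
include hμ₁ hμ₂

/-- Every Gamma value is a Pochhammer symbol times one of the three values at `A`, `B`, `A + B + J`
(with `A = μ₁ + 1/2`, `B = μ₂ + 1/2`), and these three cancel. -/
lemma gamma_div_bigJacobiNorm_even (J : ℕ) :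
    Real.Gamma (μ₁ + 1 / 2) * Real.Gamma (μ₂ + 1 / 2) /
      (Real.Gamma (muCoupled μ₁ μ₂ (2 * J) + 1 / 2) * bigJacobiNorm (2 * J) (2 * μ₂) (2 * μ₁)) =
    poch (μ₂ + 1 / 2) J / (poch (μ₁ + 1 / 2) J * J ! *
      poch (μ₁ + 1 / 2 + (μ₂ + 1 / 2) + J) J) := by
  rw [bigJacobiNorm, if_pos (even_two_mul J), Nat.mul_div_cancel_left J two_pos, muCoupled]
  push_cast
  have hA : 0 < μ₁ + 1 / 2 := by positivity
  have hB : 0 < μ₂ + 1 / 2 := by positivity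
  rw [show μ₁ + μ₂ + 2 * (J : ℝ) + 1 / 2 + 1 / 2 = μ₁ + 1 / 2 + (μ₂ + 1 / 2) + J + J by ring,
    show (2 * (J : ℝ) + 2 * μ₁ + 1) / 2 = μ₁ + 1 / 2 + J by ring,
    show (2 * (J : ℝ) + 2 * μ₂ + 3) / 2 = μ₂ + 1 / 2 + J + 1 by ring,
    show (2 * (J : ℝ) + 2 * μ₂ + 1) = 2 * (μ₂ + 1 / 2 + J) by ring,
    show (2 * (J : ℝ) + 2 * μ₂ + 2 * μ₁ + 2) / 2 = μ₁ + 1 / 2 + (μ₂ + 1 / 2) + J by ring,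
    show (2 * μ₂ + 1) / 2 = μ₂ + 1 / 2 by ring]
  generalize μ₁ + 1 / 2 = A at hA ⊢
  generalize μ₂ + 1 / 2 = B at hB ⊢
  have hG : 0 < A + B + J := by positivity
  have hBJ : 0 < B + J := by positivity
  rw [Gamma_add_nat hG, Gamma_add_nat hA, Real.Gamma_add_one hBJ.ne', Gamma_add_nat hB]
  have h1 := Real.Gamma_pos_of_pos hA
  have h2 := Real.Gamma_pos_of_pos hB
  have h3 := Real.Gamma_pos_of_pos hG
  have h4 := poch_pos hA J
  have h5 := poch_pos hB J
  have h6 := poch_pos hG J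
  field_simp

lemma gamma_div_bigJacobiNorm_odd (J : ℕ) :
    Real.Gamma (μ₁ + 1 / 2) * Real.Gamma (μ₂ + 1 / 2) /
      (Real.Gamma (muCoupled μ₁ μ₂ (2 * J + 1) + 1 / 2) *
        bigJacobiNorm (2 * J + 1) (2 * μ₂) (2 * μ₁)) =
    poch (μ₂ + 1 / 2) (J + 1) / (poch (μ₁ + 1 / 2) (J + 1) * J ! *
      poch (μ₁ + 1 / 2 + (μ₂ + 1 / 2) + J) (J + 1)) := by
  rw [bigJacobiNorm, if_neg (by simp), Nat.add_sub_cancel, Nat.mul_div_cancel_left J two_pos,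
    show (2 * J + 1 + 1) / 2 = J + 1 by omega, muCoupled]
  push_cast
  have hA : 0 < μ₁ + 1 / 2 := by positivity
  have hB : 0 < μ₂ + 1 / 2 := by positivity
  rw [show μ₁ + μ₂ + (2 * (J : ℝ) + 1) + 1 / 2 + 1 / 2 =
      μ₁ + 1 / 2 + (μ₂ + 1 / 2) + J + (J + 1 : ℕ) by push_cast; ring,
    show (2 * (J : ℝ) + 1 + 2 * μ₁ + 2) / 2 = μ₁ + 1 / 2 + (J + 1 : ℕ) by push_cast; ring,
    show (2 * (J : ℝ) + 1 + 2 * μ₂ + 2) / 2 = μ₂ + 1 / 2 + (J + 1 : ℕ) by push_cast; ring,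
    show (2 * (J : ℝ) + 1 + 2 * μ₂ + 2 * μ₁ + 1) =
      2 * (μ₁ + 1 / 2 + (μ₂ + 1 / 2) + J) by ring,
    show (2 * (J : ℝ) + 1 + 2 * μ₂ + 2 * μ₁ + 3) / 2 =
      μ₁ + 1 / 2 + (μ₂ + 1 / 2) + J + 1 by ring,
    show (2 * μ₂ + 1) / 2 = μ₂ + 1 / 2 by ring]
  generalize μ₁ + 1 / 2 = A at hA ⊢
  generalize μ₂ + 1 / 2 = B at hB ⊢
  have hG : 0 < A + B + J := by positivity
  rw [Gamma_add_nat hG, Gamma_add_nat hA, Real.Gamma_add_one hG.ne', Gamma_add_nat hB]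
  have h1 := Real.Gamma_pos_of_pos hA
  have h2 := Real.Gamma_pos_of_pos hB
  have h3 := Real.Gamma_pos_of_pos hG
  have h4 := poch_pos hA (J + 1)
  have h5 := poch_pos hB (J + 1)
  have h6 := poch_pos hG (J + 1)
  field_simp

/-- For even `N` the weight is reversed, so its index is `N - 2J = 2ν`. Reflection makes the
Pochhammer parameters positive, and the signs cancel in pairs. -/
lemma dualHahnRho_ee (ν J : ℕ) :
    dualHahnRho (2 * J) μ₂ μ₁ (2 * (ν + J)) =
      (ν + J)! * poch (μ₂ + 1 / 2 + J) ν * poch (μ₁ + 1 / 2 + (μ₂ + 1 / 2) + 2 * J + ν) ν /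
        (ν ! * J ! * poch (μ₁ + 1 / 2 + J) ν * poch (μ₁ + 1 / 2 + (μ₂ + 1 / 2) + J) ν) := by
  rw [dualHahnRho, if_pos (even_two_mul _), show 2 * (ν + J) - 2 * J = 2 * ν by omega,
    dualHahnWeight, if_pos (even_two_mul _), if_pos (even_two_mul _),
    Nat.mul_div_cancel_left ν two_pos]
  have e : ((2 * (ν + J) : ℕ) : ℝ) = 2 * (ν + J) := by push_cast; ring
  rw [e, show -(2 * ((ν : ℝ) + J) / 2) = -((ν + J : ℕ) : ℝ) by push_cast; ring,
    show -((ν + J : ℕ) : ℝ) - μ₂ + 1 / 2 = 1 - (μ₂ + 1 / 2 + J) - ν by push_cast; ring,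
    show -(2 * ((ν : ℝ) + J)) - μ₂ - μ₁ =
      1 - (μ₁ + 1 / 2 + (μ₂ + 1 / 2) + 2 * J + ν) - ν by ring,
    show -((ν + J : ℕ) : ℝ) - μ₁ + 1 / 2 = 1 - (μ₁ + 1 / 2 + J) - ν by push_cast; ring,
    show -((ν + J : ℕ) : ℝ) - μ₂ - μ₁ =
      1 - (μ₁ + 1 / 2 + (μ₂ + 1 / 2) + J) - ν by push_cast; ring,
    poch_reflect, poch_reflect, poch_reflect, poch_reflect, poch_neg_nat rfl]
  have h1 := poch_pos (show 0 < μ₁ + 1 / 2 + J by positivity) ν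
  have h2 := poch_pos (show 0 < μ₁ + 1 / 2 + (μ₂ + 1 / 2) + J by positivity) ν
  have hs : ((-1 : ℝ) ^ ν) ^ 2 = 1 := by rw [← pow_mul, mul_comm, pow_mul]; simp
  generalize poch (μ₁ + 1 / 2 + J) ν = Q1 at *
  generalize poch (μ₁ + 1 / 2 + (μ₂ + 1 / 2) + J) ν = Q2 at *
  generalize poch (μ₂ + 1 / 2 + J) ν = Q3
  generalize poch (μ₁ + 1 / 2 + (μ₂ + 1 / 2) + 2 * J + ν) ν = Q4
  generalize (-1 : ℝ) ^ ν = s at hs ⊢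
  have hs0 : s ≠ 0 := by rintro rfl; norm_num at hs
  field_simp
  linear_combination Q3 * Q4 * hs

lemma dualHahnRho_oe (ν J : ℕ) :
    dualHahnRho (2 * J + 1) μ₂ μ₁ (2 * (ν + (J + 1))) =
      (ν + (J + 1))! * poch (μ₂ + 1 / 2 + (J + 1)) ν *
          poch (μ₁ + 1 / 2 + (μ₂ + 1 / 2) + 2 * (J + 1) + ν) ν /
        (ν ! * J ! * poch (μ₁ + 1 / 2 + (J + 1)) ν *
          poch (μ₁ + 1 / 2 + (μ₂ + 1 / 2) + J) (ν + 1)) := by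
  rw [dualHahnRho, if_pos (even_two_mul _), show 2 * (ν + (J + 1)) - (2 * J + 1) = 2 * ν + 1 by omega,
    dualHahnWeight, if_pos (even_two_mul _), if_neg (by simp), Nat.add_sub_cancel,
    Nat.mul_div_cancel_left ν two_pos, show (2 * ν + 1 + 1) / 2 = ν + 1 by omega]
  have e : ((2 * (ν + (J + 1)) : ℕ) : ℝ) = 2 * (ν + (J + 1)) := by push_cast; ring
  rw [e, show -(2 * ((ν : ℝ) + (J + 1)) / 2) = -((ν + (J + 1) : ℕ) : ℝ) by push_cast; ring,
    show -((ν + (J + 1) : ℕ) : ℝ) - μ₂ + 1 / 2 = 1 - (μ₂ + 1 / 2 + (J + 1)) - ν by push_cast; ring,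
    show -(2 * ((ν : ℝ) + (J + 1))) - μ₂ - μ₁ =
      1 - (μ₁ + 1 / 2 + (μ₂ + 1 / 2) + 2 * (J + 1) + ν) - ν by ring,
    show -((ν + (J + 1) : ℕ) : ℝ) - μ₁ + 1 / 2 = 1 - (μ₁ + 1 / 2 + (J + 1)) - ν by push_cast; ring,
    show -((ν + (J + 1) : ℕ) : ℝ) - μ₂ - μ₁ =
      1 - (μ₁ + 1 / 2 + (μ₂ + 1 / 2) + J) - (ν + 1 : ℕ) by push_cast; ring,
    poch_reflect, poch_reflect, poch_reflect, poch_reflect,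
    poch_neg_nat (show ν + 1 + J = ν + (J + 1) by ring)]
  have h1 := poch_pos (show 0 < μ₁ + 1 / 2 + (J + 1) by positivity) ν
  have h2 := poch_pos (show 0 < μ₁ + 1 / 2 + (μ₂ + 1 / 2) + J by positivity) (ν + 1)
  have hs : ((-1 : ℝ) ^ ν) ^ 2 = 1 := by rw [← pow_mul, mul_comm, pow_mul]; simp
  generalize poch (μ₁ + 1 / 2 + (J + 1)) ν = Q1 at *
  generalize poch (μ₁ + 1 / 2 + (μ₂ + 1 / 2) + J) (ν + 1) = Q2 at *
  rw [pow_succ]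
  generalize poch (μ₂ + 1 / 2 + (J + 1)) ν = Q3
  generalize poch (μ₁ + 1 / 2 + (μ₂ + 1 / 2) + 2 * (J + 1) + ν) ν = Q4
  generalize (-1 : ℝ) ^ ν = s at hs ⊢
  have hs0 : s ≠ 0 := by rintro rfl; norm_num at hs
  field_simp
  linear_combination Q3 * Q4 * hs

lemma dualHahnRho_eo (ν J : ℕ) :
    dualHahnRho (2 * J) μ₂ μ₁ (2 * (ν + J) + 1) =
      (ν + J)! * poch (μ₁ + 1 / 2) J * poch (μ₁ + 1 / 2 + (μ₂ + 1 / 2)) J /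
        (ν ! * J ! * poch (μ₂ + 1 / 2) J *
          poch (μ₁ + 1 / 2 + (μ₂ + 1 / 2) + (ν + J + 1)) J) := by
  rw [dualHahnRho, if_neg (by simp), dualHahnWeight, if_neg (by simp), if_pos (even_two_mul _),
    Nat.mul_div_cancel_left J two_pos]
  have e : ((2 * (ν + J) + 1 : ℕ) : ℝ) = 2 * (ν + J) + 1 := by push_cast; ring
  rw [e, show (1 - (2 * ((ν : ℝ) + J) + 1)) / 2 = -((ν + J : ℕ) : ℝ) by push_cast; ring,
    show μ₂ + μ₁ + 1 = μ₁ + 1 / 2 + (μ₂ + 1 / 2) by ring,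
    show (2 * ((ν : ℝ) + J) + 1 + 3) / 2 + μ₂ + μ₁ =
      μ₁ + 1 / 2 + (μ₂ + 1 / 2) + (ν + J + 1) by ring, poch_neg_nat (Nat.add_comm J ν)]
  have h1 := poch_pos (show 0 < μ₂ + 1 / 2 by positivity) J
  have h2 := poch_pos (show 0 < μ₁ + 1 / 2 + (μ₂ + 1 / 2) + (ν + J + 1) by positivity) J
  have hs : ((-1 : ℝ) ^ J) ^ 2 = 1 := by rw [← pow_mul, mul_comm, pow_mul]; simp
  generalize poch (μ₂ + 1 / 2) J = Q1 at *
  generalize poch (μ₁ + 1 / 2 + (μ₂ + 1 / 2) + (ν + J + 1)) J = Q2 at *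
  generalize poch (μ₁ + 1 / 2) J = Q3
  generalize poch (μ₁ + 1 / 2 + (μ₂ + 1 / 2)) J = Q4
  generalize (-1 : ℝ) ^ J = s at hs ⊢
  field_simp
  linear_combination Q3 * Q4 * hs

lemma dualHahnRho_oo (ν J : ℕ) :
    dualHahnRho (2 * J + 1) μ₂ μ₁ (2 * (ν + J) + 1) =
      (ν + J)! * poch (μ₁ + 1 / 2) (J + 1) * poch (μ₁ + 1 / 2 + (μ₂ + 1 / 2)) J /
        (ν ! * J ! * poch (μ₂ + 1 / 2) (J + 1) *
          poch (μ₁ + 1 / 2 + (μ₂ + 1 / 2) + (ν + J + 1)) J) := by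
  rw [dualHahnRho, if_neg (by simp), dualHahnWeight, if_neg (by simp), if_neg (by simp),
    Nat.add_sub_cancel, Nat.mul_div_cancel_left J two_pos,
    show (2 * J + 1 + 1) / 2 = J + 1 by omega]
  have e : ((2 * (ν + J) + 1 : ℕ) : ℝ) = 2 * (ν + J) + 1 := by push_cast; ring
  rw [e, show (1 - (2 * ((ν : ℝ) + J) + 1)) / 2 = -((ν + J : ℕ) : ℝ) by push_cast; ring,
    show μ₂ + μ₁ + 1 = μ₁ + 1 / 2 + (μ₂ + 1 / 2) by ring,
    show (2 * ((ν : ℝ) + J) + 1 + 3) / 2 + μ₂ + μ₁ =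
      μ₁ + 1 / 2 + (μ₂ + 1 / 2) + (ν + J + 1) by ring, poch_neg_nat (Nat.add_comm J ν)]
  have h1 := poch_pos (show 0 < μ₂ + 1 / 2 by positivity) (J + 1)
  have h2 := poch_pos (show 0 < μ₁ + 1 / 2 + (μ₂ + 1 / 2) + (ν + J + 1) by positivity) J
  have hs : ((-1 : ℝ) ^ J) ^ 2 = 1 := by rw [← pow_mul, mul_comm, pow_mul]; simp
  generalize poch (μ₂ + 1 / 2) (J + 1) = Q1 at *
  generalize poch (μ₁ + 1 / 2 + (μ₂ + 1 / 2) + (ν + J + 1)) J = Q2 at *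
  generalize poch (μ₁ + 1 / 2) (J + 1) = Q3
  generalize poch (μ₁ + 1 / 2 + (μ₂ + 1 / 2)) J = Q4
  generalize (-1 : ℝ) ^ J = s at hs ⊢
  field_simp
  linear_combination Q3 * Q4 * hs

/-- The square of the ratio between the two sides of the convolution identity. -/
lemma norm_ratio_ee (ν J : ℕ) :
    poch (μ₂ + 1 / 2) J / (poch (μ₁ + 1 / 2) J * J ! *
        poch (μ₁ + 1 / 2 + (μ₂ + 1 / 2) + J) J) /
        muFactorial (2 * ν) (muCoupled μ₁ μ₂ (2 * J)) =
      dualHahnRho (2 * J) μ₂ μ₁ (2 * (ν + J)) /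
        (muFactorial (2 * (ν + J)) μ₂ * dualHahnNorm 0 μ₂ μ₁ (2 * (ν + J))) *
      (2 ^ J * poch (μ₂ + 1 / 2) J / poch (μ₁ + 1 / 2) J) ^ 2 := by
  rw [dualHahnRho_ee hμ₁ hμ₂, dualHahnNorm_zero_even, muFactorial_even, muFactorial_even,
    show muCoupled μ₁ μ₂ (2 * J) + 1 / 2 = μ₁ + 1 / 2 + (μ₂ + 1 / 2) + 2 * J by
      rw [muCoupled]; push_cast; ring]
  have hA : 0 < μ₁ + 1 / 2 := by positivity
  have hB : 0 < μ₂ + 1 / 2 := by positivity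
  generalize μ₁ + 1 / 2 = A at hA ⊢
  generalize μ₂ + 1 / 2 = B at hB ⊢
  have a1 : poch A (ν + J) = poch A J * poch (A + J) ν := by rw [add_comm, poch_add]
  have b1 : poch B (ν + J) = poch B J * poch (B + J) ν := by rw [add_comm, poch_add]
  -- Both sides are `(A + B + J)_{2ν + J}`, cut into consecutive pieces in two ways. The other
  -- parities use the analogous cut.
  have g1 : poch (A + B + J) ν * poch (A + B + (ν + J : ℕ)) (ν + J) =
      poch (A + B + J) J * (poch (A + B + 2 * J) ν * poch (A + B + 2 * J + ν) ν) := by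
    rw [← poch_add, show A + B + ((ν + J : ℕ) : ℝ) = A + B + J + ν by push_cast; ring,
      ← poch_add, show A + B + 2 * (J : ℝ) = A + B + J + J by ring, ← poch_add]
    congr 1; ring
  have p1 := poch_pos hA J
  have p2 := poch_pos hB J
  have p3 := poch_pos (show 0 < A + J by positivity) ν
  have p4 := poch_pos (show 0 < B + J by positivity) ν
  have p5 := poch_pos (show 0 < A + B + J by positivity) ν
  have p6 := poch_pos (show 0 < A + B + J by positivity) J
  have p7 := poch_pos (show 0 < A + B + 2 * J by positivity) ν
  have p8 := poch_pos (show 0 < A + B + (ν + J : ℕ) by positivity) (ν + J)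
  have h4 : (4 : ℝ) ^ (ν + J) = 4 ^ ν * (2 ^ J) ^ 2 := by
    rw [pow_add, ← pow_mul, mul_comm J 2, pow_mul 2 2]; norm_num
  rw [a1, b1, h4]
  generalize poch (A + B + (ν + J : ℕ)) (ν + J) = Q8 at *
  generalize poch (A + B + J) ν = Q5 at *
  generalize poch (A + B + 2 * J) ν = Q7 at *
  generalize poch (A + B + J) J = Q6 at *
  generalize poch (A + B + 2 * J + ν) ν = Q9 at *
  generalize poch (A + J) ν = Q3 at *
  generalize poch (B + J) ν = Q4 at *
  field_simp
  linear_combination g1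

/-- The extra factor `1 / 2` for odd `j` appears when a perfect square is extracted under the root
in `convK_odd`. -/
lemma norm_ratio_oe (ν J : ℕ) :
    poch (μ₂ + 1 / 2) (J + 1) / (poch (μ₁ + 1 / 2) (J + 1) * J ! *
        poch (μ₁ + 1 / 2 + (μ₂ + 1 / 2) + J) (J + 1)) / 2 /
        muFactorial (2 * ν + 1) (muCoupled μ₁ μ₂ (2 * J + 1)) =
      dualHahnRho (2 * J + 1) μ₂ μ₁ (2 * (ν + (J + 1))) /
        (muFactorial (2 * (ν + (J + 1))) μ₂ * dualHahnNorm 0 μ₂ μ₁ (2 * (ν + (J + 1)))) *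
      (2 ^ J * poch (μ₂ + 1 / 2) (J + 1) / poch (μ₁ + 1 / 2) (J + 1)) ^ 2 := by
  rw [dualHahnRho_oe hμ₁ hμ₂, dualHahnNorm_zero_even, muFactorial_even, muFactorial_odd,
    show muCoupled μ₁ μ₂ (2 * J + 1) + 1 / 2 = μ₁ + 1 / 2 + (μ₂ + 1 / 2) + (2 * J + 1) by
      rw [muCoupled]; push_cast; ring]
  have hA : 0 < μ₁ + 1 / 2 := by positivity
  have hB : 0 < μ₂ + 1 / 2 := by positivity
  generalize μ₁ + 1 / 2 = A at hA ⊢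
  generalize μ₂ + 1 / 2 = B at hB ⊢
  have a1 : poch A (ν + (J + 1)) = poch A (J + 1) * poch (A + (J + 1)) ν := by
    rw [add_comm, poch_add]; push_cast; rfl
  have b1 : poch B (ν + (J + 1)) = poch B (J + 1) * poch (B + (J + 1)) ν := by
    rw [add_comm, poch_add]; push_cast; rfl
  have g1 : poch (A + B + J) (ν + 1) * poch (A + B + (ν + (J + 1) : ℕ)) (ν + (J + 1)) =
      poch (A + B + J) (J + 1) * (poch (A + B + (2 * J + 1)) (ν + 1) *
        poch (A + B + 2 * (J + 1) + ν) ν) := by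
    rw [show A + B + 2 * ((J : ℝ) + 1) + ν = A + B + (2 * J + 1) + (ν + 1 : ℕ) by push_cast; ring,
      show A + B + ((ν + (J + 1) : ℕ) : ℝ) = A + B + J + (ν + 1 : ℕ) by push_cast; ring,
      ← poch_add, ← poch_add,
      show A + B + (2 * (J : ℝ) + 1) = A + B + J + (J + 1 : ℕ) by push_cast; ring, ← poch_add]
    congr 1; ring
  have p1 := poch_pos hA (J + 1)
  have p2 := poch_pos hB (J + 1)
  have p3 := poch_pos (show 0 < A + (J + 1) by positivity) ν
  have p4 := poch_pos (show 0 < B + (J + 1) by positivity) ν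
  have p5 := poch_pos (show 0 < A + B + J by positivity) (ν + 1)
  have p6 := poch_pos (show 0 < A + B + J by positivity) (J + 1)
  have p7 := poch_pos (show 0 < A + B + (2 * J + 1) by positivity) (ν + 1)
  have p8 := poch_pos (show 0 < A + B + (ν + (J + 1) : ℕ) by positivity) (ν + (J + 1))
  have h4 : (4 : ℝ) ^ (ν + (J + 1)) = 4 * (4 ^ ν * (2 ^ J) ^ 2) := by
    rw [pow_add, pow_succ, ← pow_mul, mul_comm J 2, pow_mul 2 2]; norm_num; ring
  rw [a1, b1, h4]
  generalize poch (A + B + (ν + (J + 1) : ℕ)) (ν + (J + 1)) = Q8 at *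
  generalize poch (A + B + J) (ν + 1) = Q5 at *
  generalize poch (A + B + (2 * J + 1)) (ν + 1) = Q7 at *
  generalize poch (A + B + J) (J + 1) = Q6 at *
  generalize poch (A + B + 2 * (J + 1) + ν) ν = Q9 at *
  generalize poch (A + (J + 1)) ν = Q3 at *
  generalize poch (B + (J + 1)) ν = Q4 at *
  field_simp
  linear_combination 4 * g1

lemma norm_ratio_eo (ν J : ℕ) :
    poch (μ₂ + 1 / 2) J / (poch (μ₁ + 1 / 2) J * J ! *
        poch (μ₁ + 1 / 2 + (μ₂ + 1 / 2) + J) J) /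
        muFactorial (2 * ν + 1) (muCoupled μ₁ μ₂ (2 * J)) =
      dualHahnRho (2 * J) μ₂ μ₁ (2 * (ν + J) + 1) /
        (muFactorial (2 * (ν + J) + 1) μ₂ * dualHahnNorm 0 μ₂ μ₁ (2 * (ν + J) + 1)) *
      (2 ^ J * poch (μ₂ + 1 / 2) J / poch (μ₁ + 1 / 2) J) ^ 2 := by
  rw [dualHahnRho_eo hμ₁ hμ₂, dualHahnNorm_zero_odd, muFactorial_odd, muFactorial_odd,
    show muCoupled μ₁ μ₂ (2 * J) + 1 / 2 = μ₁ + 1 / 2 + (μ₂ + 1 / 2) + 2 * J by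
      rw [muCoupled]; push_cast; ring]
  have hA : 0 < μ₁ + 1 / 2 := by positivity
  have hB : 0 < μ₂ + 1 / 2 := by positivity
  generalize μ₁ + 1 / 2 = A at hA ⊢
  generalize μ₂ + 1 / 2 = B at hB ⊢
  have g1 : poch (A + B) (ν + J + 1) * poch (A + B + (ν + J + 1)) J =
      poch (A + B) J * (poch (A + B + J) J * poch (A + B + 2 * J) (ν + 1)) := by
    rw [show A + B + ((ν : ℝ) + J + 1) = A + B + (ν + J + 1 : ℕ) by push_cast; ring,
      ← poch_add, show A + B + 2 * (J : ℝ) = A + B + J + J by ring, ← poch_add, ← poch_add]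
    congr 1; ring
  have p1 := poch_pos hA J
  have p2 := poch_pos hB J
  have p4 := poch_pos hB (ν + J + 1)
  have p5 := poch_pos (show 0 < A + B by positivity) (ν + J + 1)
  have p6 := poch_pos (show 0 < A + B + J by positivity) J
  have p7 := poch_pos (show 0 < A + B + 2 * J by positivity) (ν + 1)
  have p8 := poch_pos (show 0 < A + B + (ν + J + 1) by positivity) J
  have h4 : (4 : ℝ) ^ (ν + J) = 4 ^ ν * (2 ^ J) ^ 2 := by
    rw [pow_add, ← pow_mul, mul_comm J 2, pow_mul 2 2]; norm_num
  rw [h4]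
  generalize poch (A + B) (ν + J + 1) = Q5 at *
  generalize poch (A + B + J) J = Q6 at *
  generalize poch (A + B + 2 * J) (ν + 1) = Q7 at *
  generalize poch (A + B + (ν + J + 1)) J = Q8 at *
  field_simp
  linear_combination g1

lemma norm_ratio_oo (ν J : ℕ) :
    poch (μ₂ + 1 / 2) (J + 1) / (poch (μ₁ + 1 / 2) (J + 1) * J ! *
        poch (μ₁ + 1 / 2 + (μ₂ + 1 / 2) + J) (J + 1)) / 2 /
        muFactorial (2 * ν) (muCoupled μ₁ μ₂ (2 * J + 1)) =
      dualHahnRho (2 * J + 1) μ₂ μ₁ (2 * (ν + J) + 1) /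
        (muFactorial (2 * (ν + J) + 1) μ₂ * dualHahnNorm 0 μ₂ μ₁ (2 * (ν + J) + 1)) *
      (2 ^ J * poch (μ₂ + 1 / 2) (J + 1) / poch (μ₁ + 1 / 2) (J + 1)) ^ 2 := by
  rw [dualHahnRho_oo hμ₁ hμ₂, dualHahnNorm_zero_odd, muFactorial_odd, muFactorial_even,
    show muCoupled μ₁ μ₂ (2 * J + 1) + 1 / 2 = μ₁ + 1 / 2 + (μ₂ + 1 / 2) + (2 * J + 1) by
      rw [muCoupled]; push_cast; ring]
  have hA : 0 < μ₁ + 1 / 2 := by positivity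
  have hB : 0 < μ₂ + 1 / 2 := by positivity
  generalize μ₁ + 1 / 2 = A at hA ⊢
  generalize μ₂ + 1 / 2 = B at hB ⊢
  have g1 : poch (A + B) (ν + J + 1) * poch (A + B + (ν + J + 1)) J =
      poch (A + B) J * (poch (A + B + J) (J + 1) * poch (A + B + (2 * J + 1)) ν) := by
    rw [show A + B + ((ν : ℝ) + J + 1) = A + B + (ν + J + 1 : ℕ) by push_cast; ring,
      ← poch_add, show A + B + (2 * (J : ℝ) + 1) = A + B + J + (J + 1 : ℕ) by push_cast; ring,
      ← poch_add, ← poch_add]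
    congr 1; ring
  have p1 := poch_pos hA (J + 1)
  have p2 := poch_pos hB (J + 1)
  have p4 := poch_pos hB (ν + J + 1)
  have p5 := poch_pos (show 0 < A + B by positivity) (ν + J + 1)
  have p6 := poch_pos (show 0 < A + B + J by positivity) (J + 1)
  have p7 := poch_pos (show 0 < A + B + (2 * J + 1) by positivity) ν
  have p8 := poch_pos (show 0 < A + B + (ν + J + 1) by positivity) J
  have h4 : (4 : ℝ) ^ (ν + J) = 4 ^ ν * (2 ^ J) ^ 2 := by
    rw [pow_add, ← pow_mul, mul_comm J 2, pow_mul 2 2]; norm_num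
  rw [h4]
  generalize poch (A + B) (ν + J + 1) = Q5 at *
  generalize poch (A + B + J) (J + 1) = Q6 at *
  generalize poch (A + B + (2 * J + 1)) ν = Q7 at *
  generalize poch (A + B + (ν + J + 1)) J = Q8 at *
  field_simp
  linear_combination g1

end

/-! ### The convolution identity without square roots -/

lemma dualHahnGrid_of_even {j M : ℕ} (h : Even (j + M)) (η ξ : ℝ) :
    dualHahnGrid j η ξ M = -(2 * j + 2 * η + 2 * ξ + 1) := by
  rw [dualHahnGrid, pow_succ, h.neg_one_pow]; ring

lemma dualHahnGrid_of_odd {j M : ℕ} (h : Odd (j + M)) (η ξ : ℝ) :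
    dualHahnGrid j η ξ M = 2 * j + 2 * η + 2 * ξ + 1 := by
  rw [dualHahnGrid, pow_succ, h.neg_one_pow]; ring

/-- Needed for `j = 0`, where the odd-odd terms vanish and the total degree may be `0`. -/
lemma sum_antidiagonal_even_of_vanish (f : ℕ → ℕ → ℝ) (m : ℕ)
    (hf : ∀ a b, f (2 * a + 1) (2 * b + 1) = 0) :
    ∑ p ∈ antidiagonal (2 * m), f p.1 p.2 = ∑ p ∈ antidiagonal m, f (2 * p.1) (2 * p.2) := by
  cases m with
  | zero => simp
  | succ m => rw [sum_antidiagonal_even]; simp [hf]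

section

variable {μ₁ μ₂ ε₁ ε₂ c x₁ x₂ : ℝ}

lemma jacobi_argument (hε₁ : ε₁ ^ 2 = 1) (hε₂ : ε₂ ^ 2 = 1) (hx₂ : x₂ ≠ 0) :
    (1 - (ε₂ * x₁ / x₂) ^ 2) / (1 - (-(c * ε₁ * ε₂ / x₂)) ^ 2) =
      (x₂ ^ 2 - x₁ ^ 2) / 2 / ((x₁ ^ 2 - c ^ 2) / 2 + (x₂ ^ 2 - x₁ ^ 2) / 2) := by
  have h1 : 1 - (ε₂ * x₁ / x₂) ^ 2 = (x₂ ^ 2 - x₁ ^ 2) / x₂ ^ 2 := by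
    rw [div_pow, mul_pow, hε₂]; field_simp
  have h2 : 1 - (-(c * ε₁ * ε₂ / x₂)) ^ 2 = (x₂ ^ 2 - c ^ 2) / x₂ ^ 2 := by
    rw [neg_pow, div_pow, mul_pow, mul_pow, hε₂, hε₁]; field_simp
  rw [h1, h2, div_div_div_cancel_right₀ (pow_ne_zero 2 hx₂), ← add_div,
    div_div_div_cancel_right₀ two_ne_zero]
  congr 1; ring

lemma jacobi_factor (hx₂ : x₂ ≠ 0) :
    (1 - ε₂ * x₁ / x₂) / (1 + -(c * ε₁ * ε₂ / x₂)) = (x₂ - x₁ * ε₂) / (x₂ - c * ε₁ * ε₂) := by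
  have h1 : 1 - ε₂ * x₁ / x₂ = (x₂ - x₁ * ε₂) / x₂ := by field_simp
  have h2 : 1 + -(c * ε₁ * ε₂ / x₂) = (x₂ - c * ε₁ * ε₂) / x₂ := by field_simp; ring
  rw [h1, h2, div_div_div_cancel_right₀ hx₂]

lemma neg_one_pow_mul_self (J ν : ℕ) : (-1 : ℝ) ^ J * (-1) ^ (ν + J) = (-1) ^ ν := by
  rw [pow_add, mul_left_comm, ← mul_pow]; simp

/-- Since `x₂² - c² = (x₂ - c ε₁ ε₂)(x₂ + c ε₁ ε₂)`, the left side is `(x₂ + c ε₁ ε₂)(x₂ - x₁ ε₂) /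
2`. The correction to `y` on the right is exactly what the odd-odd terms contribute. -/
lemma jacobi_factor_mul (hε₁ : ε₁ ^ 2 = 1) (hε₂ : ε₂ ^ 2 = 1) (hs : x₂ - c * ε₁ * ε₂ ≠ 0) :
    ((x₁ ^ 2 - c ^ 2) / 2 + (x₂ ^ 2 - x₁ ^ 2) / 2) * ((x₂ - x₁ * ε₂) / (x₂ - c * ε₁ * ε₂)) =
      (x₂ ^ 2 - x₁ ^ 2) / 2 - ε₂ / 2 * ((x₁ - c * ε₁) * (x₂ - x₁ * ε₂)) := by
  rw [mul_div_assoc', div_eq_iff hs]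
  linear_combination ((x₂ - x₁ * ε₂) * c ^ 2 / 2 * ε₂ ^ 2) * hε₁ +
    ((x₂ - x₁ * ε₂) * c ^ 2 / 2 - x₁ ^ 2 / 2 * (x₂ - c * ε₁ * ε₂)) * hε₂

/-- Sorts the constants of a class sum: `(ν + P)!` cancels, `2^ν ν!` belongs to the Chihara
polynomial on the left side, and `2^P b / a` goes to the common prefactor. -/
lemma factorial_cancel (s t u f w L b a : ℝ) (ν P : ℕ) (hs : s * t = u) :
    s * (t * 2 ^ (ν + P) * (ν + P)!) * (b * ν ! / (a * (ν + P)!) * (w * f) * L) =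
      u * 2 ^ ν * ν ! * (2 ^ P * (b / a)) * (w * f) * L := by
  have : ((ν + P)! : ℝ) ≠ 0 := by positivity
  rw [← hs, pow_add, mul_div_mul_comm]
  field_simp

variable (hμ₁ : 0 < μ₁) (hμ₂ : 0 < μ₂) (hε₁ : ε₁ ^ 2 = 1) (hε₂ : ε₂ ^ 2 = 1)
  (hw : (x₁ ^ 2 - c ^ 2) / 2 + (x₂ ^ 2 - x₁ ^ 2) / 2 ≠ 0) (hx₂ : x₂ ≠ 0)
  (hs : x₂ - c * ε₁ * ε₂ ≠ 0)
include hμ₁ hμ₂ hε₁ hε₂ hw hx₂ hs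

lemma sum_convTerm_even_even (ν J : ℕ) :
    ∑ p ∈ antidiagonal (2 * ν + 2 * J), convTerm μ₁ μ₂ ε₁ ε₂ c x₁ x₂ (2 * J) p.1 p.2 =
      2 ^ J * poch (μ₂ + 1 / 2) J / poch (μ₁ + 1 / 2) J *
        chiharaMonic (2 * ν) x₂ (muCoupled μ₁ μ₂ (2 * J)) (c * epsCoupled ε₁ ε₂ (2 * J)) *
        ((x₂ ^ 2 - c ^ 2) / 2) ^ J *
        bigJacobi (2 * J) (ε₂ * x₁ / x₂) (2 * μ₂) (2 * μ₁) (-(c * ε₁ * ε₂ / x₂)) := by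
  have hμ : 0 < muCoupled μ₁ μ₂ (2 * J) := by unfold muCoupled; positivity
  have hε : (c * epsCoupled ε₁ ε₂ (2 * J)) ^ 2 = c ^ 2 := by
    rw [epsCoupled, pow_mul]; simp [mul_pow, hε₁, hε₂]
  have hG : muCoupled μ₁ μ₂ (2 * J) + 1 / 2 = μ₁ + 1 / 2 + (μ₂ + 1 / 2) + 2 * J := by
    rw [muCoupled]; push_cast; ring
  have hW : (x₂ ^ 2 - c ^ 2) / 2 = (x₁ ^ 2 - c ^ 2) / 2 + (x₂ ^ 2 - x₁ ^ 2) / 2 := by ring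
  have hgrid : ∀ M, dualHahnGrid (2 * J) μ₂ μ₁ (2 * M) = -(4 * J + 2 * μ₂ + 2 * μ₁ + 1) := by
    intro M
    rw [dualHahnGrid_of_even ⟨J + M, by ring⟩]; push_cast; ring
  have hee := sum_convTerm_ee c x₁ x₂ hμ₁ hμ₂ hε₁ hε₂ hw ν J (2 * J)
    (Or.inr (by rw [hgrid]; ring))
  rw [neg_one_pow_triangle_even,
    factorial_cancel _ _ _ _ _ _ _ _ _ _ (neg_one_pow_mul_self J ν)] at hee
  rw [chiharaMonic_even _ _ _ hμ, hε, hG, hW]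
  cases J with
  | zero =>
    rw [← mul_add, sum_antidiagonal_even_of_vanish (convTerm μ₁ μ₂ ε₁ ε₂ c x₁ x₂ (2 * 0)), hee,
      bigJacobi_zero, hyp2F1_neg_nat]
    · simp
    · intro a b
      have h0 : 2 * a + 1 + (2 * b + 1) = 2 * (a + b + 1) := by ring
      -- For `j = 0` the grid point is `-(2 μ₂ + 2 μ₁ + 1)`, so the linear factor of the odd dual
      -- Hahn polynomial is zero.
      rw [convTerm, h0, dualHahn_oe, hgrid,
        show -(4 * ((0 : ℕ) : ℝ) + 2 * μ₂ + 2 * μ₁ + 1) + 2 * μ₂ + 2 * μ₁ + 1 = 0 by simp; ring]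
      simp
  | succ J =>
    have hoo := sum_convTerm_oo c x₁ x₂ hμ₁ hμ₂ hε₁ hε₂ hw ν J (2 * (J + 1))
      (Or.inr (by rw [hgrid]; push_cast; ring))
    have hsgn : -(-1 : ℝ) ^ (J + 1) * (-1) ^ (ν + J) = (-1) ^ ν := by
      rw [pow_succ, ← neg_one_pow_mul_self J ν]; ring
    rw [neg_one_pow_triangle_even, hgrid, mul_right_comm _ (_ * _ * (_ - _)),
      factorial_cancel _ _ _ _ _ _ _ _ _ _ hsgn,
      show μ₁ + 1 / 2 + 1 + (μ₂ + 1 / 2 + 1) + (J : ℝ) - 1 =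
        μ₁ + 1 / 2 + (μ₂ + 1 / 2) + J + 1 by ring,
      show μ₁ + 1 / 2 + 1 + (μ₂ + 1 / 2 + 1) + 2 * (J : ℝ) =
        μ₁ + 1 / 2 + (μ₂ + 1 / 2) + 2 * ((J + 1 : ℕ) : ℝ) by push_cast; ring] at hoo
    rw [show μ₁ + 1 / 2 + (μ₂ + 1 / 2) + ((J + 1 : ℕ) : ℝ) - 1 =
        μ₁ + 1 / 2 + (μ₂ + 1 / 2) + J by push_cast; ring,
      hyp2F1_contiguous J _ _ (show 0 < μ₂ + 1 / 2 by positivity)] at hee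
    rw [show 2 * ν + 2 * (J + 1) = 2 * (ν + J + 1) by ring,
      sum_antidiagonal_even (convTerm μ₁ μ₂ ε₁ ε₂ c x₁ x₂ (2 * (J + 1))), hoo,
      show ν + J + 1 = ν + (J + 1) by ring, hee, bigJacobi_even, jacobi_argument hε₁ hε₂ hx₂,
      jacobi_factor hx₂,
      show μ₁ + 1 / 2 + (μ₂ + 1 / 2) + ((J + 1 : ℕ) : ℝ) =
        μ₁ + 1 / 2 + (μ₂ + 1 / 2) + J + 1 by push_cast; ring]
    have hr := jacobi_factor_mul (x₁ := x₁) hε₁ hε₂ hs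
    have hA0 : 0 < μ₁ + 1 / 2 := by positivity
    have hB0 : 0 < μ₂ + 1 / 2 := by positivity
    have hA1 := poch_pos (show 0 < μ₁ + 1 / 2 + 1 by positivity) J
    have hB1 := poch_pos (show 0 < μ₂ + 1 / 2 + 1 by positivity) J
    rw [poch_succ_left, poch_succ_left]
    generalize lag ν _ _ = L
    generalize (₂F₁ (-((J + 1 : ℕ) : ℝ)) _ _ _ : ℝ) = F1
    generalize (₂F₁ (-(J : ℝ)) _ _ _ : ℝ) = F2
    generalize (x₂ - x₁ * ε₂) / (x₂ - c * ε₁ * ε₂) = r at hr ⊢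
    generalize (x₁ ^ 2 - c ^ 2) / 2 + (x₂ ^ 2 - x₁ ^ 2) / 2 = w at hw hr ⊢
    generalize (x₂ ^ 2 - x₁ ^ 2) / 2 = y at hr ⊢
    generalize x₂ - x₁ * ε₂ = t at hr ⊢
    generalize x₁ - c * ε₁ = u at hr ⊢
    generalize poch (μ₁ + 1 / 2 + 1) J = a at hA1 ⊢
    generalize poch (μ₂ + 1 / 2 + 1) J = b at hB1 ⊢
    rw [show -(4 * ((J + 1 : ℕ) : ℝ) + 2 * μ₂ + 2 * μ₁ + 1) + 2 * μ₂ + 2 * μ₁ + 1 =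
      -(4 * (J + 1)) by push_cast; ring]
    generalize μ₁ + 1 / 2 = A at hA0 ⊢
    generalize μ₂ + 1 / 2 = B at hB0 ⊢
    -- Eliminating `y` by `jacobi_factor_mul` cancels the odd-odd sum against part of the contiguous
    -- term; what remains is the second series of the Big `-1` Jacobi polynomial.
    obtain rfl : y = w * r + ε₂ / 2 * (u * t) := by rw [hr]; ring
    rw [pow_succ, pow_succ w]
    field_simp
    ring

lemma sum_convTerm_odd_odd (ν J : ℕ) :
    ∑ p ∈ antidiagonal (2 * ν + 1 + (2 * J + 1)),
        convTerm μ₁ μ₂ ε₁ ε₂ c x₁ x₂ (2 * J + 1) p.1 p.2 =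
      2 ^ J * poch (μ₂ + 1 / 2) (J + 1) / poch (μ₁ + 1 / 2) (J + 1) *
        chiharaMonic (2 * ν + 1) x₂ (muCoupled μ₁ μ₂ (2 * J + 1))
          (c * epsCoupled ε₁ ε₂ (2 * J + 1)) *
        (((x₂ ^ 2 - c ^ 2) / 2) ^ J * (x₂ - c * ε₁ * ε₂)) *
        bigJacobi (2 * J + 1) (ε₂ * x₁ / x₂) (2 * μ₂) (2 * μ₁) (-(c * ε₁ * ε₂ / x₂)) := by
  have hμ : 0 < muCoupled μ₁ μ₂ (2 * J + 1) := by unfold muCoupled; positivity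
  have hε0 : c * epsCoupled ε₁ ε₂ (2 * J + 1) = -(c * ε₁ * ε₂) := by
    rw [epsCoupled, pow_succ, pow_mul]; simp; ring
  have hε : (-(c * ε₁ * ε₂)) ^ 2 = c ^ 2 := by simp [mul_pow, hε₁, hε₂]
  have hG : muCoupled μ₁ μ₂ (2 * J + 1) + 1 / 2 + 1 =
      μ₁ + 1 / 2 + (μ₂ + 1 / 2) + 2 * ((J + 1 : ℕ) : ℝ) := by
    rw [muCoupled]; push_cast; ring
  have hW : (x₂ ^ 2 - c ^ 2) / 2 = (x₁ ^ 2 - c ^ 2) / 2 + (x₂ ^ 2 - x₁ ^ 2) / 2 := by ring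
  have hgrid : ∀ M, dualHahnGrid (2 * J + 1) μ₂ μ₁ (2 * M) =
      4 * (J + 1) + 2 * μ₂ + 2 * μ₁ - 1 := by
    intro M
    rw [dualHahnGrid_of_odd ⟨J + M, by ring⟩]; push_cast; ring
  have hee := sum_convTerm_ee c x₁ x₂ hμ₁ hμ₂ hε₁ hε₂ hw ν (J + 1) (2 * J + 1)
    (Or.inl (by rw [hgrid]; push_cast; ring))
  rw [neg_one_pow_triangle_odd,
    factorial_cancel _ _ _ _ _ _ _ _ _ _ (neg_one_pow_mul_self (J + 1) ν),
    show μ₁ + 1 / 2 + (μ₂ + 1 / 2) + ((J + 1 : ℕ) : ℝ) - 1 =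
        μ₁ + 1 / 2 + (μ₂ + 1 / 2) + J by push_cast; ring,
    hyp2F1_contiguous_succ J _ _ (show 0 < μ₂ + 1 / 2 by positivity)] at hee
  have hoo := sum_convTerm_oo c x₁ x₂ hμ₁ hμ₂ hε₁ hε₂ hw ν J (2 * J + 1)
    (Or.inl (by rw [hgrid]; ring))
  have hsgn : -(-1 : ℝ) ^ (J + 1) * (-1) ^ (ν + J) = (-1) ^ ν := by
    rw [pow_succ, ← neg_one_pow_mul_self J ν]; ring
  rw [neg_one_pow_triangle_odd, hgrid, mul_right_comm _ (_ * _ * (_ - _)),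
    factorial_cancel _ _ _ _ _ _ _ _ _ _ hsgn,
    show μ₁ + 1 / 2 + 1 + (μ₂ + 1 / 2 + 1) + (J : ℝ) - 1 =
      μ₁ + 1 / 2 + (μ₂ + 1 / 2) + J + 1 by ring,
    show μ₁ + 1 / 2 + 1 + (μ₂ + 1 / 2 + 1) + 2 * (J : ℝ) =
      μ₁ + 1 / 2 + (μ₂ + 1 / 2) + 2 * ((J + 1 : ℕ) : ℝ) by push_cast; ring] at hoo
  rw [chiharaMonic_odd _ _ _ hμ, hε0, hε, hG, hW,
    show 2 * ν + 1 + (2 * J + 1) = 2 * (ν + J + 1) by ring,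
    sum_antidiagonal_even (convTerm μ₁ μ₂ ε₁ ε₂ c x₁ x₂ (2 * J + 1)), hoo,
    show ν + J + 1 = ν + (J + 1) by ring, hee, bigJacobi_odd, jacobi_argument hε₁ hε₂ hx₂,
    jacobi_factor hx₂]
  have hr := jacobi_factor_mul (x₁ := x₁) hε₁ hε₂ hs
  have hd : (x₂ - -(c * ε₁ * ε₂)) * (x₂ - c * ε₁ * ε₂) =
      2 * ((x₁ ^ 2 - c ^ 2) / 2 + (x₂ ^ 2 - x₁ ^ 2) / 2) := by linear_combination -hε
  have hA0 : 0 < μ₁ + 1 / 2 := by positivity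
  have hB0 : 0 < μ₂ + 1 / 2 := by positivity
  have hA1 := poch_pos (show 0 < μ₁ + 1 / 2 + 1 by positivity) J
  have hB1 := poch_pos (show 0 < μ₂ + 1 / 2 + 1 by positivity) J
  rw [poch_succ_left, poch_succ_left]
  generalize lag ν _ _ = L
  generalize (₂F₁ (-(J : ℝ)) (μ₁ + 1 / 2 + (μ₂ + 1 / 2) + J) (μ₂ + 1 / 2) _ : ℝ) = F1
  generalize (₂F₁ (-(J : ℝ)) (μ₁ + 1 / 2 + (μ₂ + 1 / 2) + J + 1) (μ₂ + 1 / 2 + 1) _ : ℝ) = F2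
  generalize (x₂ - x₁ * ε₂) / (x₂ - c * ε₁ * ε₂) = r at hr ⊢
  generalize (x₁ ^ 2 - c ^ 2) / 2 + (x₂ ^ 2 - x₁ ^ 2) / 2 = w at hw hr hd ⊢
  generalize (x₂ ^ 2 - x₁ ^ 2) / 2 = y at hr ⊢
  generalize x₂ - x₁ * ε₂ = t at hr ⊢
  generalize x₁ - c * ε₁ = u at hr ⊢
  generalize x₂ - -(c * ε₁ * ε₂) = d at hd ⊢
  generalize x₂ - c * ε₁ * ε₂ = e at hd ⊢
  generalize poch (μ₁ + 1 / 2 + 1) J = a at hA1 ⊢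
  generalize poch (μ₂ + 1 / 2 + 1) J = b at hB1 ⊢
  rw [show 4 * ((J : ℝ) + 1) + 2 * μ₂ + 2 * μ₁ - 1 + 2 * μ₂ + 2 * μ₁ + 1 =
    4 * (μ₁ + 1 / 2 + (μ₂ + 1 / 2) + J) by ring]
  generalize μ₁ + 1 / 2 = A at hA0 ⊢
  generalize μ₂ + 1 / 2 = B at hB0 ⊢
  obtain rfl : y = w * r + ε₂ / 2 * (u * t) := by rw [hr]; ring
  -- The linear factor of the odd Chihara polynomial and `x₂ - c ε₁ ε₂` are brought together; their
  -- product is `x₂² - c² = 2 w`, the missing power of `w`.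
  rw [show ∀ q k l m : ℝ, q * (k * d * L) * (l * e) * m = q * (k * L) * l * m * (d * e) by
    intros; ring, hd]
  rw [pow_succ, pow_succ w]
  field_simp
  ring

lemma sum_convTerm_odd_even (ν J : ℕ) :
    ∑ p ∈ antidiagonal (2 * ν + 1 + 2 * J),
        convTerm μ₁ μ₂ ε₁ ε₂ c x₁ x₂ (2 * J) p.1 p.2 =
      2 ^ J * poch (μ₂ + 1 / 2) J / poch (μ₁ + 1 / 2) J *
        chiharaMonic (2 * ν + 1) x₂ (muCoupled μ₁ μ₂ (2 * J)) (c * epsCoupled ε₁ ε₂ (2 * J)) *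
        ((x₂ ^ 2 - c ^ 2) / 2) ^ J *
        bigJacobi (2 * J) (ε₂ * x₁ / x₂) (2 * μ₂) (2 * μ₁) (-(c * ε₁ * ε₂ / x₂)) := by
  have hμ : 0 < muCoupled μ₁ μ₂ (2 * J) := by unfold muCoupled; positivity
  have hε0 : c * epsCoupled ε₁ ε₂ (2 * J) = c * ε₁ * ε₂ := by
    rw [epsCoupled, pow_mul]; simp; ring
  have hε : (c * ε₁ * ε₂) ^ 2 = c ^ 2 := by simp [mul_pow, hε₁, hε₂]
  have hG : muCoupled μ₁ μ₂ (2 * J) + 1 / 2 + 1 =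
      μ₁ + 1 / 2 + (μ₂ + 1 / 2) + 1 + 2 * J := by
    rw [muCoupled]; push_cast; ring
  have hW : (x₂ ^ 2 - c ^ 2) / 2 = (x₁ ^ 2 - c ^ 2) / 2 + (x₂ ^ 2 - x₁ ^ 2) / 2 := by ring
  have hgrid : ∀ M, dualHahnGrid (2 * J) μ₂ μ₁ (2 * M + 1) = 4 * J + 2 * μ₂ + 2 * μ₁ + 1 := by
    intro M
    rw [dualHahnGrid_of_odd ⟨J + M, by ring⟩]; push_cast; ring
  have heo := sum_convTerm_eo c x₁ x₂ hμ₁ hμ₂ hε₁ hε₂ hw ν J (2 * J)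
    (Or.inl (by rw [hgrid]; ring))
  have hoe := sum_convTerm_oe c x₁ x₂ hμ₁ hμ₂ hε₁ hε₂ hw ν J (2 * J)
    (Or.inl (by rw [hgrid]; ring))
  rw [neg_one_pow_triangle_even, mul_right_comm _ (x₂ - x₁ * ε₂),
    factorial_cancel _ _ _ _ _ _ _ _ _ _ (neg_one_pow_mul_self J ν),
    show μ₁ + 1 / 2 + (μ₂ + 1 / 2 + 1) + (J : ℝ) - 1 =
      μ₁ + 1 / 2 + (μ₂ + 1 / 2) + J by ring,
    show μ₁ + 1 / 2 + (μ₂ + 1 / 2 + 1) + 2 * (J : ℝ) =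
      μ₁ + 1 / 2 + (μ₂ + 1 / 2) + 1 + 2 * J by ring] at heo
  rw [neg_one_pow_triangle_even, hgrid, mul_right_comm _ (_ * _ * (_ / _)),
    factorial_cancel _ _ _ _ _ _ _ _ _ _ (neg_one_pow_mul_self J ν),
    show μ₁ + 1 / 2 + 1 + (μ₂ + 1 / 2) + (J : ℝ) - 1 =
      μ₁ + 1 / 2 + (μ₂ + 1 / 2) + J by ring,
    show μ₁ + 1 / 2 + 1 + (μ₂ + 1 / 2) + 2 * (J : ℝ) =
      μ₁ + 1 / 2 + (μ₂ + 1 / 2) + 1 + 2 * J by ring] at hoe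
  rw [chiharaMonic_odd _ _ _ hμ, hε0, hε, hG, hW,
    show 2 * ν + 1 + 2 * J = 2 * (ν + J) + 1 by ring,
    sum_antidiagonal_odd (convTerm μ₁ μ₂ ε₁ ε₂ c x₁ x₂ (2 * J)), heo, hoe]
  have hA0 : 0 < μ₁ + 1 / 2 := by positivity
  have hB0 : 0 < μ₂ + 1 / 2 := by positivity
  have hBJ : 0 < μ₂ + 1 / 2 + J := by positivity
  have hAJ : 0 < μ₁ + 1 / 2 + J := by positivity
  have hA1 := poch_pos hA0 J
  have hB1 := poch_pos hB0 J
  have hA2 : poch (μ₁ + 1 / 2 + 1) J = poch (μ₁ + 1 / 2) J * (μ₁ + 1 / 2 + J) / (μ₁ + 1 / 2) := by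
    rw [eq_div_iff hA0.ne', ← poch_succ, poch_succ_left]; ring
  have hB2 : poch (μ₂ + 1 / 2 + 1) J = poch (μ₂ + 1 / 2) J * (μ₂ + 1 / 2 + J) / (μ₂ + 1 / 2) := by
    rw [eq_div_iff hB0.ne', ← poch_succ, poch_succ_left]; ring
  -- Multiplying by the denominator and writing `x₂ - c ε₁ ε₂ = (x₂ - x₁ ε₂) + ε₂ (x₁ - c ε₁)`
  -- separates the two parity classes; the contiguous relation merges the two series multiplied by
  -- `x₂ - x₁ ε₂`.
  have hcomb : (x₂ - c * ε₁ * ε₂) *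
      bigJacobi (2 * J) (ε₂ * x₁ / x₂) (2 * μ₂) (2 * μ₁) (-(c * ε₁ * ε₂ / x₂)) =
      ε₂ * (x₁ - c * ε₁) *
        ₂F₁ (-(J : ℝ)) (μ₁ + 1 / 2 + (μ₂ + 1 / 2) + J) (μ₂ + 1 / 2)
          ((x₂ ^ 2 - x₁ ^ 2) / 2 / ((x₁ ^ 2 - c ^ 2) / 2 + (x₂ ^ 2 - x₁ ^ 2) / 2)) +
      (x₂ - x₁ * ε₂) * ((μ₂ + 1 / 2 + J) / (μ₂ + 1 / 2) *
        ₂F₁ (-(J : ℝ)) (μ₁ + 1 / 2 + (μ₂ + 1 / 2) + J) (μ₂ + 1 / 2 + 1)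
          ((x₂ ^ 2 - x₁ ^ 2) / 2 / ((x₁ ^ 2 - c ^ 2) / 2 + (x₂ ^ 2 - x₁ ^ 2) / 2))) := by
    cases J with
    | zero =>
      rw [mul_zero, bigJacobi_zero, hyp2F1_neg_nat, hyp2F1_neg_nat]
      simp only [Nat.antidiagonal_zero, sum_singleton]
      rw [Nat.cast_zero, add_zero, add_zero, div_self hB0.ne']
      simp
      ring
    | succ J =>
      have h := hyp2F1_contiguous_upper J (μ₁ + 1 / 2 + (μ₂ + 1 / 2) + ((J + 1 : ℕ) : ℝ))
        ((x₂ ^ 2 - x₁ ^ 2) / 2 / ((x₁ ^ 2 - c ^ 2) / 2 + (x₂ ^ 2 - x₁ ^ 2) / 2)) hB0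
      rw [show μ₂ + 1 / 2 + (J : ℝ) + 1 = μ₂ + 1 / 2 + (J + 1 : ℕ) by push_cast; ring] at h
      have ht : (x₂ - c * ε₁ * ε₂) * ((x₂ - x₁ * ε₂) / (x₂ - c * ε₁ * ε₂)) = x₂ - x₁ * ε₂ := by
        field_simp
      rw [bigJacobi_even, jacobi_argument hε₁ hε₂ hx₂, jacobi_factor hx₂, ← h]
      linear_combination (((J : ℝ) + 1) / (μ₂ + 1 / 2) *
        ₂F₁ (-(J : ℝ)) (μ₁ + 1 / 2 + (μ₂ + 1 / 2) + ((J + 1 : ℕ) : ℝ)) (μ₂ + 1 / 2 + 1)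
          ((x₂ ^ 2 - x₁ ^ 2) / 2 / ((x₁ ^ 2 - c ^ 2) / 2 + (x₂ ^ 2 - x₁ ^ 2) / 2))) * ht
  rw [show ∀ q k l m : ℝ, q * (k * (x₂ - c * ε₁ * ε₂) * l) * m *
    bigJacobi (2 * J) (ε₂ * x₁ / x₂) (2 * μ₂) (2 * μ₁) (-(c * ε₁ * ε₂ / x₂)) =
    q * (k * l) * m * ((x₂ - c * ε₁ * ε₂) *
      bigJacobi (2 * J) (ε₂ * x₁ / x₂) (2 * μ₂) (2 * μ₁) (-(c * ε₁ * ε₂ / x₂))) by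
      intros; ring, hcomb, hA2, hB2]
  generalize lag ν _ _ = L
  generalize (₂F₁ (-(J : ℝ)) (μ₁ + 1 / 2 + (μ₂ + 1 / 2) + J) (μ₂ + 1 / 2) _ : ℝ) = F1
  generalize (₂F₁ (-(J : ℝ)) (μ₁ + 1 / 2 + (μ₂ + 1 / 2) + J) (μ₂ + 1 / 2 + 1) _ : ℝ) = F2
  generalize (x₁ ^ 2 - c ^ 2) / 2 + (x₂ ^ 2 - x₁ ^ 2) / 2 = w at hw ⊢
  generalize poch (μ₁ + 1 / 2) J = a at hA1 ⊢
  generalize poch (μ₂ + 1 / 2) J = b at hB1 ⊢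
  rw [show 4 * (J : ℝ) + 2 * μ₂ + 2 * μ₁ + 1 + 2 * μ₁ - 2 * μ₂ + 1 = 4 * (μ₁ + 1 / 2 + J) by ring]
  generalize μ₁ + 1 / 2 = A at hA0 hAJ ⊢
  generalize μ₂ + 1 / 2 = B at hB0 hBJ ⊢
  field_simp
  ring

lemma sum_convTerm_even_odd (ν J : ℕ) :
    ∑ p ∈ antidiagonal (2 * ν + (2 * J + 1)),
        convTerm μ₁ μ₂ ε₁ ε₂ c x₁ x₂ (2 * J + 1) p.1 p.2 =
      2 ^ J * poch (μ₂ + 1 / 2) (J + 1) / poch (μ₁ + 1 / 2) (J + 1) *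
        chiharaMonic (2 * ν) x₂ (muCoupled μ₁ μ₂ (2 * J + 1))
          (c * epsCoupled ε₁ ε₂ (2 * J + 1)) *
        (((x₂ ^ 2 - c ^ 2) / 2) ^ J * (x₂ - c * ε₁ * ε₂)) *
        bigJacobi (2 * J + 1) (ε₂ * x₁ / x₂) (2 * μ₂) (2 * μ₁) (-(c * ε₁ * ε₂ / x₂)) := by
  have hμ : 0 < muCoupled μ₁ μ₂ (2 * J + 1) := by unfold muCoupled; positivity
  have hε : (c * epsCoupled ε₁ ε₂ (2 * J + 1)) ^ 2 = c ^ 2 := by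
    have h1 : (-1 : ℝ) ^ (2 * J + 1) = -1 := Odd.neg_one_pow ⟨J, rfl⟩
    rw [epsCoupled, h1]; simp [mul_pow, hε₁, hε₂]
  have hG : muCoupled μ₁ μ₂ (2 * J + 1) + 1 / 2 =
      μ₁ + 1 / 2 + (μ₂ + 1 / 2) + 1 + 2 * J := by
    rw [muCoupled]; push_cast; ring
  have hW : (x₂ ^ 2 - c ^ 2) / 2 = (x₁ ^ 2 - c ^ 2) / 2 + (x₂ ^ 2 - x₁ ^ 2) / 2 := by ring
  have hgrid : ∀ M, dualHahnGrid (2 * J + 1) μ₂ μ₁ (2 * M + 1) =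
      -(4 * J + 2 + 2 * μ₂ + 2 * μ₁ + 1) := by
    intro M
    rw [dualHahnGrid_of_even ⟨J + M + 1, by ring⟩]; push_cast; ring
  have hsgn : (-1 : ℝ) ^ (J + 1) * (-1) ^ (ν + J) = -(-1) ^ ν := by
    rw [pow_succ, ← neg_one_pow_mul_self J ν]; ring
  have heo := sum_convTerm_eo c x₁ x₂ hμ₁ hμ₂ hε₁ hε₂ hw ν J (2 * J + 1)
    (Or.inr (by rw [hgrid]; ring))
  have hoe := sum_convTerm_oe c x₁ x₂ hμ₁ hμ₂ hε₁ hε₂ hw ν J (2 * J + 1)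
    (Or.inr (by rw [hgrid]; ring))
  rw [neg_one_pow_triangle_odd, mul_right_comm _ (x₂ - x₁ * ε₂),
    factorial_cancel _ _ _ _ _ _ _ _ _ _ hsgn,
    show μ₁ + 1 / 2 + (μ₂ + 1 / 2 + 1) + (J : ℝ) - 1 =
      μ₁ + 1 / 2 + (μ₂ + 1 / 2) + J by ring,
    show μ₁ + 1 / 2 + (μ₂ + 1 / 2 + 1) + 2 * (J : ℝ) =
      μ₁ + 1 / 2 + (μ₂ + 1 / 2) + 1 + 2 * J by ring] at heo
  rw [neg_one_pow_triangle_odd, hgrid, mul_right_comm _ (_ * _ * (_ / _)),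
    factorial_cancel _ _ _ _ _ _ _ _ _ _ hsgn,
    show μ₁ + 1 / 2 + 1 + (μ₂ + 1 / 2) + (J : ℝ) - 1 =
      μ₁ + 1 / 2 + (μ₂ + 1 / 2) + J by ring,
    show μ₁ + 1 / 2 + 1 + (μ₂ + 1 / 2) + 2 * (J : ℝ) =
      μ₁ + 1 / 2 + (μ₂ + 1 / 2) + 1 + 2 * J by ring] at hoe
  rw [chiharaMonic_even _ _ _ hμ, hε, hG, hW,
    show 2 * ν + (2 * J + 1) = 2 * (ν + J) + 1 by ring,
    sum_antidiagonal_odd (convTerm μ₁ μ₂ ε₁ ε₂ c x₁ x₂ (2 * J + 1)), heo, hoe, bigJacobi_odd,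
    jacobi_argument hε₁ hε₂ hx₂, jacobi_factor hx₂]
  have hA0 : 0 < μ₁ + 1 / 2 := by positivity
  have hB0 : 0 < μ₂ + 1 / 2 := by positivity
  have hBJ : 0 < μ₂ + 1 / 2 + J := by positivity
  have hAJ : 0 < μ₁ + 1 / 2 + J := by positivity
  have hA1 := poch_pos hA0 J
  have hB1 := poch_pos hB0 J
  have hA2 : poch (μ₁ + 1 / 2 + 1) J = poch (μ₁ + 1 / 2) J * (μ₁ + 1 / 2 + J) / (μ₁ + 1 / 2) := by
    rw [eq_div_iff hA0.ne', ← poch_succ, poch_succ_left]; ring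
  have hB2 : poch (μ₂ + 1 / 2 + 1) J = poch (μ₂ + 1 / 2) J * (μ₂ + 1 / 2 + J) / (μ₂ + 1 / 2) := by
    rw [eq_div_iff hB0.ne', ← poch_succ, poch_succ_left]; ring
  have h := hyp2F1_contiguous_lower J (μ₁ + 1 / 2 + (μ₂ + 1 / 2) + J)
    ((x₂ ^ 2 - x₁ ^ 2) / 2 / ((x₁ ^ 2 - c ^ 2) / 2 + (x₂ ^ 2 - x₁ ^ 2) / 2)) hB0
  have hd : x₂ - c * ε₁ * ε₂ = (x₂ - x₁ * ε₂) + ε₂ * (x₁ - c * ε₁) := by ring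
  have ht : (x₂ - c * ε₁ * ε₂) * ((x₂ - x₁ * ε₂) / (x₂ - c * ε₁ * ε₂)) = x₂ - x₁ * ε₂ := by
    field_simp
  rw [poch_succ, poch_succ, hA2, hB2]
  generalize lag ν _ _ = L
  -- The order matters: each pattern is looser than the previous one. With `b = A + B + J`, `F1`,
  -- `F2`, `F3` have the parameters `(b, B)`, `(b, B + 1)`, `(b + 1, B + 1)`.
  generalize (₂F₁ (-(J : ℝ)) (μ₁ + 1 / 2 + (μ₂ + 1 / 2) + J) (μ₂ + 1 / 2) _ : ℝ) = F1 at h ⊢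
  generalize (₂F₁ (-(J : ℝ)) (μ₁ + 1 / 2 + (μ₂ + 1 / 2) + J) _ _ : ℝ) = F2 at h ⊢
  generalize (₂F₁ (-(J : ℝ)) _ _ _ : ℝ) = F3 at h ⊢
  generalize (x₁ ^ 2 - c ^ 2) / 2 + (x₂ ^ 2 - x₁ ^ 2) / 2 = w at hw ⊢
  generalize (x₂ - x₁ * ε₂) / (x₂ - c * ε₁ * ε₂) = r at ht ⊢
  generalize x₂ - c * ε₁ * ε₂ = e at ht hd ⊢
  generalize x₂ - x₁ * ε₂ = t at ht hd ⊢
  generalize x₁ - c * ε₁ = u at hd ⊢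
  generalize poch (μ₁ + 1 / 2) J = a at hA1 ⊢
  generalize poch (μ₂ + 1 / 2) J = b at hB1 ⊢
  rw [show -(4 * (J : ℝ) + 2 + 2 * μ₂ + 2 * μ₁ + 1) + 2 * μ₁ - 2 * μ₂ + 1 =
    -(4 * (μ₂ + 1 / 2 + J)) by ring]
  generalize μ₁ + 1 / 2 = A at h hA0 hAJ ⊢
  generalize μ₂ + 1 / 2 = B at h hB0 hBJ ⊢
  have hcomb : e * (F1 - (A + B + J) / B * r * F3) = ε₂ * u * F1 - t * ((A + J) / B) * F2 := by
    have hk : F1 - (A + B + J) / B * F3 = -((A + J) / B) * F2 := by rw [h]; ring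
    calc _ = e * F1 - (A + B + J) / B * (e * r) * F3 := by ring
      _ = ε₂ * u * F1 + t * (F1 - (A + B + J) / B * F3) := by rw [ht, hd]; ring
      _ = _ := by rw [hk]; ring
  rw [show ∀ q k l : ℝ, q * (k * e) * l = q * k * (e * l) by intros; ring, hcomb]
  field_simp
  ring

end

/-! ### Restoring the square roots -/

/-- Only the `μ`-factorials of `n₁` and `n₂`, known to be positive, are moved out of the root, so
the sign of the other factor plays no role. What stays under the root depends on `n₁ + n₂` alone. -/
lemma sqrt_mul_convTerm {μ₁ μ₂ : ℝ} (hμ₁ : 0 < μ₁) (hμ₂ : 0 < μ₂) (ε₁ ε₂ c x₁ x₂ : ℝ)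
    (j n₁ n₂ : ℕ) :
    (-1) ^ phase n₁ n₂ j * (ε₂ / 2) ^ n₁ *
        √(muFactorial n₂ μ₂ * dualHahnRho j μ₂ μ₁ (n₁ + n₂) /
          (muFactorial n₁ μ₁ * muFactorial (n₁ + n₂) μ₂ * dualHahnNorm 0 μ₂ μ₁ (n₁ + n₂))) *
        dualHahn n₁ (dualHahnGrid j μ₂ μ₁ (n₁ + n₂)) μ₂ μ₁ (n₁ + n₂) *
        chihara n₁ x₁ μ₁ (c * ε₁) * chihara n₂ x₂ μ₂ (x₁ * ε₂) =
      √(dualHahnRho j μ₂ μ₁ (n₁ + n₂) /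
          (muFactorial (n₁ + n₂) μ₂ * dualHahnNorm 0 μ₂ μ₁ (n₁ + n₂))) *
        convTerm μ₁ μ₂ ε₁ ε₂ c x₁ x₂ j n₁ n₂ := by
  have h1 := muFactorial_pos n₁ hμ₁
  have h2 := muFactorial_pos n₂ hμ₂
  have h3 : √(muFactorial n₁ μ₁) ≠ 0 := (Real.sqrt_pos.2 h1).ne'
  have h4 : √(muFactorial n₁ μ₁) * √(muFactorial n₁ μ₁) = muFactorial n₁ μ₁ :=
    Real.mul_self_sqrt h1.le
  rw [show muFactorial n₂ μ₂ * dualHahnRho j μ₂ μ₁ (n₁ + n₂) /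
      (muFactorial n₁ μ₁ * muFactorial (n₁ + n₂) μ₂ * dualHahnNorm 0 μ₂ μ₁ (n₁ + n₂)) =
      dualHahnRho j μ₂ μ₁ (n₁ + n₂) /
        (muFactorial (n₁ + n₂) μ₂ * dualHahnNorm 0 μ₂ μ₁ (n₁ + n₂)) *
        (muFactorial n₂ μ₂ / muFactorial n₁ μ₁) by ring,
    Real.sqrt_mul' _ (by positivity), Real.sqrt_div h2.le, convTerm, chiharaMonic, chiharaMonic,
    mul_div_right_comm √(muFactorial n₁ μ₁)]
  have h5 : √(muFactorial n₁ μ₁) / muFactorial n₁ μ₁ = 1 / √(muFactorial n₁ μ₁) := by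
    rw [div_eq_div_iff h1.ne' h3, h4, one_mul]
  rw [h5]
  ring

lemma sqrt_div_muFactorial {g u C m : ℝ} (hC : 0 ≤ C) (hm : 0 < m) (h : g / m = u * C ^ 2) :
    √g / √m = √u * C := by
  rw [← Real.sqrt_div' _ hm.le, h, Real.sqrt_mul' _ (sq_nonneg C), Real.sqrt_sq hC]

lemma chihara_eq (n : ℕ) (x γ : ℝ) {μ : ℝ} (hμ : 0 < μ) :
    chihara n x μ γ = chiharaMonic n x μ γ / √(muFactorial n μ) := by
  have := (Real.sqrt_pos.2 (muFactorial_pos n hμ)).ne'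
  rw [chiharaMonic, mul_div_cancel_left₀ _ this]

/-- Since `|d| < |x|`, the difference `x - d` has the sign of `x`. This explains the factor
`sign(λ₂)^j`: for odd `j` the root produces `|x₂ - c ε₁ ε₂|`. -/
lemma sign_mul_abs_sub {x d : ℝ} (h : |d| < |x|) : Real.sign x * |x - d| = x - d := by
  rcases lt_or_ge 0 x with hx | hx
  · rw [abs_of_pos hx] at h
    rw [Real.sign_of_pos hx, abs_of_pos (by linarith [le_abs_self d]), one_mul]
  · have hx0 : x ≠ 0 := abs_pos.1 ((abs_nonneg _).trans_lt h)
    rw [abs_of_nonpos hx] at h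
    rw [Real.sign_of_neg (lt_of_le_of_ne hx hx0), abs_of_neg (by linarith [neg_abs_le d])]
    ring

lemma sign_pow_even {x : ℝ} (hx : x ≠ 0) (J : ℕ) : Real.sign x ^ (2 * J) = 1 := by
  rw [pow_mul]
  rcases Real.sign_apply_eq_of_ne_zero x hx with h | h <;> rw [h] <;> simp

section

variable {μ₁ μ₂ ε₁ ε₂ c x₂ : ℝ}

lemma convK_even (hμ₁ : 0 < μ₁) (hμ₂ : 0 < μ₂) (hs : x₂ - c * ε₁ * ε₂ ≠ 0)
    (hw : 0 < (x₂ ^ 2 - c ^ 2) / 2) (J : ℕ) :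
    convK (2 * J) x₂ μ₂ μ₁ c ε₁ ε₂ = ((x₂ ^ 2 - c ^ 2) / 2) ^ J *
      √(poch (μ₂ + 1 / 2) J / (poch (μ₁ + 1 / 2) J * J ! *
        poch (μ₁ + 1 / 2 + (μ₂ + 1 / 2) + J) J)) := by
  rw [convK, gamma_div_bigJacobiNorm_even hμ₁ hμ₂, (even_two_mul J).neg_one_pow, one_mul,
    div_self hs, mul_one, Real.sqrt_mul (by positivity), mul_comm 2 J, pow_mul,
    Real.sqrt_sq (by positivity)]

lemma convK_odd (hμ₁ : 0 < μ₁) (hμ₂ : 0 < μ₂) (hε : (c * ε₁ * ε₂) ^ 2 = c ^ 2)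
    (hd : |c * ε₁ * ε₂| < |x₂|) (J : ℕ) :
    Real.sign x₂ ^ (2 * J + 1) * convK (2 * J + 1) x₂ μ₂ μ₁ c ε₁ ε₂ =
      ((x₂ ^ 2 - c ^ 2) / 2) ^ J * (x₂ - c * ε₁ * ε₂) *
      √(poch (μ₂ + 1 / 2) (J + 1) / (poch (μ₁ + 1 / 2) (J + 1) * J ! *
        poch (μ₁ + 1 / 2 + (μ₂ + 1 / 2) + J) (J + 1)) / 2) := by
  have hw : 0 < (x₂ ^ 2 - c ^ 2) / 2 := by rw [← hε]; linarith [sq_lt_sq.2 hd]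
  have hx : x₂ ≠ 0 := abs_pos.1 ((abs_nonneg _).trans_lt hd)
  have hp : x₂ - -1 * c * ε₁ * ε₂ ≠ 0 := by
    intro h0
    have : x₂ ^ 2 = (c * ε₁ * ε₂) ^ 2 := by linear_combination (x₂ - c * ε₁ * ε₂) * h0
    linarith [sq_lt_sq.2 hd]
  -- One factor `x₂² - c²` contains the denominator `x₂ + c ε₁ ε₂`. Cancelling it leaves `(x₂ - c ε₁
  -- ε₂)² / 2` times an even power.
  have key : ((x₂ ^ 2 - c ^ 2) / 2) ^ (2 * J + 1) *
      ((x₂ - c * ε₁ * ε₂) / (x₂ - -1 * c * ε₁ * ε₂)) =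
      (((x₂ ^ 2 - c ^ 2) / 2) ^ J * |x₂ - c * ε₁ * ε₂|) ^ 2 / 2 := by
    rw [mul_div_assoc', div_eq_iff hp, mul_pow, sq_abs, pow_succ, mul_comm 2 J, pow_mul]
    linear_combination ((((x₂ ^ 2 - c ^ 2) / 2) ^ J) ^ 2 * (x₂ - c * ε₁ * ε₂) / 2) * hε
  rw [convK, gamma_div_bigJacobiNorm_odd hμ₁ hμ₂, Odd.neg_one_pow ⟨J, rfl⟩, key,
    div_mul_eq_mul_div, mul_div_assoc, Real.sqrt_mul (sq_nonneg _), Real.sqrt_sq (by positivity),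
    pow_succ, sign_pow_even hx, one_mul]
  linear_combination (((x₂ ^ 2 - c ^ 2) / 2) ^ J *
    √(poch (μ₂ + 1 / 2) (J + 1) / (poch (μ₁ + 1 / 2) (J + 1) * J ! *
      poch (μ₁ + 1 / 2 + (μ₂ + 1 / 2) + J) (J + 1)) / 2)) * sign_mul_abs_sub hd

end

end DunklOP

/-! ### Assembly of the four parity cases. -/

theorem proposition4 (μ₁ μ₂ : ℝ) (hμ₁ : 0 < μ₁) (hμ₂ : 0 < μ₂)
    (ε₁ ε₂ : ℝ) (hε₁ : ε₁ = 1 ∨ ε₁ = -1) (hε₂ : ε₂ = 1 ∨ ε₂ = -1)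
    (c x₁ x₂ : ℝ) (hx₂ : |c| < |x₂|) (N j : ℕ) :
    Real.sign x₂ ^ j * convK j x₂ μ₂ μ₁ c ε₁ ε₂ *
        chihara N x₂ (muCoupled μ₁ μ₂ j) (c * epsCoupled ε₁ ε₂ j) *
        bigJacobi j (ε₂ * x₁ / x₂) (2 * μ₂) (2 * μ₁) (-(c * ε₁ * ε₂ / x₂)) =
      ∑ n ∈ Finset.HasAntidiagonal.antidiagonal (N + j),
        (-1) ^ phase n.1 n.2 j * (ε₂ / 2) ^ n.1 *
          √(muFactorial n.2 μ₂ * dualHahnRho j μ₂ μ₁ (n.1 + n.2) /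
            (muFactorial n.1 μ₁ * muFactorial (n.1 + n.2) μ₂ *
              dualHahnNorm 0 μ₂ μ₁ (n.1 + n.2))) *
          dualHahn n.1 (dualHahnGrid j μ₂ μ₁ (n.1 + n.2)) μ₂ μ₁ (n.1 + n.2) *
          chihara n.1 x₁ μ₁ (c * ε₁) * chihara n.2 x₂ μ₂ (x₁ * ε₂) := by
  have hε₁' : ε₁ ^ 2 = 1 := sq_eq_one_iff.2 hε₁
  have hε₂' : ε₂ ^ 2 = 1 := sq_eq_one_iff.2 hε₂
  have hε : (c * ε₁ * ε₂) ^ 2 = c ^ 2 := by simp [mul_pow, hε₁', hε₂']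
  have hd : |c * ε₁ * ε₂| < |x₂| := by rwa [sq_eq_sq_iff_abs_eq_abs _ _ |>.1 hε]
  have hW : 0 < (x₂ ^ 2 - c ^ 2) / 2 := by linarith [sq_lt_sq.2 hx₂]
  have hw : (x₁ ^ 2 - c ^ 2) / 2 + (x₂ ^ 2 - x₁ ^ 2) / 2 ≠ 0 := by
    rw [show (x₁ ^ 2 - c ^ 2) / 2 + (x₂ ^ 2 - x₁ ^ 2) / 2 = (x₂ ^ 2 - c ^ 2) / 2 by ring]
    exact hW.ne'
  have hx : x₂ ≠ 0 := abs_pos.1 ((abs_nonneg _).trans_lt hx₂)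
  have hs : x₂ - c * ε₁ * ε₂ ≠ 0 := by
    intro h0; rw [sub_eq_zero.1 h0] at hd; exact lt_irrefl _ hd
  have hμ : 0 < muCoupled μ₁ μ₂ j := by unfold muCoupled; positivity
  have hm := muFactorial_pos N hμ
  -- On the antidiagonal `n₁ + n₂` is the constant `N + j`, so the remaining root is the same for
  -- all terms and can leave the sum.
  have hsum : ∀ n ∈ Finset.HasAntidiagonal.antidiagonal (N + j), _ = _ := fun n hn =>
    (sqrt_mul_convTerm hμ₁ hμ₂ ε₁ ε₂ c x₁ x₂ j n.1 n.2).trans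
      (by rw [Finset.HasAntidiagonal.mem_antidiagonal.1 hn])
  rw [Finset.sum_congr rfl hsum, ← Finset.mul_sum, chihara_eq N _ _ hμ]
  have hA : 0 < μ₁ + 1 / 2 := by positivity
  have hB : 0 < μ₂ + 1 / 2 := by positivity
  obtain ⟨J, rfl | rfl⟩ := Nat.even_or_odd' j
  · have hC : 0 ≤ 2 ^ J * poch (μ₂ + 1 / 2) J / poch (μ₁ + 1 / 2) J := by
      have := poch_pos hA J
      have := poch_pos hB J
      positivity
    rw [sign_pow_even hx, one_mul, convK_even hμ₁ hμ₂ hs hW]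
    obtain ⟨ν, rfl | rfl⟩ := Nat.even_or_odd' N
    · have hr := sqrt_div_muFactorial hC hm (norm_ratio_ee hμ₁ hμ₂ ν J)
      rw [sum_convTerm_even_even hμ₁ hμ₂ hε₁' hε₂' hw hx hs,
        show 2 * ν + 2 * J = 2 * (ν + J) by ring]
      linear_combination (((x₂ ^ 2 - c ^ 2) / 2) ^ J * chiharaMonic (2 * ν) x₂ _ _ *
        bigJacobi (2 * J) (ε₂ * x₁ / x₂) (2 * μ₂) (2 * μ₁) (-(c * ε₁ * ε₂ / x₂))) * hr
    · have hr := sqrt_div_muFactorial hC hm (norm_ratio_eo hμ₁ hμ₂ ν J)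
      rw [sum_convTerm_odd_even hμ₁ hμ₂ hε₁' hε₂' hw hx hs,
        show 2 * ν + 1 + 2 * J = 2 * (ν + J) + 1 by ring]
      linear_combination (((x₂ ^ 2 - c ^ 2) / 2) ^ J * chiharaMonic (2 * ν + 1) x₂ _ _ *
        bigJacobi (2 * J) (ε₂ * x₁ / x₂) (2 * μ₂) (2 * μ₁) (-(c * ε₁ * ε₂ / x₂))) * hr
  · have hC : 0 ≤ 2 ^ J * poch (μ₂ + 1 / 2) (J + 1) / poch (μ₁ + 1 / 2) (J + 1) := by
      have := poch_pos hA (J + 1)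
      have := poch_pos hB (J + 1)
      positivity
    rw [convK_odd hμ₁ hμ₂ hε hd]
    obtain ⟨ν, rfl | rfl⟩ := Nat.even_or_odd' N
    · have hr := sqrt_div_muFactorial hC hm (norm_ratio_oo hμ₁ hμ₂ ν J)
      rw [sum_convTerm_even_odd hμ₁ hμ₂ hε₁' hε₂' hw hx hs,
        show 2 * ν + (2 * J + 1) = 2 * (ν + J) + 1 by ring]
      linear_combination (((x₂ ^ 2 - c ^ 2) / 2) ^ J * (x₂ - c * ε₁ * ε₂) *
        chiharaMonic (2 * ν) x₂ _ _ *
        bigJacobi (2 * J + 1) (ε₂ * x₁ / x₂) (2 * μ₂) (2 * μ₁) (-(c * ε₁ * ε₂ / x₂))) * hr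
    · have hr := sqrt_div_muFactorial hC hm (norm_ratio_oe hμ₁ hμ₂ ν J)
      rw [sum_convTerm_odd_odd hμ₁ hμ₂ hε₁' hε₂' hw hx hs,
        show 2 * ν + 1 + (2 * J + 1) = 2 * (ν + (J + 1)) by ring]
      linear_combination (((x₂ ^ 2 - c ^ 2) / 2) ^ J * (x₂ - c * ε₁ * ε₂) *
        chiharaMonic (2 * ν + 1) x₂ _ _ *
        bigJacobi (2 * J + 1) (ε₂ * x₁ / x₂) (2 * μ₂) (2 * μ₁) (-(c * ε₁ * ε₂ / x₂))) * hr
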